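/- Let $n\ge 1$, let $B^{n+1}\subset\mathbb R^{n+1}$ be the open unit ball, and let $M^n$ be a compact smooth manifold with nonempty boundary, not necessarily connected. Let $x:M\to\mathbb R^{n+1}$ be a smooth immersion with a smooth unit normal field $N$, such that $x(\operatorname{int}M)\subset B^{n+1}$ and $x(\partial M)\subset\partial B^{n+1}$. Let $T$ be a generalized body enclosed by $x(M)$ and a region $\Omega$ (the wetted part) of $\partial B^{n+1}$, with $N$ pointing into $T$; that is, $T$ is a nonempty finite family of nonempty open sets $T_1,\dots,T_k\subset B^{n+1}$, possibly overlapping, whose oriented boundary in $B^{n+1}$, counted with multiplicity, is $x(M)$ with inner normal $N$: $$\sum_{i=1}^k\int_{T_i}\operatorname{div}Y\,dv=-\int_M\langle Y\circ x,N\rangle\,da\qquad\text{for all } Y\in C_c^\infty(B^{n+1},\mathbb R^{n+1}),$$ where $da$ is the area element of the metric induced by $x$; the rest of the boundary of $T$ is $\Omega\subset\partial B^{n+1}$. Let $\sigma$ be the second fundamental form of $x$ with respect to $N$, let $\nu$ be the outward unit conormal of $\partial M$ in $M$, and let $\bar\nu$ be the outward unit conormal of $\Omega$ along $x(\partial M)$,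 that is, $\bar\nu=\langle x,N\rangle\nu-\langle x,\nu\rangle N$. Suppose that $x$ is capillary: its mean curvature $H=\frac1n\operatorname{tr}\sigma$ is constant, and the angle between $\nu$ and $\bar\nu$ is a constant $\theta\in(0,\pi)$ along $\partial M$. If the mass center of $T$, $\big(\sum_i|T_i|\big)^{-1}\sum_i\int_{T_i}y\,dv(y)$, is the origin, then $M$ is (weakly) unstable: there is a smooth function $f$ on $M$ with $\int_M f\,da=0$ and $$\partial^2E(f)=-\int_M\big(\Delta f+|\sigma|^2f\big)f\,da+\int_{\partial M}\Big(\frac{\partial f}{\partial\nu}-qf\Big)f\,ds<0,\qquad q=\frac1{\sin\theta}+\cot\theta\,\sigma(\nu,\nu),$$ where $\Delta$ is the Laplace–Beltrami operator of the induced metric and $ds$ the area element of $\partial M$. -/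

import Mathlib

open Set MeasureTheory
open scoped Manifold ContDiff RealInnerProductSpace

noncomputable section

namespace Capillary

/-! Throughout, `M` is a manifold with boundary of dimension `n = m + 1`, modelled on the half space
`{u ∈ ℝⁿ | 0 ≤ u 0}`, and `x : M → ℝⁿ⁺¹` is a map (later: an immersion) with unit normal `N`.
Mathlib identifies the tangent space at `p` with `ℝⁿ` through the preferred chart at `p`, so the
vectors `EuclideanSpace.single i 1` are the coordinate vectors of that chart. -/

section Pointwise

variable (m : ℕ) {M : Type*} [TopologicalSpace M] [ChartedSpace (EuclideanHalfSpace (m + 1)) M]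

/-- The differential at `p` of a map from `M` to a normed space. -/
def differential {F : Type*} [NormedAddCommGroup F] [NormedSpace ℝ F] (f : M → F) (p : M) :
    EuclideanSpace ℝ (Fin (m + 1)) →L[ℝ] F :=
  mfderiv (𝓡∂ (m + 1)) 𝓘(ℝ, F) f p

/-- The `i`-th partial derivative at `p`, in the preferred chart at `p`. -/
def partialDeriv {F : Type*} [NormedAddCommGroup F] [NormedSpace ℝ F] (f : M → F) (p : M)
    (i : Fin (m + 1)) : F :=
  differential m f p (EuclideanSpace.single i 1)

variable {m}
variable (x N : M → EuclideanSpace ℝ (Fin (m + 2)))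

/-- The matrix `g_ij = ⟨∂ᵢx, ∂ⱼx⟩` of the induced metric (first fundamental form) at `p`. -/
def metricMatrix (p : M) : Matrix (Fin (m + 1)) (Fin (m + 1)) ℝ :=
  Matrix.of fun i j => ⟪partialDeriv m x p i, partialDeriv m x p j⟫

/-- The second fundamental form with respect to `N`:
`σ(v, w) = ⟨D_v W, N⟩ = -⟨D_v N, w⟩` for tangent vectors `v, w` at `p`. -/
def secondForm (p : M) (v w : EuclideanSpace ℝ (Fin (m + 1))) : ℝ :=
  -⟪differential m N p v, differential m x p w⟫

/-- The matrix `h_ij = σ(∂ᵢ, ∂ⱼ)`. -/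
def secondFormMatrix (p : M) : Matrix (Fin (m + 1)) (Fin (m + 1)) ℝ :=
  Matrix.of fun i j =>
    secondForm x N p (EuclideanSpace.single i 1) (EuclideanSpace.single j 1)

/-- The mean curvature `H = (1/n) g^{ij} h_ij`. -/
def meanCurvature (p : M) : ℝ :=
  ((m : ℝ) + 1)⁻¹ * ((metricMatrix x p)⁻¹ * secondFormMatrix x N p).trace

/-- The squared norm `|σ|² = g^{ij} h_jk g^{kl} h_il` of the second fundamental form. -/
def secondFormNormSq (p : M) : ℝ :=
  ((metricMatrix x p)⁻¹ * secondFormMatrix x N p *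
    (metricMatrix x p)⁻¹ * (secondFormMatrix x N p).transpose).trace

/-- The gradient on `M` of a function `f`, as a vector of the ambient space tangent to `x`:
`∇f = g^{ij} ∂ᵢf ∂ⱼx`. -/
def gradient (f : M → ℝ) (p : M) : EuclideanSpace ℝ (Fin (m + 2)) :=
  ∑ i, ∑ j, ((metricMatrix x p)⁻¹ i j * partialDeriv m f p i) • partialDeriv m x p j

/-- The divergence along `M` of a vector field `V` along `x`: `div_M V = g^{ij} ⟨∂ᵢV, ∂ⱼx⟩`. -/
def divergence (V : M → EuclideanSpace ℝ (Fin (m + 2))) (p : M) : ℝ :=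
  ∑ i, ∑ j, (metricMatrix x p)⁻¹ i j * ⟪partialDeriv m V p i, partialDeriv m x p j⟫

/-- The Laplace–Beltrami operator of the induced metric. -/
def laplacian (f : M → ℝ) (p : M) : ℝ :=
  divergence x (gradient x f) p

/-- At a boundary point `p`: the outward unit conormal of `∂M` in `M`, as a tangent vector at `p`.
It is `-∇u₀/|∇u₀|`, where `u₀` is the coordinate that vanishes on `∂M` and is positive inside. -/
def conormalTangent (p : M) : EuclideanSpace ℝ (Fin (m + 1)) :=
  WithLp.toLp 2 fun j => -((metricMatrix x p)⁻¹ j 0) / Real.sqrt ((metricMatrix x p)⁻¹ 0 0)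

/-- The outward unit conormal `ν` of `∂M` in `M`, as a vector of the ambient space. -/
def conormal (p : M) : EuclideanSpace ℝ (Fin (m + 2)) :=
  differential m x p (conormalTangent x p)

/-- The outward unit conormal `ν̄` of the wetted region `Ω` along `∂M`. At a boundary point, the
plane normal to `∂M` has the two orthonormal bases `(N, ν)` and `(x, ν̄)`, where `x` is the outward
normal of the unit sphere. As `N` points into the body and `ν`, `ν̄` point out of `M`, `Ω`, these
bases have the same orientation, so `ν̄` is the image of `x` under the rotation `N ↦ ν ↦ -N`. -/
def wettedConormal (p : M) : EuclideanSpace ℝ (Fin (m + 2)) :=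
  ⟪x p, N p⟫ • conormal x p - ⟪x p, conormal x p⟫ • N p

/-- `x : M → ℝⁿ⁺¹` is a smooth immersed hypersurface in the closed unit ball, with smooth unit
normal field `N`, that meets the unit sphere exactly along `∂M`, and `∂M` is not empty. -/
structure IsImmersedInBall : Prop where
  smooth : ContMDiff (𝓡∂ (m + 1)) 𝓘(ℝ, EuclideanSpace ℝ (Fin (m + 2))) ∞ x
  immersion : ∀ p, Function.Injective (differential m x p)
  normal_smooth : ContMDiff (𝓡∂ (m + 1)) 𝓘(ℝ, EuclideanSpace ℝ (Fin (m + 2))) ∞ N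
  normal_norm : ∀ p, ‖N p‖ = 1
  normal_orthogonal : ∀ p v, ⟪N p, differential m x p v⟫ = 0
  interior_mem : ∀ p ∈ (𝓡∂ (m + 1)).interior M, x p ∈ Metric.ball 0 1
  boundary_mem : ∀ p ∈ (𝓡∂ (m + 1)).boundary M, x p ∈ Metric.sphere 0 1
  boundary_nonempty : ((𝓡∂ (m + 1)).boundary M).Nonempty

/-- An immersed capillary hypersurface in the unit ball: constant mean curvature, and constant
contact angle `θ ∈ (0, π)` with the unit sphere, the angle between `ν` and `ν̄`. -/
structure IsCapillary (θ : ℝ) : Prop extends IsImmersedInBall x N where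
  angle_mem : θ ∈ Ioo 0 Real.pi
  constant_meanCurvature : ∃ H : ℝ, ∀ p, meanCurvature x N p = H
  contact_angle : ∀ p ∈ (𝓡∂ (m + 1)).boundary M,
    InnerProductGeometry.angle (conormal x p) (wettedConormal x N p) = θ

end Pointwise

section Measures

variable {m : ℕ} {M : Type*} [TopologicalSpace M] [ChartedSpace (EuclideanHalfSpace (m + 1)) M]
  [MeasurableSpace M]
variable (x N : M → EuclideanSpace ℝ (Fin (m + 2)))

/-- The partial derivatives of `x` in the chart around `p`, at the coordinate point `u`. -/
def chartPartial (p : M) (u : EuclideanSpace ℝ (Fin (m + 1))) (i : Fin (m + 1)) :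
    EuclideanSpace ℝ (Fin (m + 2)) :=
  fderivWithin ℝ (x ∘ (extChartAt (𝓡∂ (m + 1)) p).symm) (range (𝓡∂ (m + 1))) u
    (EuclideanSpace.single i 1)

/-- The area measure on the domain of the chart around `p`: the image of `√(det g_ij) du`. -/
def chartArea (p : M) : Measure M :=
  Measure.map (extChartAt (𝓡∂ (m + 1)) p).symm
    ((volume.restrict (extChartAt (𝓡∂ (m + 1)) p).target).withDensity fun u =>
      ENNReal.ofReal (Real.sqrt (Matrix.of fun i j : Fin (m + 1) =>
        ⟪chartPartial x p u i, chartPartial x p u j⟫).det))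

/-- The area element `da` of the metric induced on `M` by `x`. The measures of the charts agree on
overlaps, so that their supremum is the measure which restricts to each of them. -/
def area : Measure M := ⨆ p : M, chartArea x p

/-- The inclusion `u ↦ (0, u)` of `ℝⁿ⁻¹` as the boundary of the half space of `ℝⁿ`. -/
def boundaryInclusion (u : EuclideanSpace ℝ (Fin m)) : EuclideanSpace ℝ (Fin (m + 1)) :=
  WithLp.toLp 2 (Fin.cons (0 : ℝ) fun i => u i)

/-- The area measure of `∂M` on the domain of the chart around `p`: the image under
`u ↦ (0, u)` of `√(det (g_ij)_{i,j ≥ 1}) du`. For `n = 1` it is the counting measure. -/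
def chartBoundaryArea (p : M) : Measure M :=
  Measure.map (fun u => (extChartAt (𝓡∂ (m + 1)) p).symm (boundaryInclusion u))
    ((volume.restrict (boundaryInclusion ⁻¹' (extChartAt (𝓡∂ (m + 1)) p).target)).withDensity
      fun u => ENNReal.ofReal (Real.sqrt (Matrix.of fun i j : Fin m =>
        ⟪chartPartial x p (boundaryInclusion u) i.succ,
          chartPartial x p (boundaryInclusion u) j.succ⟫).det))

/-- The area element `ds` of `∂M`, as a measure on `M` that is carried by `∂M`. -/
def boundaryArea : Measure M := ⨆ p : M, chartBoundaryArea x p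

/-- The second variation of energy
`∂²E(f) = -∫_M (Δf + |σ|² f) f da + ∫_∂M (∂f/∂ν - q f) f ds`, with
`q = 1 / sin θ + cot θ σ(ν, ν)`. -/
def secondVariation (θ : ℝ) (f : M → ℝ) : ℝ :=
  -(∫ p, (laplacian x f p + secondFormNormSq x N p * f p) * f p ∂(area x)) +
    ∫ p, (differential m f p (conormalTangent x p) -
      (1 / Real.sin θ +
        Real.cot θ * secondForm x N p (conormalTangent x p) (conormalTangent x p)) * f p) * f p
      ∂(boundaryArea x)

/-- Weak stability: `∂²E(f) ≥ 0` for all smooth functions `f` (up to the boundary) of mean zero. -/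
def IsWeaklyStable (θ : ℝ) : Prop :=
  ∀ f : M → ℝ, ContMDiff (𝓡∂ (m + 1)) 𝓘(ℝ, ℝ) ∞ f →
    ∫ p, f p ∂(area x) = 0 → 0 ≤ secondVariation x N θ f

/-- The divergence of a vector field on Euclidean space. -/
def euclideanDiv {k : ℕ} (Y : EuclideanSpace ℝ (Fin k) → EuclideanSpace ℝ (Fin k))
    (y : EuclideanSpace ℝ (Fin k)) : ℝ :=
  ∑ i, fderiv ℝ Y y (EuclideanSpace.single i 1) i

/-- The generalized body `T` enclosed by `x(M)` and the wetted region `Ω` of the sphere: a finite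
family of nonempty open subsets `T i` of the unit ball, which may overlap, whose boundary consists
of `x(M)`, with `N` as the normal pointing into `T`, and of a part `Ω` of the unit sphere. As `x(M)`
may have self-intersections, the boundary is that of the chain `∑ᵢ T i`, that is, oriented and
counted with multiplicity; in the open ball it is `x(M)` and nothing else. In the language of
geometric measure theory, the distributional gradient of the multiplicity function `∑ᵢ 1_{T i}` in
the open ball is the vector measure `N da`. The rest of the boundary lies on the sphere: it is `Ω`,
which `T` determines. -/
structure IsGeneralizedBody {k : ℕ} (T : Fin k → Set (EuclideanSpace ℝ (Fin (m + 2)))) :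
    Prop where
  pos : 0 < k
  isOpen : ∀ i, IsOpen (T i)
  nonempty : ∀ i, (T i).Nonempty
  subset_ball : ∀ i, T i ⊆ Metric.ball 0 1
  boundary_eq : ∀ Y : EuclideanSpace ℝ (Fin (m + 2)) → EuclideanSpace ℝ (Fin (m + 2)),
    ContDiff ℝ ∞ Y → HasCompactSupport Y → tsupport Y ⊆ Metric.ball 0 1 →
      ∑ i, ∫ y in T i, euclideanDiv Y y = -∫ p, ⟪Y (x p), N p⟫ ∂(area x)

/-- The mass center of a generalized body, overlaps being counted with multiplicity. -/
def massCenter {k d : ℕ} (T : Fin k → Set (EuclideanSpace ℝ (Fin d))) : EuclideanSpace ℝ (Fin d) :=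
  (∑ i, volume.real (T i))⁻¹ • ∑ i, ∫ y in T i, y

end Measures

end Capillary

end

/-! Write n = m + 1. For a fixed vector a, the field X_a(y) = ⟨a, y⟩ y - ((|y|² + 1)/2) a is
conformal and tangent to the unit sphere: it generates conformal automorphisms of the ball. Its
normal component f_a = ⟨X_a ∘ x, N⟩ (`testFunction`) is the test function, and three facts make it
useful.

Mean zero: div X_a = (n + 1)⟨a, y⟩, and the sphere contributes no flux because X_a is tangent to it.
So ∫ f_a is a multiple of ⟨a, ∑ᵢ ∫_{Tᵢ} y⟩, which vanishes when the mass center is the origin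
(`IsGeneralizedBody.integral_testFunction`).

Jacobi operator: Δx = nH N, and ΔN = -|σ|² N because H is constant. These give Δf_a + |σ|² f_a = -n
(H⟨a, x⟩ + ⟨a, N⟩) (`IsImmersedInBall.laplacian_testFunction`).

Boundary condition: along ∂M one has x = cos θ N + sin θ ν, and ν is a principal direction, whence
∂f_a/∂ν = q f_a (`IsCapillary.testFunction_boundary`). The boundary integral in the second variation
therefore vanishes.

Sum over an orthonormal basis of vectors a, and put w = (|x|² - 1)/2. The integrand becomes n w (1 +
H⟨x, N⟩) - n |xᵀ|², where |xᵀ|² = |x|² - ⟨x, N⟩². Here n (1 + H⟨x, N⟩) = Δw, w vanishes on ∂M and ∇w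
= xᵀ, so Green's formula gives ∑ ∂²E(f_a) = -(n + 1) ∫ |xᵀ|² (`IsCapillary.sum_secondVariation`).
The last integral is positive: if x were normal everywhere, |x| would be locally constant, although
it equals 1 on ∂M and is smaller than 1 inside. Hence ∂²E(f_a) < 0 for some basis vector a.

Neither integration by parts uses a boundary version of Stokes' theorem. Both use a cutoff in |x|²
or |y|²; the factor 1 - |y|² in w and in ⟨y, X_a⟩ absorbs the derivative of the cutoff, and
dominated convergence removes it. -/

noncomputable section

namespace Capillary

/-! ### Traces with respect to a pulled back inner product -/

section Gram

variable {n : ℕ} {F : Type*} [NormedAddCommGroup F] [InnerProductSpace ℝ F]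

/-- The Gram matrix of the coordinate vectors under a linear map. -/
def gramMatrix (L : EuclideanSpace ℝ (Fin n) →L[ℝ] F) : Matrix (Fin n) (Fin n) ℝ :=
  Matrix.of fun i j => ⟪L (EuclideanSpace.single i 1), L (EuclideanSpace.single j 1)⟫

/-- The trace of `B` with respect to the inner product pulled back by `L`. -/
def gramTrace (L : EuclideanSpace ℝ (Fin n) →L[ℝ] F)
    (B : EuclideanSpace ℝ (Fin n) → EuclideanSpace ℝ (Fin n) → ℝ) : ℝ :=
  ∑ i, ∑ j, (gramMatrix L)⁻¹ i j * B (EuclideanSpace.single i 1) (EuclideanSpace.single j 1)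

theorem sum_smul_single (v : EuclideanSpace ℝ (Fin n)) :
    ∑ i, v i • EuclideanSpace.single i (1 : ℝ) = v := by
  ext j
  simp [Finset.sum_apply, Pi.single_apply]

theorem map_eq_sum_smul_single {Z : Type*} [AddCommGroup Z] [Module ℝ Z]
    (A : EuclideanSpace ℝ (Fin n) →ₗ[ℝ] Z) (v : EuclideanSpace ℝ (Fin n)) :
    A v = ∑ i, v i • A (EuclideanSpace.single i 1) := by
  conv_lhs => rw [← sum_smul_single v]
  simp

theorem gramMatrix_transpose (L : EuclideanSpace ℝ (Fin n) →L[ℝ] F) :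
    (gramMatrix L).transpose = gramMatrix L := by
  ext i j
  simp [gramMatrix, real_inner_comm]

theorem gramMatrix_inv_symm (L : EuclideanSpace ℝ (Fin n) →L[ℝ] F) (i j : Fin n) :
    (gramMatrix L)⁻¹ i j = (gramMatrix L)⁻¹ j i := by
  conv_lhs => rw [← gramMatrix_transpose L, ← Matrix.transpose_nonsing_inv]
  rfl

theorem gramMatrix_posDef {L : EuclideanSpace ℝ (Fin n) →L[ℝ] F} (hL : Function.Injective L) :
    (gramMatrix L).PosDef := by
  have : gramMatrix L = Matrix.gram ℝ fun i => L (EuclideanSpace.single i 1) := by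
    ext i j; simp [gramMatrix, Matrix.gram]
  rw [this]
  apply Matrix.posDef_gram_of_linearIndependent
  have h := (EuclideanSpace.basisFun (Fin n) ℝ).toBasis.linearIndependent
  have h2 := h.map' (L : EuclideanSpace ℝ (Fin n) →ₗ[ℝ] F) (LinearMap.ker_eq_bot.2 hL)
  have e : (fun i => L (EuclideanSpace.single i 1)) =
      (L : EuclideanSpace ℝ (Fin n) →ₗ[ℝ] F) ∘ (EuclideanSpace.basisFun (Fin n) ℝ).toBasis := by
    ext i; simp
  rw [e]
  exact h2

theorem gramMatrix_det_pos {L : EuclideanSpace ℝ (Fin n) →L[ℝ] F} (hL : Function.Injective L) :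
    0 < (gramMatrix L).det := (gramMatrix_posDef hL).det_pos

theorem gramMatrix_inv_mul {L : EuclideanSpace ℝ (Fin n) →L[ℝ] F} (hL : Function.Injective L) :
    (gramMatrix L)⁻¹ * gramMatrix L = 1 :=
  Matrix.nonsing_inv_mul _ (gramMatrix_det_pos hL).ne'.isUnit

theorem gramTrace_congr {L : EuclideanSpace ℝ (Fin n) →L[ℝ] F}
    {B C : EuclideanSpace ℝ (Fin n) → EuclideanSpace ℝ (Fin n) → ℝ}
    (h : ∀ v w, B v w = C v w) : gramTrace L B = gramTrace L C := by
  simp [gramTrace, h]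

theorem gramTrace_comm (L : EuclideanSpace ℝ (Fin n) →L[ℝ] F)
    (B : EuclideanSpace ℝ (Fin n) → EuclideanSpace ℝ (Fin n) → ℝ) :
    gramTrace L B = gramTrace L fun v w => B w v := by
  unfold gramTrace
  rw [Finset.sum_comm]
  simp_rw [gramMatrix_inv_symm L]

theorem gramTrace_add (L : EuclideanSpace ℝ (Fin n) →L[ℝ] F)
    (B C : EuclideanSpace ℝ (Fin n) → EuclideanSpace ℝ (Fin n) → ℝ) :
    (gramTrace L fun v w => B v w + C v w) = gramTrace L B + gramTrace L C := by
  simp [gramTrace, mul_add, Finset.sum_add_distrib]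

theorem gramTrace_neg (L : EuclideanSpace ℝ (Fin n) →L[ℝ] F)
    (B : EuclideanSpace ℝ (Fin n) → EuclideanSpace ℝ (Fin n) → ℝ) :
    (gramTrace L fun v w => -B v w) = -gramTrace L B := by
  simp [gramTrace]

theorem gramTrace_sub (L : EuclideanSpace ℝ (Fin n) →L[ℝ] F)
    (B C : EuclideanSpace ℝ (Fin n) → EuclideanSpace ℝ (Fin n) → ℝ) :
    (gramTrace L fun v w => B v w - C v w) = gramTrace L B - gramTrace L C := by
  simp [gramTrace, mul_sub, Finset.sum_sub_distrib]

theorem gramTrace_const_mul (L : EuclideanSpace ℝ (Fin n) →L[ℝ] F) (c : ℝ)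
    (B : EuclideanSpace ℝ (Fin n) → EuclideanSpace ℝ (Fin n) → ℝ) :
    (gramTrace L fun v w => c * B v w) = c * gramTrace L B := by
  simp [gramTrace, Finset.mul_sum, mul_left_comm]

theorem gramTrace_sum {ι : Type*} (s : Finset ι) (L : EuclideanSpace ℝ (Fin n) →L[ℝ] F)
    (B : ι → EuclideanSpace ℝ (Fin n) → EuclideanSpace ℝ (Fin n) → ℝ) :
    (gramTrace L fun v w => ∑ b ∈ s, B b v w) = ∑ b ∈ s, gramTrace L (B b) := by
  classical
  induction s using Finset.induction_on with
  | empty => simp [gramTrace]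
  | insert a s ha ih => simp only [Finset.sum_insert ha, gramTrace_add, ih]

/-- The trace is independent of the linear coordinates. -/
theorem gramTrace_comp (L : EuclideanSpace ℝ (Fin n) →L[ℝ] F)
    (A : EuclideanSpace ℝ (Fin n) ≃L[ℝ] EuclideanSpace ℝ (Fin n))
    (B : EuclideanSpace ℝ (Fin n) →ₗ[ℝ] EuclideanSpace ℝ (Fin n) →ₗ[ℝ] ℝ) :
    gramTrace (L ∘L (A : EuclideanSpace ℝ (Fin n) →L[ℝ] EuclideanSpace ℝ (Fin n)))
      (fun v w => B (A v) (A w)) = gramTrace L fun v w => B v w := by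
  set a : Matrix (Fin n) (Fin n) ℝ := Matrix.of fun k i => A (EuclideanSpace.single i 1) k with ha
  set b : Matrix (Fin n) (Fin n) ℝ :=
    Matrix.of fun i j => B (EuclideanSpace.single i 1) (EuclideanSpace.single j 1) with hb
  have key : ∀ C : EuclideanSpace ℝ (Fin n) →ₗ[ℝ] EuclideanSpace ℝ (Fin n) →ₗ[ℝ] ℝ,
      (Matrix.of fun i j => C (A (EuclideanSpace.single i 1)) (A (EuclideanSpace.single j 1))) =
      a.transpose * (Matrix.of fun i j =>
        C (EuclideanSpace.single i 1) (EuclideanSpace.single j 1)) * a := by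
    intro C
    ext i j
    rw [Matrix.of_apply, map_eq_sum_smul_single C (A _), Matrix.mul_assoc]
    simp only [LinearMap.sum_apply, LinearMap.smul_apply, Matrix.mul_apply, Matrix.transpose_apply,
      smul_eq_mul, ha, Matrix.of_apply]
    refine Finset.sum_congr rfl fun k _ => ?_
    rw [map_eq_sum_smul_single (C _) (A _)]
    simp [mul_comm]
  have hg : gramMatrix (L ∘L (A : EuclideanSpace ℝ (Fin n) →L[ℝ] EuclideanSpace ℝ (Fin n))) =
      a.transpose * gramMatrix L * a := by
    have := key ((innerₗ F).compl₁₂ (L : EuclideanSpace ℝ (Fin n) →ₗ[ℝ] F)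
      (L : EuclideanSpace ℝ (Fin n) →ₗ[ℝ] F))
    simpa [gramMatrix] using this
  have hau : IsUnit a.det := by
    refine Matrix.isUnit_det_of_left_inverse (B := Matrix.of fun k i =>
      A.symm (EuclideanSpace.single i 1) k) ?_
    ext i j
    have h := congrArg (fun v : EuclideanSpace ℝ (Fin n) => v i)
      (map_eq_sum_smul_single (A.symm : EuclideanSpace ℝ (Fin n) →ₗ[ℝ] _)
        (A (EuclideanSpace.single j 1)))
    simp only [Matrix.mul_apply, Matrix.of_apply, ha]
    simp only [Matrix.one_apply]
    simp at h
    rw [h]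
    exact Finset.sum_congr rfl fun k _ => mul_comm _ _
  have htr : ∀ P Q : Matrix (Fin n) (Fin n) ℝ,
      ∑ i, ∑ j, P i j * Q i j = (P * Q.transpose).trace := by
    intro P Q
    simp [Matrix.trace, Matrix.mul_apply]
  have h1 := htr (gramMatrix L)⁻¹ b
  have h2 := htr (a.transpose * gramMatrix L * a)⁻¹ (a.transpose * b * a)
  unfold gramTrace
  rw [hg]
  have e2 : ∀ i j, B (A (EuclideanSpace.single i 1)) (A (EuclideanSpace.single j 1)) =
      (a.transpose * b * a) i j := fun i j => by rw [hb, ← key B]; rfl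
  simp_rw [e2]
  rw [h2]
  refine Eq.trans ?_ h1.symm
  have hau' : IsUnit a.transpose.det := by rwa [Matrix.det_transpose]
  -- The inverse of the new Gram matrix is `a⁻¹ * G⁻¹ * aᵀ⁻¹`. The factors `aᵀ` cancel, and the
  -- remaining conjugation by `a` is invisible to the trace.
  rw [Matrix.mul_inv_rev, Matrix.mul_inv_rev, Matrix.transpose_mul, Matrix.transpose_mul,
    Matrix.transpose_transpose]
  have : a⁻¹ * ((gramMatrix L)⁻¹ * a.transpose⁻¹) * (a.transpose * (b.transpose * a)) =
      a⁻¹ * ((gramMatrix L)⁻¹ * b.transpose * a) := by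
    rw [Matrix.mul_assoc, Matrix.mul_assoc, ← Matrix.mul_assoc a.transpose⁻¹,
      Matrix.nonsing_inv_mul _ hau', Matrix.one_mul]
    simp only [Matrix.mul_assoc]
  rw [this, Matrix.trace_mul_comm, Matrix.mul_assoc, Matrix.mul_nonsing_inv _ hau, Matrix.mul_one]

/-- The Gram matrix changes by congruence, `aᵀ * G * a`. The square root of the resulting identity
is the Jacobian factor between the area densities of two charts. -/
theorem gramMatrix_comp_det (L : EuclideanSpace ℝ (Fin n) →L[ℝ] F)
    (A : EuclideanSpace ℝ (Fin n) →L[ℝ] EuclideanSpace ℝ (Fin n)) :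
    (gramMatrix (L ∘L A)).det = A.det ^ 2 * (gramMatrix L).det := by
  set a : Matrix (Fin n) (Fin n) ℝ := Matrix.of fun k i => A (EuclideanSpace.single i 1) k with ha
  have hg : gramMatrix (L ∘L A) = a.transpose * gramMatrix L * a := by
    ext i j
    have e : ∀ i, L (A (EuclideanSpace.single i 1)) =
        ∑ k, a k i • L (EuclideanSpace.single k 1) := fun i =>
      map_eq_sum_smul_single (L : EuclideanSpace ℝ (Fin n) →ₗ[ℝ] F) (A _)
    simp only [gramMatrix, Matrix.of_apply, ContinuousLinearMap.comp_apply, e, Matrix.mul_assoc]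
    simp only [sum_inner, inner_sum, Matrix.mul_apply, Matrix.transpose_apply, Finset.mul_sum,
      Matrix.of_apply, inner_smul_left, inner_smul_right]
    rw [Finset.sum_comm]
    refine Finset.sum_congr rfl fun k _ => Finset.sum_congr rfl fun l _ => ?_
    simp; ring
  have hdet : A.det = a.det := by
    have : a = LinearMap.toMatrix (EuclideanSpace.basisFun (Fin n) ℝ).toBasis
        (EuclideanSpace.basisFun (Fin n) ℝ).toBasis
        (A : EuclideanSpace ℝ (Fin n) →ₗ[ℝ] EuclideanSpace ℝ (Fin n)) := by
      ext i j
      simp [ha, LinearMap.toMatrix_apply]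
    rw [this, LinearMap.det_toMatrix]
  rw [hg, Matrix.det_mul, Matrix.det_mul, Matrix.det_transpose, hdet]
  ring

/-- Contraction with the inner product evaluates a linear form. -/
theorem gramTrace_inner_mul {L : EuclideanSpace ℝ (Fin n) →L[ℝ] F} (hL : Function.Injective L)
    (c : EuclideanSpace ℝ (Fin n)) (φ : EuclideanSpace ℝ (Fin n) →ₗ[ℝ] ℝ) :
    (gramTrace L fun v w => ⟪L v, L c⟫ * φ w) = φ c := by
  have h : ∀ i, ⟪L (EuclideanSpace.single i 1), L c⟫ = ∑ k, gramMatrix L i k * c k := by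
    intro i
    have := map_eq_sum_smul_single (L : EuclideanSpace ℝ (Fin n) →ₗ[ℝ] F) c
    simp only [ContinuousLinearMap.coe_coe] at this
    rw [this, inner_sum]
    simp [inner_smul_right, gramMatrix, mul_comm]
  have hinv := gramMatrix_inv_mul hL
  rw [gramTrace, Finset.sum_comm, map_eq_sum_smul_single φ c]
  refine Finset.sum_congr rfl fun j _ => ?_
  simp_rw [← mul_assoc, ← Finset.sum_mul]
  rw [smul_eq_mul]
  congr 1
  simp_rw [h, Finset.mul_sum, gramMatrix_inv_symm L _ j, ← mul_assoc]
  rw [Finset.sum_comm]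
  simp_rw [← Finset.sum_mul]
  have : ∀ k, ∑ i, (gramMatrix L)⁻¹ j i * gramMatrix L i k = (1 : Matrix (Fin n) (Fin n) ℝ) j k :=
    fun k => by rw [← hinv, Matrix.mul_apply]
  simp [this, Matrix.one_apply]

/-- A vector is the sum of its normal and its tangential part. -/
theorem exists_tangential {L : EuclideanSpace ℝ (Fin n) →L[ℝ] EuclideanSpace ℝ (Fin (n + 1))}
    (hL : Function.Injective L) {N : EuclideanSpace ℝ (Fin (n + 1))} (hN : ‖N‖ = 1)
    (hNL : ∀ v, ⟪N, L v⟫ = 0) (a : EuclideanSpace ℝ (Fin (n + 1))) :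
    ∃ c, a = ⟪N, a⟫ • N + L c := by
  set R := LinearMap.range (L : EuclideanSpace ℝ (Fin n) →ₗ[ℝ] EuclideanSpace ℝ (Fin (n + 1)))
  have hle : R ≤ (ℝ ∙ N)ᗮ := by
    rintro _ ⟨v, rfl⟩
    rw [Submodule.mem_orthogonal_singleton_iff_inner_right]
    exact hNL v
  have hN0 : N ≠ 0 := by rintro rfl; simp at hN
  have hR : Module.finrank ℝ R = n := by
    rw [LinearMap.finrank_range_of_inj hL]; simp
  have : Fact (Module.finrank ℝ (EuclideanSpace ℝ (Fin (n + 1))) = n + 1) := ⟨by simp⟩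
  have hO : Module.finrank ℝ (ℝ ∙ N)ᗮ = n := Submodule.finrank_orthogonal_span_singleton hN0
  have heq := Submodule.eq_of_le_of_finrank_eq hle (hR.trans hO.symm)
  have hmem : a - ⟪N, a⟫ • N ∈ R := by
    rw [heq, Submodule.mem_orthogonal_singleton_iff_inner_right, inner_sub_right,
      inner_smul_right, real_inner_self_eq_norm_sq, hN]
    ring
  obtain ⟨c, hc⟩ := hmem
  exact ⟨c, by rw [← sub_eq_iff_eq_add']; exact hc.symm⟩

/-- Only the tangential parts of `a` and `b` enter, and the trace recovers their scalar product: the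
full product minus the product of the normal components. -/
theorem gramTrace_inner_inner {L : EuclideanSpace ℝ (Fin n) →L[ℝ] EuclideanSpace ℝ (Fin (n + 1))}
    (hL : Function.Injective L) {N : EuclideanSpace ℝ (Fin (n + 1))} (hN : ‖N‖ = 1)
    (hNL : ∀ v, ⟪N, L v⟫ = 0) (a b : EuclideanSpace ℝ (Fin (n + 1))) :
    (gramTrace L fun v w => ⟪L v, a⟫ * ⟪L w, b⟫) = ⟪a, b⟫ - ⟪N, a⟫ * ⟪N, b⟫ := by
  obtain ⟨c, hc⟩ := exists_tangential hL hN hNL a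
  have h : ∀ v, ⟪L v, a⟫ = ⟪L v, L c⟫ := fun v => by
    rw [hc, inner_add_right, inner_smul_right, real_inner_comm N (L v), hNL]; simp
  simp_rw [h]
  have := gramTrace_inner_mul hL c ((innerₗ _ b).comp
    (L : EuclideanSpace ℝ (Fin n) →ₗ[ℝ] EuclideanSpace ℝ (Fin (n + 1))))
  simp only [LinearMap.comp_apply, innerₗ_apply_apply, ContinuousLinearMap.coe_coe] at this
  simp_rw [real_inner_comm b] at this ⊢
  rw [this]
  have h2 : L c = a - ⟪N, a⟫ • N := by rw [eq_sub_iff_add_eq']; exact hc.symm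
  rw [h2, inner_sub_right, inner_smul_right]

/-- `N` and the range of `L` span the ambient space. Vector identities such as those for Δx, ΔN and
dN are checked by separating normal and tangential components in this way. -/
theorem eq_of_inner_normal_tangent
    {L : EuclideanSpace ℝ (Fin n) →L[ℝ] EuclideanSpace ℝ (Fin (n + 1))}
    (hL : Function.Injective L) {N : EuclideanSpace ℝ (Fin (n + 1))} (hN : ‖N‖ = 1)
    (hNL : ∀ v, ⟪N, L v⟫ = 0) {a b : EuclideanSpace ℝ (Fin (n + 1))}
    (h1 : ⟪a, N⟫ = ⟪b, N⟫) (h2 : ∀ v, ⟪a, L v⟫ = ⟪b, L v⟫) : a = b := by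
  obtain ⟨c, hc⟩ := exists_tangential hL hN hNL (a - b)
  rw [← sub_eq_zero, ← inner_self_eq_zero (𝕜 := ℝ)]
  nth_rewrite 2 [hc]
  rw [inner_add_right, inner_smul_right, inner_sub_left, inner_sub_left, h1, h2]
  simp

end Gram

/-! ### Differentiation of determinants -/

section Det

variable {ι : Type*} [Fintype ι] [DecidableEq ι]

/-- Jacobi's formula. -/
theorem hasDerivAt_det {A : ℝ → Matrix ι ι ℝ} {A' : Matrix ι ι ℝ} {t : ℝ}
    (h : ∀ i j, HasDerivAt (fun s => A s i j) (A' i j) t) :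
    HasDerivAt (fun s => (A s).det) ((A t).adjugate * A').trace t := by
  have h1 : HasDerivAt (fun s => (A s).det)
      (∑ σ : Equiv.Perm ι, ((Equiv.Perm.sign σ : ℤ) : ℝ) *
        ∑ i, (∏ j ∈ Finset.univ.erase i, A t (σ j) j) * A' (σ i) i) t := by
    simp_rw [Matrix.det_apply']
    refine HasDerivAt.fun_sum fun σ _ => HasDerivAt.const_mul _ ?_
    have := HasDerivAt.fun_finsetProd (u := Finset.univ) (f := fun j s => A s (σ j) j)
      (f' := fun j => A' (σ j) j) (x := t) fun j _ => h (σ j) j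
    simpa using this
  convert h1 using 1
  -- By Cramer's rule the diagonal entry is the determinant with column `i` differentiated, which is
  -- one group of terms of the product rule in the Leibniz expansion.
  have h2 : ∀ i, ((A t).adjugate * A') i i = ((A t).updateCol i fun k => A' k i).det := by
    intro i
    rw [← Matrix.cramer_apply, Matrix.cramer_eq_adjugate_mulVec]
    rfl
  simp_rw [Matrix.trace, Matrix.diag, h2, Matrix.det_apply', Finset.mul_sum]
  rw [Finset.sum_comm]
  refine Finset.sum_congr rfl fun σ _ => Finset.sum_congr rfl fun i _ => ?_
  congr 1
  rw [← Finset.prod_erase_mul _ _ (Finset.mem_univ i)]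
  congr 1
  · refine Finset.prod_congr rfl fun j hj => ?_
    rw [Matrix.updateCol_ne (Finset.ne_of_mem_erase hj)]
  · simp

theorem contDiffOn_det {E : Type*} [NormedAddCommGroup E] [NormedSpace ℝ E] {U : Set E}
    {A : E → Matrix ι ι ℝ} {k : WithTop ℕ∞} (h : ∀ i j, ContDiffOn ℝ k (fun u => A u i j) U) :
    ContDiffOn ℝ k (fun u => (A u).det) U := by
  simp_rw [Matrix.det_apply']
  exact ContDiffOn.sum fun σ _ => contDiffOn_const.mul (contDiffOn_prod fun i _ => h _ _)

/-- The entries of the inverse are cofactors divided by the determinant. -/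
theorem contDiffOn_inv {E : Type*} [NormedAddCommGroup E] [NormedSpace ℝ E] {U : Set E}
    {A : E → Matrix ι ι ℝ} {k : WithTop ℕ∞} (h : ∀ i j, ContDiffOn ℝ k (fun u => A u i j) U)
    (h0 : ∀ u ∈ U, (A u).det ≠ 0) (i j : ι) :
    ContDiffOn ℝ k (fun u => (A u)⁻¹ i j) U := by
  have : ∀ u, (A u)⁻¹ i j = (A u).det⁻¹ * (A u).adjugate i j := fun u => by
    rw [Matrix.inv_def]; simp
  simp_rw [this]
  refine ((contDiffOn_det h).inv h0).mul ?_
  simp_rw [Matrix.adjugate_apply]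
  refine contDiffOn_det fun a b => ?_
  by_cases hab : a = j
  · subst hab; simpa using contDiffOn_const
  · simpa [Matrix.updateRow_ne hab] using h a b

end Det

/-! ### Hypersurfaces parametrized by an open subset of Euclidean space -/

section Local

variable {n : ℕ}

local notation "𝔼" => EuclideanSpace ℝ (Fin n)

variable {F Z : Type*} [NormedAddCommGroup F] [InnerProductSpace ℝ F]
  [NormedAddCommGroup Z] [NormedSpace ℝ Z]

/-- The `i`-th coordinate vector. -/
abbrev coordVec (i : Fin n) : EuclideanSpace ℝ (Fin n) := EuclideanSpace.single i 1

/-- The gradient in a parametrization `X`. -/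
def locGrad (X : 𝔼 → F) (f : 𝔼 → ℝ) (u : 𝔼) : F :=
  ∑ i, ∑ j, ((gramMatrix (fderiv ℝ X u))⁻¹ i j * fderiv ℝ f u (coordVec i)) •
    fderiv ℝ X u (coordVec j)

/-- The Laplace–Beltrami operator in a parametrization `X`. -/
def locLap (X : 𝔼 → F) (f : 𝔼 → ℝ) (u : 𝔼) : ℝ :=
  gramTrace (fderiv ℝ X u) fun v w => ⟪fderiv ℝ (locGrad X f) u v, fderiv ℝ X u w⟫

/-- The second derivative. -/
def hess (f : 𝔼 → Z) (u v w : 𝔼) : Z := fderiv ℝ (fderiv ℝ f) u v w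

/-- The trace of the second derivative of `f` in the metric induced by `X`. -/
def hessTrace (X : 𝔼 → F) (f : 𝔼 → Z) (u : 𝔼) : Z :=
  ∑ i, ∑ j, (gramMatrix (fderiv ℝ X u))⁻¹ i j • hess f u (coordVec i) (coordVec j)

/-- The coordinate components of the tangential part of the trace of `hess X`. -/
def drift (X : 𝔼 → F) (u : 𝔼) : 𝔼 :=
  WithLp.toLp 2 fun i =>
    ∑ j, (gramMatrix (fderiv ℝ X u))⁻¹ i j * ⟪fderiv ℝ X u (coordVec j), hessTrace X X u⟫

/-- The Laplace–Beltrami operator in nondivergence form, for functions with values in `Z`. -/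
def vecLap (X : 𝔼 → F) (f : 𝔼 → Z) (u : 𝔼) : Z :=
  hessTrace X f u - fderiv ℝ f u (drift X u)

theorem inner_locGrad (X : 𝔼 → F) (f : 𝔼 → ℝ) (u : 𝔼) (b : F) :
    ⟪locGrad X f u, b⟫ =
      gramTrace (fderiv ℝ X u) fun v w => fderiv ℝ f u v * ⟪fderiv ℝ X u w, b⟫ := by
  simp [locGrad, gramTrace, sum_inner, inner_smul_left, mul_assoc]

theorem inner_locGrad_fderiv {X : 𝔼 → F} {f : 𝔼 → ℝ} {u : 𝔼}
    (hX : Function.Injective (fderiv ℝ X u)) (v : 𝔼) :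
    ⟪locGrad X f u, fderiv ℝ X u v⟫ = fderiv ℝ f u v := by
  rw [inner_locGrad, gramTrace_comm]
  have := gramTrace_inner_mul hX v (fderiv ℝ f u : 𝔼 →ₗ[ℝ] ℝ)
  simp only [ContinuousLinearMap.coe_coe] at this
  simp_rw [mul_comm (fderiv ℝ f u _)]
  exact this

theorem fderiv_drift (X : 𝔼 → F) (f : 𝔼 → ℝ) (u : 𝔼) :
    fderiv ℝ f u (drift X u) = ⟪locGrad X f u, hessTrace X X u⟫ := by
  have := map_eq_sum_smul_single (fderiv ℝ f u : 𝔼 →ₗ[ℝ] ℝ) (drift X u)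
  simp only [ContinuousLinearMap.coe_coe] at this
  rw [this, inner_locGrad, gramTrace]
  refine Finset.sum_congr rfl fun i _ => ?_
  simp only [drift, smul_eq_mul, Finset.sum_mul]
  exact Finset.sum_congr rfl fun j _ => by ring

section Smooth

variable {U : Set (EuclideanSpace ℝ (Fin n))}

theorem contDiffOn_fderiv_apply (hU : IsOpen U) {f : 𝔼 → Z} (hf : ContDiffOn ℝ ∞ f U) (v : 𝔼) :
    ContDiffOn ℝ ∞ (fun u => fderiv ℝ f u v) U :=
  (hf.fderiv_of_isOpen hU (by simp)).clm_apply contDiffOn_const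

theorem differentiableAt_of_contDiffOn (hU : IsOpen U) {f : 𝔼 → Z} (hf : ContDiffOn ℝ ∞ f U)
    {u : 𝔼} (hu : u ∈ U) : DifferentiableAt ℝ f u :=
  (hf.contDiffAt (hU.mem_nhds hu)).differentiableAt (by simp)

theorem hasFDerivAt_fderiv_apply (hU : IsOpen U) {f : 𝔼 → Z} (hf : ContDiffOn ℝ ∞ f U)
    {u : 𝔼} (hu : u ∈ U) (w : 𝔼) :
    HasFDerivAt (fun u => fderiv ℝ f u w) ((fderiv ℝ (fderiv ℝ f) u).flip w) u := by
  have h : DifferentiableAt ℝ (fderiv ℝ f) u :=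
    differentiableAt_of_contDiffOn hU (hf.fderiv_of_isOpen hU (by simp)) hu
  have := h.hasFDerivAt.clm_apply (hasFDerivAt_const w u)
  simpa using this

theorem fderiv_fderiv_apply (hU : IsOpen U) {f : 𝔼 → Z} (hf : ContDiffOn ℝ ∞ f U)
    {u : 𝔼} (hu : u ∈ U) (v w : 𝔼) :
    fderiv ℝ (fun u => fderiv ℝ f u w) u v = hess f u v w := by
  rw [(hasFDerivAt_fderiv_apply hU hf hu w).fderiv]; rfl

theorem hess_symm (hU : IsOpen U) {f : 𝔼 → Z} (hf : ContDiffOn ℝ ∞ f U)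
    {u : 𝔼} (hu : u ∈ U) (v w : 𝔼) : hess f u v w = hess f u w v :=
  ((hf.contDiffAt (hU.mem_nhds hu)).isSymmSndFDerivAt
    (by
      rw [minSmoothness_of_isRCLikeNormedField]
      exact WithTop.coe_le_coe.2 (le_top : (2 : ℕ∞) ≤ ⊤))) v w

theorem contDiffOn_gramMatrix (hU : IsOpen U) {X : 𝔼 → F} (hX : ContDiffOn ℝ ∞ X U)
    (i j : Fin n) : ContDiffOn ℝ ∞ (fun u => gramMatrix (fderiv ℝ X u) i j) U :=
  (contDiffOn_fderiv_apply hU hX _).inner ℝ (contDiffOn_fderiv_apply hU hX _)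

theorem contDiffOn_gramMatrix_inv (hU : IsOpen U) {X : 𝔼 → F} (hX : ContDiffOn ℝ ∞ X U)
    (hi : ∀ u ∈ U, Function.Injective (fderiv ℝ X u)) (i j : Fin n) :
    ContDiffOn ℝ ∞ (fun u => (gramMatrix (fderiv ℝ X u))⁻¹ i j) U :=
  contDiffOn_inv (contDiffOn_gramMatrix hU hX) (fun u hu => (gramMatrix_det_pos (hi u hu)).ne') i j

theorem contDiffOn_locGrad (hU : IsOpen U) {X : 𝔼 → F} (hX : ContDiffOn ℝ ∞ X U)
    (hi : ∀ u ∈ U, Function.Injective (fderiv ℝ X u)) {f : 𝔼 → ℝ} (hf : ContDiffOn ℝ ∞ f U) :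
    ContDiffOn ℝ ∞ (locGrad X f) U := by
  unfold locGrad
  exact ContDiffOn.sum fun i _ => ContDiffOn.sum fun j _ =>
    ((contDiffOn_gramMatrix_inv hU hX hi i j).mul (contDiffOn_fderiv_apply hU hf _)).smul
      (contDiffOn_fderiv_apply hU hX _)

/-- Differentiating ⟨∇f, X_w⟩ = f_w gives ⟨∂_v ∇f, X_w⟩ = f_vw - ⟨∇f, X_vw⟩, and the trace of the
last term is the derivative of f along `drift`. The nondivergence form also makes sense for vector
valued maps, so it can be applied to X and N themselves. -/
theorem locLap_eq_vecLap (hU : IsOpen U) {X : 𝔼 → F} (hX : ContDiffOn ℝ ∞ X U)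
    (hi : ∀ u ∈ U, Function.Injective (fderiv ℝ X u)) {f : 𝔼 → ℝ} (hf : ContDiffOn ℝ ∞ f U)
    {u : 𝔼} (hu : u ∈ U) : locLap X f u = vecLap X f u := by
  have key : ∀ v w, ⟪fderiv ℝ (locGrad X f) u v, fderiv ℝ X u w⟫ =
      hess f u v w - ⟪locGrad X f u, hess X u v w⟫ := by
    intro v w
    have h1 := (differentiableAt_of_contDiffOn hU (contDiffOn_locGrad hU hX hi hf) hu).hasFDerivAt
    have h2 := h1.inner ℝ (hasFDerivAt_fderiv_apply hU hX hu w)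
    have h3 : (fun u => ⟪locGrad X f u, fderiv ℝ X u w⟫) =ᶠ[nhds u] fun u => fderiv ℝ f u w := by
      filter_upwards [hU.mem_nhds hu] with z hz
      exact inner_locGrad_fderiv (hi z hz) w
    have h4 := (h2.congr_of_eventuallyEq h3.symm).unique (hasFDerivAt_fderiv_apply hU hf hu w)
    have h5 := congrArg (fun L : 𝔼 →L[ℝ] ℝ => L v) h4
    simp at h5
    unfold hess
    linarith
  unfold locLap
  rw [gramTrace_congr key, gramTrace_sub, vecLap, fderiv_drift]
  congr 1
  simp [hessTrace, gramTrace, inner_sum, inner_smul_right]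

theorem vecLap_add (hU : IsOpen U) {X : 𝔼 → F} {f g : 𝔼 → Z} (hf : ContDiffOn ℝ ∞ f U)
    (hg : ContDiffOn ℝ ∞ g U) {u : 𝔼} (hu : u ∈ U) :
    vecLap X (fun u => f u + g u) u = vecLap X f u + vecLap X g u := by
  have h0 : ∀ z ∈ U, fderiv ℝ (fun u => f u + g u) z = fderiv ℝ f z + fderiv ℝ g z :=
    fun z hz => fderiv_fun_add (differentiableAt_of_contDiffOn hU hf hz)
      (differentiableAt_of_contDiffOn hU hg hz)
  have h1 : fderiv ℝ (fun u => f u + g u) =ᶠ[nhds u] fun z => fderiv ℝ f z + fderiv ℝ g z := by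
    filter_upwards [hU.mem_nhds hu] with z hz using h0 z hz
  have h2 : ∀ v w, hess (fun u => f u + g u) u v w = hess f u v w + hess g u v w := by
    intro v w
    unfold hess
    rw [h1.fderiv_eq, fderiv_fun_add
      (differentiableAt_of_contDiffOn hU (hf.fderiv_of_isOpen hU (by simp)) hu)
      (differentiableAt_of_contDiffOn hU (hg.fderiv_of_isOpen hU (by simp)) hu)]
    simp
  simp only [vecLap, hessTrace, h2, h0 u hu, smul_add, Finset.sum_add_distrib,
    add_apply]
  abel

theorem vecLap_mul (hU : IsOpen U) {X : 𝔼 → F} {f g : 𝔼 → ℝ} (hf : ContDiffOn ℝ ∞ f U)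
    (hg : ContDiffOn ℝ ∞ g U) {u : 𝔼} (hu : u ∈ U) :
    vecLap X (fun u => f u * g u) u = f u * vecLap X g u + g u * vecLap X f u +
      2 * gramTrace (fderiv ℝ X u) fun v w => fderiv ℝ f u v * fderiv ℝ g u w := by
  have h0 : ∀ z ∈ U, fderiv ℝ (fun u => f u * g u) z = f z • fderiv ℝ g z + g z • fderiv ℝ f z :=
    fun z hz => fderiv_fun_mul (differentiableAt_of_contDiffOn hU hf hz)
      (differentiableAt_of_contDiffOn hU hg hz)
  have h1 : fderiv ℝ (fun u => f u * g u) =ᶠ[nhds u]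
      fun z => f z • fderiv ℝ g z + g z • fderiv ℝ f z := by
    filter_upwards [hU.mem_nhds hu] with z hz using h0 z hz
  have h2 : ∀ v w, hess (fun u => f u * g u) u v w = (f u * hess g u v w + g u * hess f u v w) +
      (fderiv ℝ f u v * fderiv ℝ g u w + fderiv ℝ f u w * fderiv ℝ g u v) := by
    intro v w
    have a1 := (differentiableAt_of_contDiffOn hU hf hu).hasFDerivAt
    have a2 := (differentiableAt_of_contDiffOn hU hg hu).hasFDerivAt
    have a3 := (differentiableAt_of_contDiffOn hU
      (hf.fderiv_of_isOpen hU (m := ∞) (by simp)) hu).hasFDerivAt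
    have a4 := (differentiableAt_of_contDiffOn hU
      (hg.fderiv_of_isOpen hU (m := ∞) (by simp)) hu).hasFDerivAt
    unfold hess
    rw [h1.fderiv_eq, ((a1.fun_smul a4).fun_add (a2.fun_smul a3)).fderiv]
    simp
    ring
  have h3 : hessTrace X (fun u => f u * g u) u =
      f u * hessTrace X g u + g u * hessTrace X f u +
      2 * gramTrace (fderiv ℝ X u) fun v w => fderiv ℝ f u v * fderiv ℝ g u w := by
    have e : ∀ f : 𝔼 → ℝ, hessTrace X f u = gramTrace (fderiv ℝ X u) (hess f u) := fun f => by
      simp [hessTrace, gramTrace]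
    rw [e, e, e, gramTrace_congr h2, gramTrace_add, gramTrace_add, gramTrace_add,
      gramTrace_const_mul, gramTrace_const_mul,
      gramTrace_comm _ fun v w => fderiv ℝ f u w * fderiv ℝ g u v]
    ring
  simp only [vecLap, h3, h0 u hu, add_apply, smul_apply,
    smul_eq_mul]
  ring

theorem vecLap_clm (hU : IsOpen U) {X : 𝔼 → F} {f : 𝔼 → Z} (hf : ContDiffOn ℝ ∞ f U)
    (A : Z →L[ℝ] ℝ) {u : 𝔼} (hu : u ∈ U) :
    vecLap X (fun u => A (f u)) u = A (vecLap X f u) := by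
  have h0 : ∀ z ∈ U, fderiv ℝ (fun u => A (f u)) z = A ∘L fderiv ℝ f z := fun z hz =>
    (A.hasFDerivAt.comp z (differentiableAt_of_contDiffOn hU hf hz).hasFDerivAt).fderiv
  have h2 : ∀ v w, hess (fun u => A (f u)) u v w = A (hess f u v w) := by
    intro v w
    have h1 : (fun z => fderiv ℝ (fun u => A (f u)) z w) =ᶠ[nhds u]
        fun z => A (fderiv ℝ f z w) := by
      filter_upwards [hU.mem_nhds hu] with z hz
      rw [h0 z hz]; rfl
    rw [← fderiv_fderiv_apply hU (f := fun u => A (f u)) (A.contDiff.comp_contDiffOn hf) hu, h1.fderiv_eq]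
    have h3 : HasFDerivAt (fun z => A (fderiv ℝ f z w)) _ u :=
      A.hasFDerivAt.comp u (hasFDerivAt_fderiv_apply hU hf hu w)
    rw [h3.fderiv]
    rfl
  simp [vecLap, hessTrace, h2, h0 u hu]

end Smooth

end Local

section LocalHypersurface

variable {n : ℕ}

local notation "𝔼" => EuclideanSpace ℝ (Fin n)
local notation "𝔽" => EuclideanSpace ℝ (Fin (n + 1))

/-- A parametrized immersed hypersurface with unit normal field. -/
structure IsLocalHypersurface (X N : EuclideanSpace ℝ (Fin n) → EuclideanSpace ℝ (Fin (n + 1)))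
    (U : Set (EuclideanSpace ℝ (Fin n))) : Prop where
  isOpen : IsOpen U
  smooth : ContDiffOn ℝ ∞ X U
  normal_smooth : ContDiffOn ℝ ∞ N U
  immersion : ∀ u ∈ U, Function.Injective (fderiv ℝ X u)
  normal_norm : ∀ u ∈ U, ‖N u‖ = 1
  normal_orthogonal : ∀ u ∈ U, ∀ v, ⟪N u, fderiv ℝ X u v⟫ = 0

namespace IsLocalHypersurface

variable {X N : EuclideanSpace ℝ (Fin n) → EuclideanSpace ℝ (Fin (n + 1))}
  {U : Set (EuclideanSpace ℝ (Fin n))} {u : EuclideanSpace ℝ (Fin n)}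

theorem inner_fderiv_normal (h : IsLocalHypersurface X N U) (hu : u ∈ U) (v : 𝔼) :
    ⟪fderiv ℝ N u v, N u⟫ = 0 := by
  have h1 := (differentiableAt_of_contDiffOn h.isOpen h.normal_smooth hu).hasFDerivAt
  have h2 := h1.inner ℝ h1
  have h3 : (fun u => ⟪N u, N u⟫) =ᶠ[nhds u] fun _ => 1 := by
    filter_upwards [h.isOpen.mem_nhds hu] with z hz
    rw [real_inner_self_eq_norm_sq, h.normal_norm z hz]; norm_num
  have h4 := (h2.congr_of_eventuallyEq h3.symm).unique (hasFDerivAt_const (1 : ℝ) u)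
  have h5 := congrArg (fun L : 𝔼 →L[ℝ] ℝ => L v) h4
  simpa [real_inner_comm (fderiv ℝ N u v)] using h5

theorem inner_hess_normal (h : IsLocalHypersurface X N U) (hu : u ∈ U) (v w : 𝔼) :
    ⟪hess X u v w, N u⟫ = -⟪fderiv ℝ N u v, fderiv ℝ X u w⟫ := by
  have h1 := (differentiableAt_of_contDiffOn h.isOpen h.normal_smooth hu).hasFDerivAt
  have h2 := h1.inner ℝ (hasFDerivAt_fderiv_apply h.isOpen h.smooth hu w)
  have h3 : (fun u => ⟪N u, fderiv ℝ X u w⟫) =ᶠ[nhds u] fun _ => 0 := by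
    filter_upwards [h.isOpen.mem_nhds hu] with z hz using h.normal_orthogonal z hz w
  have h4 := (h2.congr_of_eventuallyEq h3.symm).unique (hasFDerivAt_const (0 : ℝ) u)
  have h5 := congrArg (fun L : 𝔼 →L[ℝ] ℝ => L v) h4
  simp at h5
  rw [real_inner_comm]
  unfold hess
  linarith

/-- Both sides are minus the normal component of the second derivative of `X`, which is symmetric.
-/
theorem secondForm_symm (h : IsLocalHypersurface X N U) (hu : u ∈ U) (v w : 𝔼) :
    ⟪fderiv ℝ N u v, fderiv ℝ X u w⟫ = ⟪fderiv ℝ N u w, fderiv ℝ X u v⟫ := by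
  have h1 := h.inner_hess_normal hu v w
  have h2 := h.inner_hess_normal hu w v
  rw [hess_symm h.isOpen h.smooth hu] at h1
  linarith

theorem inner_hess_normal_normal (h : IsLocalHypersurface X N U) (hu : u ∈ U) (v w : 𝔼) :
    ⟪hess N u v w, N u⟫ = -⟪fderiv ℝ N u v, fderiv ℝ N u w⟫ := by
  have h1 := (differentiableAt_of_contDiffOn h.isOpen h.normal_smooth hu).hasFDerivAt
  have h2 := h1.inner ℝ (hasFDerivAt_fderiv_apply h.isOpen h.normal_smooth hu w)
  have h3 : (fun u => ⟪N u, fderiv ℝ N u w⟫) =ᶠ[nhds u] fun _ => 0 := by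
    filter_upwards [h.isOpen.mem_nhds hu] with z hz
    rw [real_inner_comm]; exact h.inner_fderiv_normal hz w
  have h4 := (h2.congr_of_eventuallyEq h3.symm).unique (hasFDerivAt_const (0 : ℝ) u)
  have h5 := congrArg (fun L : 𝔼 →L[ℝ] ℝ => L v) h4
  simp at h5
  rw [real_inner_comm]
  unfold hess
  linarith

theorem inner_hessTrace (X : 𝔼 → 𝔽) (Y : 𝔼 → 𝔽) (a : 𝔽) :
    ⟪hessTrace X Y u, a⟫ = gramTrace (fderiv ℝ X u) fun v w => ⟪hess Y u v w, a⟫ := by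
  simp [hessTrace, gramTrace, sum_inner, inner_smul_left]

/-- The image of the drift is the tangential part of the trace of the second derivative. -/
theorem inner_fderiv_drift (h : IsLocalHypersurface X N U) (hu : u ∈ U) (v : 𝔼) :
    ⟪fderiv ℝ X u (drift X u), fderiv ℝ X u v⟫ = ⟪hessTrace X X u, fderiv ℝ X u v⟫ := by
  have h1 := map_eq_sum_smul_single (fderiv ℝ X u : 𝔼 →ₗ[ℝ] 𝔽) (drift X u)
  simp only [ContinuousLinearMap.coe_coe] at h1
  have h2 := gramTrace_inner_mul (h.immersion u hu) v
    ((innerₗ _ (hessTrace X X u)).comp (fderiv ℝ X u : 𝔼 →ₗ[ℝ] 𝔽))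
  simp only [LinearMap.comp_apply, innerₗ_apply_apply, ContinuousLinearMap.coe_coe] at h2
  rw [← h2, h1, sum_inner, gramTrace]
  refine Finset.sum_congr rfl fun i _ => ?_
  simp only [drift, inner_smul_left]
  simp only [conj_trivial, Finset.sum_mul]
  refine Finset.sum_congr rfl fun j _ => ?_
  rw [real_inner_comm (hessTrace X X u)]
  ring

/-- The drift is made to cancel the tangential part of the trace of the second derivative of `X`.
The normal part is the trace of the second fundamental form. This is Δx = nH N. -/
theorem vecLap_self (h : IsLocalHypersurface X N U) (hu : u ∈ U) :
    vecLap X X u = (gramTrace (fderiv ℝ X u) fun v w =>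
      -⟪fderiv ℝ N u v, fderiv ℝ X u w⟫) • N u := by
  refine eq_of_inner_normal_tangent (h.immersion u hu) (h.normal_norm u hu)
    (h.normal_orthogonal u hu) ?_ fun v => ?_
  · rw [vecLap, inner_sub_left, inner_hessTrace, gramTrace_congr (h.inner_hess_normal hu),
      real_inner_comm, h.normal_orthogonal u hu, inner_smul_left, real_inner_self_eq_norm_sq,
      h.normal_norm u hu]
    simp
  · rw [vecLap, inner_sub_left, h.inner_fderiv_drift hu, inner_smul_left,
      h.normal_orthogonal u hu]
    simp

/-- The differentiated symmetry of the second fundamental form. -/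
theorem codazzi (h : IsLocalHypersurface X N U) (hu : u ∈ U) (a b c : 𝔼) :
    ⟪hess N u c a, fderiv ℝ X u b⟫ + ⟪fderiv ℝ N u a, hess X u c b⟫ =
      ⟪hess N u c b, fderiv ℝ X u a⟫ + ⟪fderiv ℝ N u b, hess X u c a⟫ := by
  have key : ∀ a b : 𝔼, HasFDerivAt (fun u => ⟪fderiv ℝ N u a, fderiv ℝ X u b⟫) _ u := fun a b =>
    (hasFDerivAt_fderiv_apply h.isOpen h.normal_smooth hu a).inner ℝ
      (hasFDerivAt_fderiv_apply h.isOpen h.smooth hu b)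
  have h3 : (fun u => ⟪fderiv ℝ N u a, fderiv ℝ X u b⟫) =ᶠ[nhds u]
      fun u => ⟪fderiv ℝ N u b, fderiv ℝ X u a⟫ := by
    filter_upwards [h.isOpen.mem_nhds hu] with z hz using h.secondForm_symm hz a b
  have h4 := ((key a b).congr_of_eventuallyEq h3.symm).unique (key b a)
  have h5 := congrArg (fun L : 𝔼 →L[ℝ] ℝ => L c) h4
  simp at h5
  unfold hess
  linarith

/-- The matrix of the shape operator. -/
def shapeMatrix (X N : EuclideanSpace ℝ (Fin n) → EuclideanSpace ℝ (Fin (n + 1)))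
    (u : EuclideanSpace ℝ (Fin n)) : Matrix (Fin n) (Fin n) ℝ :=
  (gramMatrix (fderiv ℝ X u))⁻¹ *
    Matrix.of fun i j => -⟪fderiv ℝ N u (coordVec i), fderiv ℝ X u (coordVec j)⟫

theorem trace_shapeMatrix (X N : 𝔼 → 𝔽) (u : 𝔼) : (shapeMatrix X N u).trace =
    gramTrace (fderiv ℝ X u) fun v w => -⟪fderiv ℝ N u v, fderiv ℝ X u w⟫ := by
  rw [gramTrace_comm]
  simp [shapeMatrix, Matrix.trace, Matrix.mul_apply, gramTrace]

/-- The Weingarten equation. -/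
theorem fderiv_normal (h : IsLocalHypersurface X N U) (hu : u ∈ U) (i : Fin n) :
    fderiv ℝ N u (coordVec i) =
      -∑ k, shapeMatrix X N u k i • fderiv ℝ X u (coordVec k) := by
  refine eq_of_inner_normal_tangent (h.immersion u hu) (h.normal_norm u hu)
    (h.normal_orthogonal u hu) ?_ fun v => ?_
  · rw [h.inner_fderiv_normal hu, inner_neg_left, sum_inner]
    have e : ∀ k, ⟪fderiv ℝ X u (coordVec k), N u⟫ = 0 := fun k => by
      rw [real_inner_comm]; exact h.normal_orthogonal u hu _
    simp [inner_smul_left, e]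
  · have h1 := gramTrace_inner_mul (h.immersion u hu) v
      ((innerₗ _ (fderiv ℝ N u (coordVec i))).comp (fderiv ℝ X u : 𝔼 →ₗ[ℝ] 𝔽))
    simp only [LinearMap.comp_apply, innerₗ_apply_apply, ContinuousLinearMap.coe_coe] at h1
    rw [← h1, inner_neg_left, sum_inner, gramTrace, ← Finset.sum_neg_distrib]
    refine Finset.sum_congr rfl fun k _ => ?_
    simp only [inner_smul_left, shapeMatrix, Matrix.mul_apply, Matrix.of_apply, conj_trivial,
      Finset.sum_mul]
    rw [← Finset.sum_neg_distrib]
    refine Finset.sum_congr rfl fun l _ => ?_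
    rw [h.secondForm_symm hu (coordVec l)]
    ring

theorem contDiffOn_shapeMatrix (h : IsLocalHypersurface X N U) (i j : Fin n) :
    ContDiffOn ℝ ∞ (fun u => shapeMatrix X N u i j) U := by
  simp only [shapeMatrix, Matrix.mul_apply, Matrix.of_apply]
  exact ContDiffOn.sum fun k _ =>
    (contDiffOn_gramMatrix_inv h.isOpen h.smooth h.immersion i k).mul
      ((contDiffOn_fderiv_apply h.isOpen h.normal_smooth _).inner ℝ
        (contDiffOn_fderiv_apply h.isOpen h.smooth _)).neg

/-- With both indices raised, the second fundamental form is `G⁻¹ * B * G⁻¹`, where `G` and `B` are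
symmetric. -/
theorem shapeMatrix_mul_inv_symm (h : IsLocalHypersurface X N U) (hu : u ∈ U) (k j : Fin n) :
    ∑ i, shapeMatrix X N u k i * (gramMatrix (fderiv ℝ X u))⁻¹ i j =
      ∑ i, shapeMatrix X N u j i * (gramMatrix (fderiv ℝ X u))⁻¹ i k := by
  set B : Matrix (Fin n) (Fin n) ℝ :=
    Matrix.of fun i j => -⟪fderiv ℝ N u (coordVec i), fderiv ℝ X u (coordVec j)⟫ with hB
  have hBt : B.transpose = B := by
    ext i j; simp only [hB, Matrix.transpose_apply, Matrix.of_apply]; rw [h.secondForm_symm hu]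
  have hG := gramMatrix_transpose (fderiv ℝ X u)
  have : (shapeMatrix X N u * (gramMatrix (fderiv ℝ X u))⁻¹).transpose =
      shapeMatrix X N u * (gramMatrix (fderiv ℝ X u))⁻¹ := by
    rw [shapeMatrix, ← hB, Matrix.transpose_mul, Matrix.transpose_mul,
      Matrix.transpose_nonsing_inv, hG, hBt, Matrix.mul_assoc]
  have h2 := congrFun (congrFun this j) k
  simpa [Matrix.mul_apply] using h2

/-- The trace of the derivative of the shape operator vanishes if the mean curvature is constant. -/
theorem gramTrace_hess_normal (h : IsLocalHypersurface X N U) {c : ℝ}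
    (hc : ∀ u ∈ U, (gramTrace (fderiv ℝ X u) fun v w =>
      -⟪fderiv ℝ N u v, fderiv ℝ X u w⟫) = c) (hu : u ∈ U) (v : 𝔼) :
    (gramTrace (fderiv ℝ X u) fun a b => ⟪hess N u v a, fderiv ℝ X u b⟫) =
      gramTrace (fderiv ℝ X u) fun a b => ⟪fderiv ℝ N u a, hess X u v b⟫ := by
  set G := gramMatrix (fderiv ℝ X u)
  have hS : ∀ k i, HasFDerivAt (fun u => shapeMatrix X N u k i)
      (fderiv ℝ (fun u => shapeMatrix X N u k i) u) u := fun k i =>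
    (differentiableAt_of_contDiffOn h.isOpen (h.contDiffOn_shapeMatrix k i) hu).hasFDerivAt
  -- The Weingarten equation, differentiated. After contraction with `G⁻¹`, the terms with the
  -- derivative of the shape matrix sum to the derivative of its trace, which is zero as the trace
  -- is constant. The remaining terms match the right-hand side by the symmetry of the raised shape
  -- matrix.
  have h1 : ∀ i, hess N u v (coordVec i) =
      -∑ k, (shapeMatrix X N u k i • hess X u v (coordVec k) +
        (fderiv ℝ (fun u => shapeMatrix X N u k i) u v) • fderiv ℝ X u (coordVec k)) := by
    intro i
    have e : (fun u => fderiv ℝ N u (coordVec i)) =ᶠ[nhds u]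
        fun u => -∑ k, shapeMatrix X N u k i • fderiv ℝ X u (coordVec k) := by
      filter_upwards [h.isOpen.mem_nhds hu] with z hz using h.fderiv_normal hz i
    have e2 : HasFDerivAt (fun u => -∑ k, shapeMatrix X N u k i • fderiv ℝ X u (coordVec k)) _ u :=
      (HasFDerivAt.fun_sum fun k _ => (hS k i).fun_smul
        (hasFDerivAt_fderiv_apply h.isOpen h.smooth hu (coordVec k))).fun_neg
    rw [← fderiv_fderiv_apply h.isOpen h.normal_smooth hu, e.fderiv_eq, e2.fderiv]
    simp [hess]
  have h2 : ∑ i, fderiv ℝ (fun u => shapeMatrix X N u i i) u v = 0 := by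
    have e : (fun u => ∑ i, shapeMatrix X N u i i) =ᶠ[nhds u] fun _ => c := by
      filter_upwards [h.isOpen.mem_nhds hu] with z hz
      rw [← hc z hz, ← trace_shapeMatrix]; rfl
    have e2 : HasFDerivAt (fun u => ∑ i, shapeMatrix X N u i i) _ u :=
      HasFDerivAt.fun_sum fun k _ => hS k k
    have e3 := (e2.congr_of_eventuallyEq e.symm).unique (hasFDerivAt_const c u)
    simpa using congrArg (fun L : 𝔼 →L[ℝ] ℝ => L v) e3
  have hinv : ∀ k i, ∑ j, G⁻¹ i j * ⟪fderiv ℝ X u (coordVec k), fderiv ℝ X u (coordVec j)⟫ =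
      (1 : Matrix (Fin n) (Fin n) ℝ) i k := by
    intro k i
    rw [← gramMatrix_inv_mul (h.immersion u hu), Matrix.mul_apply]
    refine Finset.sum_congr rfl fun j _ => ?_
    rw [real_inner_comm]; rfl
  have h3 : (gramTrace (fderiv ℝ X u) fun a b => ⟪hess N u v a, fderiv ℝ X u b⟫) =
      -∑ k, ∑ j, (∑ i, shapeMatrix X N u k i * G⁻¹ i j) *
        ⟪hess X u v (coordVec k), fderiv ℝ X u (coordVec j)⟫ := by
    have e1 : (gramTrace (fderiv ℝ X u) fun a b => ⟪hess N u v a, fderiv ℝ X u b⟫) =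
        -(∑ i, ∑ j, ∑ k, shapeMatrix X N u k i * G⁻¹ i j *
          ⟪hess X u v (coordVec k), fderiv ℝ X u (coordVec j)⟫) -
        ∑ i, ∑ k, fderiv ℝ (fun u => shapeMatrix X N u k i) u v * ∑ j, G⁻¹ i j *
          ⟪fderiv ℝ X u (coordVec k), fderiv ℝ X u (coordVec j)⟫ := by
      rw [gramTrace, ← Finset.sum_neg_distrib, ← Finset.sum_sub_distrib]
      refine Finset.sum_congr rfl fun i _ => ?_
      simp_rw [Finset.mul_sum]
      rw [Finset.sum_comm (f := fun k j => fderiv ℝ (fun u => shapeMatrix X N u k i) u v * _),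
        ← Finset.sum_neg_distrib, ← Finset.sum_sub_distrib]
      refine Finset.sum_congr rfl fun j _ => ?_
      rw [h1 i, inner_neg_left, sum_inner, ← Finset.sum_neg_distrib, ← Finset.sum_neg_distrib,
        ← Finset.sum_sub_distrib, Finset.mul_sum]
      refine Finset.sum_congr rfl fun k _ => ?_
      rw [inner_add_left, inner_smul_left, inner_smul_left]
      simp only [conj_trivial]
      ring
    rw [e1]
    simp_rw [hinv]
    have e2 : ∑ i, ∑ k, fderiv ℝ (fun u => shapeMatrix X N u k i) u v *
        (1 : Matrix (Fin n) (Fin n) ℝ) i k = 0 := by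
      rw [← h2]
      refine Finset.sum_congr rfl fun i _ => ?_
      simp [Matrix.one_apply]
    rw [e2, sub_zero]
    congr 1
    simp_rw [Finset.sum_mul]
    rw [Finset.sum_comm]
    conv_lhs => enter [2, j]; rw [Finset.sum_comm]
    rw [Finset.sum_comm]
  have h4 : (gramTrace (fderiv ℝ X u) fun a b => ⟪fderiv ℝ N u a, hess X u v b⟫) =
      -∑ k, ∑ j, (∑ i, shapeMatrix X N u k i * G⁻¹ i j) *
        ⟪hess X u v (coordVec j), fderiv ℝ X u (coordVec k)⟫ := by
    rw [gramTrace]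
    simp_rw [Finset.sum_mul]
    conv_rhs => enter [1, 2, k]; rw [Finset.sum_comm]
    conv_rhs => rw [Finset.sum_comm, ← Finset.sum_neg_distrib]
    refine Finset.sum_congr rfl fun i _ => ?_
    conv_rhs => rw [Finset.sum_comm, ← Finset.sum_neg_distrib]
    refine Finset.sum_congr rfl fun j _ => ?_
    rw [h.fderiv_normal hu i, inner_neg_left, sum_inner, ← Finset.sum_neg_distrib,
      ← Finset.sum_neg_distrib, Finset.mul_sum]
    refine Finset.sum_congr rfl fun k _ => ?_
    rw [inner_smul_left, real_inner_comm]
    simp only [conj_trivial]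
    ring
  rw [h3, h4, Finset.sum_comm]
  congr 1
  refine Finset.sum_congr rfl fun j _ => Finset.sum_congr rfl fun k _ => ?_
  rw [h.shapeMatrix_mul_inv_symm hu]

/-- The normal component follows from differentiating ⟨N, N⟩ = 1 twice. The tangential component
would be minus the gradient of nH by the Codazzi equation, so it vanishes. This is ΔN = -|σ|² N. -/
theorem vecLap_normal (h : IsLocalHypersurface X N U) {c : ℝ}
    (hc : ∀ u ∈ U, (gramTrace (fderiv ℝ X u) fun v w =>
      -⟪fderiv ℝ N u v, fderiv ℝ X u w⟫) = c) (hu : u ∈ U) :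
    vecLap X N u = (-gramTrace (fderiv ℝ X u) fun v w =>
      ⟪fderiv ℝ N u v, fderiv ℝ N u w⟫) • N u := by
  refine eq_of_inner_normal_tangent (h.immersion u hu) (h.normal_norm u hu)
    (h.normal_orthogonal u hu) ?_ fun v => ?_
  · rw [vecLap, inner_sub_left, inner_hessTrace, gramTrace_congr (h.inner_hess_normal_normal hu),
      h.inner_fderiv_normal hu, inner_smul_left, real_inner_self_eq_norm_sq,
      h.normal_norm u hu, gramTrace_neg]
    simp
  -- dN(v) is tangential, say dX(c). Symmetry of the second fundamental form moves the drift to the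
  -- other slot, where its image is the tangential part of the trace of the second derivative of X.
  · have e1 : ⟪fderiv ℝ N u (drift X u), fderiv ℝ X u v⟫ =
        gramTrace (fderiv ℝ X u) fun a b => ⟪fderiv ℝ N u v, hess X u a b⟫ := by
      obtain ⟨c, hc⟩ := exists_tangential (h.immersion u hu) (h.normal_norm u hu)
        (h.normal_orthogonal u hu) (fderiv ℝ N u v)
      rw [real_inner_comm, h.inner_fderiv_normal hu, zero_smul, zero_add] at hc
      rw [h.secondForm_symm hu, hc, real_inner_comm, h.inner_fderiv_drift hu, inner_hessTrace]
      exact gramTrace_congr fun a b => real_inner_comm _ _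
    -- The trace of the Codazzi identity over its first and third arguments. By constancy of the
    -- mean curvature two of the four terms cancel; the other two state that the trace of the second
    -- derivative of N, paired with X_v, equals the drift term `e1`.
    have e2 := gramTrace_congr (L := fderiv ℝ X u) fun a b => h.codazzi hu b v a
    have e3 : ∀ a b, ⟪hess N u a v, fderiv ℝ X u b⟫ = ⟪hess N u v a, fderiv ℝ X u b⟫ :=
      fun a b => by rw [hess_symm h.isOpen h.normal_smooth hu]
    have e4 : ∀ a b, ⟪fderiv ℝ N u b, hess X u a v⟫ = ⟪fderiv ℝ N u b, hess X u v a⟫ :=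
      fun a b => by rw [hess_symm h.isOpen h.smooth hu]
    rw [gramTrace_add, gramTrace_add, gramTrace_congr e3, h.gramTrace_hess_normal hc hu v,
      gramTrace_congr e4, gramTrace_comm _ fun a b => ⟪fderiv ℝ N u b, hess X u v a⟫] at e2
    rw [vecLap, inner_sub_left, inner_hessTrace, e1, inner_smul_left, h.normal_orthogonal u hu]
    linarith

end IsLocalHypersurface

/-! ### The Laplacian in divergence form -/

section DivergenceForm

variable {F : Type*} [NormedAddCommGroup F] [InnerProductSpace ℝ F]
  {U : Set (EuclideanSpace ℝ (Fin n))} {u : EuclideanSpace ℝ (Fin n)}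

/-- The density `√(det g_ij)` of the area in a parametrization. -/
def areaDensity (X : EuclideanSpace ℝ (Fin n) → F) (u : EuclideanSpace ℝ (Fin n)) : ℝ :=
  Real.sqrt (gramMatrix (fderiv ℝ X u)).det

theorem areaDensity_pos {X : 𝔼 → F} (hi : Function.Injective (fderiv ℝ X u)) :
    0 < areaDensity X u := Real.sqrt_pos.2 (gramMatrix_det_pos hi)

theorem contDiffOn_areaDensity (hU : IsOpen U) {X : 𝔼 → F} (hX : ContDiffOn ℝ ∞ X U)
    (hi : ∀ u ∈ U, Function.Injective (fderiv ℝ X u)) : ContDiffOn ℝ ∞ (areaDensity X) U :=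
  (contDiffOn_det (contDiffOn_gramMatrix hU hX)).sqrt
    fun u hu => (gramMatrix_det_pos (hi u hu)).ne'

/-- Jacobi's formula on the line `u + t • v`: the derivative of √det g is ½ √det g tr(g⁻¹ ∂_v g).
The two halves of ∂_v g contribute equally, which removes the ½. -/
theorem fderiv_areaDensity (hU : IsOpen U) {X : 𝔼 → F} (hX : ContDiffOn ℝ ∞ X U)
    (hi : ∀ u ∈ U, Function.Injective (fderiv ℝ X u)) (hu : u ∈ U) (v : 𝔼) :
    fderiv ℝ (areaDensity X) u v = areaDensity X u *
      gramTrace (fderiv ℝ X u) fun a b => ⟪hess X u v a, fderiv ℝ X u b⟫ := by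
  set G := gramMatrix (fderiv ℝ X u) with hG
  have hpos := gramMatrix_det_pos (hi u hu)
  have hline : HasDerivAt (fun t : ℝ => u + t • v) v 0 := by
    simpa using ((hasDerivAt_id (0 : ℝ)).smul_const v).const_add u
  have hD : HasFDerivAt (areaDensity X) (fderiv ℝ (areaDensity X) u) (u + (0 : ℝ) • v) := by
    simpa using (differentiableAt_of_contDiffOn hU (contDiffOn_areaDensity hU hX hi) hu).hasFDerivAt
  have h1 := hD.comp_hasDerivAt (0 : ℝ) hline
  have h2 : ∀ i j, HasDerivAt (fun t : ℝ => gramMatrix (fderiv ℝ X (u + t • v)) i j)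
      (⟪fderiv ℝ X u (coordVec i), hess X u v (coordVec j)⟫ +
        ⟪hess X u v (coordVec i), fderiv ℝ X u (coordVec j)⟫) 0 := by
    intro i j
    have e := (hasFDerivAt_fderiv_apply hU hX hu (coordVec i)).inner ℝ
      (hasFDerivAt_fderiv_apply hU hX hu (coordVec j))
    have := e.comp_hasDerivAt_of_eq (0 : ℝ) hline (by simp)
    refine HasDerivAt.congr_deriv this ?_
    simp [hess]
  have h3 := (hasDerivAt_det (A := fun t : ℝ => gramMatrix (fderiv ℝ X (u + t • v)))
    (A' := Matrix.of fun i j => ⟪fderiv ℝ X u (coordVec i), hess X u v (coordVec j)⟫ +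
        ⟪hess X u v (coordVec i), fderiv ℝ X u (coordVec j)⟫) h2).sqrt (by simpa using hpos.ne')
  have h4 := h1.unique h3
  rw [h4]
  simp only [zero_smul, add_zero, ← hG]
  have hadj : G.adjugate = G.det • G⁻¹ := by
    rw [Matrix.inv_def, smul_smul, Ring.inverse_eq_inv', mul_inv_cancel₀ hpos.ne', one_smul]
  have h5 : (G⁻¹ * Matrix.of fun i j => ⟪fderiv ℝ X u (coordVec i), hess X u v (coordVec j)⟫ +
        ⟪hess X u v (coordVec i), fderiv ℝ X u (coordVec j)⟫).trace =
      2 * gramTrace (fderiv ℝ X u) fun a b => ⟪hess X u v a, fderiv ℝ X u b⟫ := by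
    have e : (G⁻¹ * Matrix.of fun i j => ⟪fderiv ℝ X u (coordVec i), hess X u v (coordVec j)⟫ +
        ⟪hess X u v (coordVec i), fderiv ℝ X u (coordVec j)⟫).trace =
        gramTrace (fderiv ℝ X u) fun a b => ⟪hess X u v a, fderiv ℝ X u b⟫ +
          ⟪hess X u v b, fderiv ℝ X u a⟫ := by
      simp only [Matrix.trace, Matrix.diag, Matrix.mul_apply, gramTrace, Matrix.of_apply]
      refine Finset.sum_congr rfl fun i _ => Finset.sum_congr rfl fun j _ => ?_
      rw [real_inner_comm]
    rw [e, gramTrace_add, gramTrace_comm _ fun a b => ⟪hess X u v b, fderiv ℝ X u a⟫]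
    ring
  rw [hadj, Matrix.smul_mul, Matrix.trace_smul, h5, areaDensity, ← hG, smul_eq_mul]
  have hs : Real.sqrt G.det ≠ 0 := (Real.sqrt_pos.2 hpos).ne'
  have hss : Real.sqrt G.det * Real.sqrt G.det = G.det := Real.mul_self_sqrt hpos.le
  rw [div_eq_iff (by positivity)]
  nth_rewrite 1 [← hss]
  ring

/-- The components of the field `ψ ∇f`, weighted with the area density. -/
def fluxComponent (X : EuclideanSpace ℝ (Fin n) → F) (ψ f : EuclideanSpace ℝ (Fin n) → ℝ)
    (i : Fin n) (u : EuclideanSpace ℝ (Fin n)) : ℝ :=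
  areaDensity X u * (ψ u * ∑ j, (gramMatrix (fderiv ℝ X u))⁻¹ j i * fderiv ℝ f u (coordVec j))

theorem contDiffOn_fluxComponent (hU : IsOpen U) {X : 𝔼 → F} (hX : ContDiffOn ℝ ∞ X U)
    (hi : ∀ u ∈ U, Function.Injective (fderiv ℝ X u)) {ψ f : 𝔼 → ℝ} (hψ : ContDiffOn ℝ ∞ ψ U)
    (hf : ContDiffOn ℝ ∞ f U) (i : Fin n) : ContDiffOn ℝ ∞ (fluxComponent X ψ f i) U :=
  (contDiffOn_areaDensity hU hX hi).mul (hψ.mul (ContDiffOn.sum fun j _ =>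
    (contDiffOn_gramMatrix_inv hU hX hi j i).mul (contDiffOn_fderiv_apply hU hf _)))

/-- This is √g div(ψ∇f) = ∂ᵢ(√g ψ gⁱʲ ∂ⱼf). Write ∇f = ∑ Vᵏ X_k; its divergence is ∑ ∂_k Vᵏ plus the
terms ∑ Vᵏ tr⟨X_k·, X_·⟩, and the latter are the logarithmic derivatives of the area density. The
left side integrates to zero for compact support. -/
theorem sum_fderiv_fluxComponent (hU : IsOpen U) {X : 𝔼 → F} (hX : ContDiffOn ℝ ∞ X U)
    (hi : ∀ u ∈ U, Function.Injective (fderiv ℝ X u)) {ψ f : 𝔼 → ℝ} (hψ : ContDiffOn ℝ ∞ ψ U)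
    (hf : ContDiffOn ℝ ∞ f U) (hu : u ∈ U) :
    ∑ i, fderiv ℝ (fluxComponent X ψ f i) u (coordVec i) =
      areaDensity X u * (ψ u * locLap X f u +
        gramTrace (fderiv ℝ X u) fun v w => fderiv ℝ ψ u v * fderiv ℝ f u w) := by
  set G := gramMatrix (fderiv ℝ X u) with hG
  set V : Fin n → 𝔼 → ℝ := fun i u =>
    ∑ j, (gramMatrix (fderiv ℝ X u))⁻¹ j i * fderiv ℝ f u (coordVec j) with hV
  have hVs : ∀ i, ContDiffOn ℝ ∞ (V i) U := fun i => ContDiffOn.sum fun j _ =>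
    (contDiffOn_gramMatrix_inv hU hX hi j i).mul (contDiffOn_fderiv_apply hU hf _)
  have hVd : ∀ i, HasFDerivAt (V i) (fderiv ℝ (V i) u) u := fun i =>
    (differentiableAt_of_contDiffOn hU (hVs i) hu).hasFDerivAt
  have hψd := (differentiableAt_of_contDiffOn hU hψ hu).hasFDerivAt
  have hDd := (differentiableAt_of_contDiffOn hU (contDiffOn_areaDensity hU hX hi) hu).hasFDerivAt
  have hgrad : locGrad X f = fun u => ∑ k, V k u • fderiv ℝ X u (coordVec k) := by
    ext1 z
    simp only [locGrad, hV, Finset.sum_smul]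
    rw [Finset.sum_comm]
  have hinv : ∀ k i, ∑ j, G⁻¹ i j * ⟪fderiv ℝ X u (coordVec k), fderiv ℝ X u (coordVec j)⟫ =
      (1 : Matrix (Fin n) (Fin n) ℝ) i k := by
    intro k i
    rw [← gramMatrix_inv_mul (hi u hu), Matrix.mul_apply]
    refine Finset.sum_congr rfl fun j _ => ?_
    rw [real_inner_comm]; rfl
  have hlap : locLap X f u = ∑ k, fderiv ℝ (V k) u (coordVec k) +
      ∑ k, V k u * gramTrace (fderiv ℝ X u)
        fun a b => ⟪hess X u (coordVec k) a, fderiv ℝ X u b⟫ := by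
    have e1 := HasFDerivAt.fun_sum (u := Finset.univ) fun k _ => (hVd k).fun_smul
      (hasFDerivAt_fderiv_apply hU hX hu (coordVec k))
    rw [← hgrad] at e1
    have e2 : ∀ v w, ⟪fderiv ℝ (locGrad X f) u v, fderiv ℝ X u w⟫ =
        ∑ k, (V k u * ⟪hess X u (coordVec k) v, fderiv ℝ X u w⟫ +
          fderiv ℝ (V k) u v * ⟪fderiv ℝ X u (coordVec k), fderiv ℝ X u w⟫) := by
      intro v w
      rw [e1.fderiv]
      simp only [sum_apply, sum_inner, add_apply, smul_apply,
        ContinuousLinearMap.smulRight_apply, inner_add_left, inner_smul_left, conj_trivial]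
      refine Finset.sum_congr rfl fun k _ => ?_
      rw [hess_symm hU hX hu (coordVec k) v]
      rfl
    rw [locLap, gramTrace_congr e2, gramTrace_sum]
    simp_rw [gramTrace_add, gramTrace_const_mul]
    rw [Finset.sum_add_distrib, add_comm]
    congr 1
    simp only [gramTrace]
    have e3 : ∀ k i, ∑ j, (gramMatrix (fderiv ℝ X u))⁻¹ i j * (fderiv ℝ (V k) u (coordVec i) *
        ⟪fderiv ℝ X u (coordVec k), fderiv ℝ X u (coordVec j)⟫) =
        fderiv ℝ (V k) u (coordVec i) * (1 : Matrix (Fin n) (Fin n) ℝ) i k := by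
      intro k i
      rw [← hinv, Finset.mul_sum]
      exact Finset.sum_congr rfl fun j _ => by rw [hG]; ring
    simp_rw [e3]
    refine Finset.sum_congr rfl fun k _ => ?_
    simp [Matrix.one_apply]
  have hflux : ∀ i, fderiv ℝ (fluxComponent X ψ f i) u (coordVec i) =
      areaDensity X u * (ψ u * fderiv ℝ (V i) u (coordVec i) +
        V i u * fderiv ℝ ψ u (coordVec i)) + (ψ u * V i u) * (areaDensity X u *
          gramTrace (fderiv ℝ X u) fun a b => ⟪hess X u (coordVec i) a, fderiv ℝ X u b⟫) := by
    intro i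
    have e : HasFDerivAt (fluxComponent X ψ f i) _ u := hDd.fun_mul (hψd.fun_mul (hVd i))
    rw [e.fderiv, ← fderiv_areaDensity hU hX hi hu]
    simp [hV]
    ring
  have hΓ : (gramTrace (fderiv ℝ X u) fun v w => fderiv ℝ ψ u v * fderiv ℝ f u w) =
      ∑ i, V i u * fderiv ℝ ψ u (coordVec i) := by
    simp only [gramTrace, hV, Finset.sum_mul]
    refine Finset.sum_congr rfl fun i _ => Finset.sum_congr rfl fun j _ => ?_
    rw [gramMatrix_inv_symm]; ring
  rw [hlap, hΓ]
  simp_rw [hflux]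
  simp only [mul_add, Finset.mul_sum, Finset.sum_add_distrib]
  have : ∀ i, ψ u * V i u * (areaDensity X u *
      gramTrace (fderiv ℝ X u) fun a b => ⟪hess X u (coordVec i) a, fderiv ℝ X u b⟫) =
      areaDensity X u * (ψ u * (V i u *
      gramTrace (fderiv ℝ X u) fun a b => ⟪hess X u (coordVec i) a, fderiv ℝ X u b⟫)) :=
    fun i => by ring
  simp_rw [this]
  ring

end DivergenceForm

end LocalHypersurface

/-! ### Computations in charts -/

section Chart

variable {m : ℕ} {M : Type*} [TopologicalSpace M] [ChartedSpace (EuclideanHalfSpace (m + 1)) M]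
variable {Z : Type*} [NormedAddCommGroup Z] [NormedSpace ℝ Z]

/-- The interior of the target of the chart at `p`. -/
def chartInterior (p : M) : Set (EuclideanSpace ℝ (Fin (m + 1))) :=
  interior (extChartAt (𝓡∂ (m + 1)) p).target

/-- A map on `M`, read in the chart at `p`. -/
def chartRep (p : M) (f : M → Z) : EuclideanSpace ℝ (Fin (m + 1)) → Z :=
  f ∘ (extChartAt (𝓡∂ (m + 1)) p).symm

theorem isOpen_chartInterior (p : M) : IsOpen (chartInterior (m := m) p) := isOpen_interior

theorem chartInterior_subset (p : M) :
    chartInterior p ⊆ (extChartAt (𝓡∂ (m + 1)) p).target := interior_subset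

/-- The differential of the inverse of the chart at `p`, in the coordinates of Mathlib's
identification of the tangent spaces with Euclidean space. -/
def chartFrame (p : M) (u : EuclideanSpace ℝ (Fin (m + 1))) :
    EuclideanSpace ℝ (Fin (m + 1)) →L[ℝ] EuclideanSpace ℝ (Fin (m + 1)) :=
  mfderivWithin 𝓘(ℝ, EuclideanSpace ℝ (Fin (m + 1))) (𝓡∂ (m + 1))
    (extChartAt (𝓡∂ (m + 1)) p).symm (range (𝓡∂ (m + 1))) u

variable [IsManifold (𝓡∂ (m + 1)) ∞ M]

theorem isInvertible_chartFrame {p : M} {u : EuclideanSpace ℝ (Fin (m + 1))}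
    (hu : u ∈ (extChartAt (𝓡∂ (m + 1)) p).target) : (chartFrame p u).IsInvertible :=
  isInvertible_mfderivWithin_extChartAt_symm hu

/-- The differential at a point is expressed in the preferred chart of that point, the
representative in the fixed chart at `p`. `chartFrame` compares the two, and by `gramTrace_comp`
traces do not depend on it. -/
theorem fderivWithin_chartRep {p : M} {u : EuclideanSpace ℝ (Fin (m + 1))}
    (hu : u ∈ (extChartAt (𝓡∂ (m + 1)) p).target) {f : M → Z}
    (hf : MDifferentiableAt (𝓡∂ (m + 1)) 𝓘(ℝ, Z) f ((extChartAt (𝓡∂ (m + 1)) p).symm u)) :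
    fderivWithin ℝ (chartRep p f) (range (𝓡∂ (m + 1))) u =
      differential m f ((extChartAt (𝓡∂ (m + 1)) p).symm u) ∘L chartFrame p u := by
  have hU : UniqueMDiffWithinAt 𝓘(ℝ, EuclideanSpace ℝ (Fin (m + 1))) (range (𝓡∂ (m + 1))) u :=
    (𝓡∂ (m + 1)).uniqueMDiffOn u (extChartAt_target_subset_range p hu)
  rw [← mfderivWithin_eq_fderivWithin]
  exact mfderiv_comp_mfderivWithin u hf (mdifferentiableWithinAt_extChartAt_symm hu) hU

omit [IsManifold (𝓡∂ (m + 1)) ∞ M] in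
theorem fderivWithin_range_eq {p : M} {u : EuclideanSpace ℝ (Fin (m + 1))}
    (hu : u ∈ chartInterior p) (f : EuclideanSpace ℝ (Fin (m + 1)) → Z) :
    fderivWithin ℝ f (range (𝓡∂ (m + 1))) u = fderiv ℝ f u :=
  fderivWithin_of_mem_nhds (Filter.mem_of_superset
    ((isOpen_chartInterior p).mem_nhds hu)
    ((chartInterior_subset p).trans (extChartAt_target_subset_range p)))

theorem fderiv_chartRep {p : M} {u : EuclideanSpace ℝ (Fin (m + 1))}
    (hu : u ∈ chartInterior p) {f : M → Z}
    (hf : MDifferentiableAt (𝓡∂ (m + 1)) 𝓘(ℝ, Z) f ((extChartAt (𝓡∂ (m + 1)) p).symm u)) :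
    fderiv ℝ (chartRep p f) u =
      differential m f ((extChartAt (𝓡∂ (m + 1)) p).symm u) ∘L chartFrame p u := by
  rw [← fderivWithin_range_eq hu, fderivWithin_chartRep (chartInterior_subset p hu) hf]

theorem contDiffOn_chartRep {f : M → Z} (hf : ContMDiff (𝓡∂ (m + 1)) 𝓘(ℝ, Z) ∞ f) (p : M) :
    ContDiffOn ℝ ∞ (chartRep p f) (extChartAt (𝓡∂ (m + 1)) p).target := by
  rw [← contMDiffOn_iff_contDiffOn]
  exact hf.comp_contMDiffOn (contMDiffOn_extChartAt_symm p)

theorem contDiffOn_chartRep_interior {f : M → Z} (hf : ContMDiff (𝓡∂ (m + 1)) 𝓘(ℝ, Z) ∞ f)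
    (p : M) : ContDiffOn ℝ ∞ (chartRep (m := m) p f) (chartInterior (m := m) p) :=
  (contDiffOn_chartRep hf p).mono (chartInterior_subset p)

/-- A gradient scalar product with respect to the induced metric. -/
def gradInner (x : M → EuclideanSpace ℝ (Fin (m + 2))) (f g : M → ℝ) (p : M) : ℝ :=
  gramTrace (differential m x p) fun v w => differential m f p v * differential m g p w

omit [IsManifold (𝓡∂ (m + 1)) ∞ M] in
theorem inner_gradient (x : M → EuclideanSpace ℝ (Fin (m + 2))) (f : M → ℝ) (p : M)
    (b : EuclideanSpace ℝ (Fin (m + 2))) :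
    ⟪gradient x f p, b⟫ = gramTrace (differential m x p)
      fun v w => differential m f p v * ⟪differential m x p w, b⟫ := by
  simp only [gradient, gramTrace, sum_inner, inner_smul_left, mul_assoc, conj_trivial]
  rfl

section Immersion

variable {x : M → EuclideanSpace ℝ (Fin (m + 2))}
  {p : M} {u : EuclideanSpace ℝ (Fin (m + 1))}

theorem gradInner_eq_chart (hx : ContMDiff (𝓡∂ (m + 1)) 𝓘(ℝ, EuclideanSpace ℝ (Fin (m + 2))) ∞ x)
    {f g : M → ℝ} (hf : ContMDiff (𝓡∂ (m + 1)) 𝓘(ℝ, ℝ) ∞ f)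
    (hg : ContMDiff (𝓡∂ (m + 1)) 𝓘(ℝ, ℝ) ∞ g) (hu : u ∈ chartInterior p) :
    gradInner x f g ((extChartAt (𝓡∂ (m + 1)) p).symm u) =
      gramTrace (fderiv ℝ (chartRep p x) u)
        fun v w => fderiv ℝ (chartRep p f) u v * fderiv ℝ (chartRep p g) u w := by
  obtain ⟨A, hA⟩ := isInvertible_chartFrame (chartInterior_subset p hu)
  set q := (extChartAt (𝓡∂ (m + 1)) p).symm u
  rw [fderiv_chartRep hu (hx.mdifferentiable (by simp) _),
    fderiv_chartRep hu (hf.mdifferentiable (by simp) _),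
    fderiv_chartRep hu (hg.mdifferentiable (by simp) _), ← hA]
  have := gramTrace_comp (differential m x q) A ((LinearMap.mul ℝ ℝ).compl₁₂
    (differential m f q : EuclideanSpace ℝ (Fin (m + 1)) →ₗ[ℝ] ℝ)
    (differential m g q : EuclideanSpace ℝ (Fin (m + 1)) →ₗ[ℝ] ℝ))
  exact this.symm

theorem gramTrace_inner_eq_chart
    (hx : ContMDiff (𝓡∂ (m + 1)) 𝓘(ℝ, EuclideanSpace ℝ (Fin (m + 2))) ∞ x)
    {V W : M → EuclideanSpace ℝ (Fin (m + 2))} (hu : u ∈ chartInterior p)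
    (hV : MDifferentiableAt (𝓡∂ (m + 1)) 𝓘(ℝ, EuclideanSpace ℝ (Fin (m + 2))) V
      ((extChartAt (𝓡∂ (m + 1)) p).symm u))
    (hW : MDifferentiableAt (𝓡∂ (m + 1)) 𝓘(ℝ, EuclideanSpace ℝ (Fin (m + 2))) W
      ((extChartAt (𝓡∂ (m + 1)) p).symm u)) :
    (gramTrace (differential m x ((extChartAt (𝓡∂ (m + 1)) p).symm u)) fun v w =>
      ⟪differential m V ((extChartAt (𝓡∂ (m + 1)) p).symm u) v,
        differential m W ((extChartAt (𝓡∂ (m + 1)) p).symm u) w⟫) =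
      gramTrace (fderiv ℝ (chartRep p x) u)
        fun v w => ⟪fderiv ℝ (chartRep p V) u v, fderiv ℝ (chartRep p W) u w⟫ := by
  obtain ⟨A, hA⟩ := isInvertible_chartFrame (chartInterior_subset p hu)
  set q := (extChartAt (𝓡∂ (m + 1)) p).symm u
  rw [fderiv_chartRep hu (hx.mdifferentiable (by simp) _), fderiv_chartRep hu hV,
    fderiv_chartRep hu hW, ← hA]
  have := gramTrace_comp (differential m x q) A ((innerₗ (EuclideanSpace ℝ (Fin (m + 2)))).compl₁₂
    (differential m V q : EuclideanSpace ℝ (Fin (m + 1)) →ₗ[ℝ] EuclideanSpace ℝ (Fin (m + 2)))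
    (differential m W q : EuclideanSpace ℝ (Fin (m + 1)) →ₗ[ℝ] EuclideanSpace ℝ (Fin (m + 2))))
  exact this.symm

theorem gradient_eq_chart (hx : ContMDiff (𝓡∂ (m + 1)) 𝓘(ℝ, EuclideanSpace ℝ (Fin (m + 2))) ∞ x)
    {f : M → ℝ} (hf : ContMDiff (𝓡∂ (m + 1)) 𝓘(ℝ, ℝ) ∞ f) (hu : u ∈ chartInterior p) :
    gradient x f ((extChartAt (𝓡∂ (m + 1)) p).symm u) =
      locGrad (chartRep p x) (chartRep p f) u := by
  obtain ⟨A, hA⟩ := isInvertible_chartFrame (chartInterior_subset p hu)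
  set q := (extChartAt (𝓡∂ (m + 1)) p).symm u with hq
  refine ext_inner_right ℝ fun b => ?_
  rw [inner_gradient, inner_locGrad, fderiv_chartRep hu (hx.mdifferentiable (by simp) _),
    fderiv_chartRep hu (hf.mdifferentiable (by simp) _), ← hA, ← hq]
  have := gramTrace_comp (differential m x q) A ((LinearMap.mul ℝ ℝ).compl₁₂
    (differential m f q : EuclideanSpace ℝ (Fin (m + 1)) →ₗ[ℝ] ℝ)
    ((innerₗ _ b).comp (differential m x q :
      EuclideanSpace ℝ (Fin (m + 1)) →ₗ[ℝ] EuclideanSpace ℝ (Fin (m + 2)))))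
  simp only [LinearMap.compl₁₂_apply, LinearMap.comp_apply, innerₗ_apply_apply,
    ContinuousLinearMap.coe_coe, LinearMap.mul_apply'] at this
  simp only [real_inner_comm b]
  exact this.symm

theorem injective_fderiv_chartRep
    (hx : ContMDiff (𝓡∂ (m + 1)) 𝓘(ℝ, EuclideanSpace ℝ (Fin (m + 2))) ∞ x)
    (hi : ∀ p, Function.Injective (differential m x p)) (hu : u ∈ chartInterior p) :
    Function.Injective (fderiv ℝ (chartRep p x) u) := by
  obtain ⟨A, hA⟩ := isInvertible_chartFrame (chartInterior_subset p hu)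
  rw [fderiv_chartRep hu (hx.mdifferentiable (by simp) _), ← hA]
  exact (hi _).comp A.injective

/-- Serves for the gradient field, whose regularity is read off from its expression in a chart. -/
theorem mdifferentiableAt_of_chartRep {f : M → Z} (hu : u ∈ chartInterior p)
    (hf : DifferentiableAt ℝ (chartRep p f) u) :
    MDifferentiableAt (𝓡∂ (m + 1)) 𝓘(ℝ, Z) f ((extChartAt (𝓡∂ (m + 1)) p).symm u) := by
  set q := (extChartAt (𝓡∂ (m + 1)) p).symm u with hq
  have hut := chartInterior_subset p hu
  have hqs : q ∈ (extChartAt (𝓡∂ (m + 1)) p).source := (extChartAt (𝓡∂ (m + 1)) p).map_target hut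
  have h1 : extChartAt (𝓡∂ (m + 1)) p q = u := (extChartAt (𝓡∂ (m + 1)) p).right_inv hut
  have h2 : MDifferentiableAt (𝓡∂ (m + 1)) 𝓘(ℝ, EuclideanSpace ℝ (Fin (m + 1)))
      (extChartAt (𝓡∂ (m + 1)) p) q :=
    mdifferentiableAt_extChartAt (by rwa [extChartAt_source] at hqs)
  have h3 : MDifferentiableAt 𝓘(ℝ, EuclideanSpace ℝ (Fin (m + 1))) 𝓘(ℝ, Z) (chartRep p f)
      (extChartAt (𝓡∂ (m + 1)) p q) := by rw [h1]; exact hf.mdifferentiableAt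
  refine (h3.comp q h2).congr_of_eventuallyEq ?_
  filter_upwards [extChartAt_source_mem_nhds' (I := 𝓡∂ (m + 1)) hqs] with z hz
  simp only [chartRep, Function.comp_apply, (extChartAt (𝓡∂ (m + 1)) p).left_inv hz]

theorem chartRep_gradient_eventuallyEq
    (hx : ContMDiff (𝓡∂ (m + 1)) 𝓘(ℝ, EuclideanSpace ℝ (Fin (m + 2))) ∞ x)
    {f : M → ℝ} (hf : ContMDiff (𝓡∂ (m + 1)) 𝓘(ℝ, ℝ) ∞ f) (hu : u ∈ chartInterior p) :
    chartRep p (gradient x f) =ᶠ[nhds u] locGrad (chartRep p x) (chartRep p f) := by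
  filter_upwards [(isOpen_chartInterior p).mem_nhds hu] with z hz
  exact gradient_eq_chart hx hf hz

theorem laplacian_eq_chart
    (hx : ContMDiff (𝓡∂ (m + 1)) 𝓘(ℝ, EuclideanSpace ℝ (Fin (m + 2))) ∞ x)
    (hi : ∀ p, Function.Injective (differential m x p))
    {f : M → ℝ} (hf : ContMDiff (𝓡∂ (m + 1)) 𝓘(ℝ, ℝ) ∞ f) (hu : u ∈ chartInterior p) :
    laplacian x f ((extChartAt (𝓡∂ (m + 1)) p).symm u) =
      locLap (chartRep p x) (chartRep p f) u := by
  have hg := chartRep_gradient_eventuallyEq hx hf hu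
  have hd : DifferentiableAt ℝ (chartRep p (gradient x f)) u :=
    (differentiableAt_of_contDiffOn (isOpen_chartInterior p)
      (contDiffOn_locGrad (isOpen_chartInterior p) (contDiffOn_chartRep_interior hx p)
        (fun u hu => injective_fderiv_chartRep hx hi hu) (contDiffOn_chartRep_interior hf p))
      hu).congr_of_eventuallyEq hg
  rw [locLap, ← hg.fderiv_eq]
  exact gramTrace_inner_eq_chart hx hu (mdifferentiableAt_of_chartRep hu hd)
    (hx.mdifferentiable (by simp) _)

end Immersion

omit [IsManifold (𝓡∂ (m + 1)) ∞ M] in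
theorem meanCurvature_eq_gramTrace (x N : M → EuclideanSpace ℝ (Fin (m + 2))) (p : M) :
    ((m : ℝ) + 1) * meanCurvature x N p = gramTrace (differential m x p) fun v w =>
      -⟪differential m N p v, differential m x p w⟫ := by
  have h : ((metricMatrix x p)⁻¹ * secondFormMatrix x N p).trace =
      gramTrace (differential m x p) fun v w => -⟪differential m N p v, differential m x p w⟫ := by
    rw [gramTrace_comm]
    simp only [Matrix.trace, Matrix.diag, Matrix.mul_apply]
    rfl
  rw [meanCurvature, h, ← mul_assoc, mul_inv_cancel₀ (by positivity), one_mul]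

/-- The interior points of `M` are those which a chart maps to the interior of its target. -/
theorem mem_interior_iff_chart {p q : M} (hq : q ∈ (extChartAt (𝓡∂ (m + 1)) p).source) :
    q ∈ (𝓡∂ (m + 1)).interior M ↔ extChartAt (𝓡∂ (m + 1)) p q ∈ chartInterior p :=
  (𝓡∂ (m + 1)).isInteriorPoint_iff_of_mem_atlas (n := ∞) (by simp)
    (ChartedSpace.chart_mem_atlas p) (by rwa [extChartAt_source] at hq)

theorem symm_mem_interior_iff {p : M} {u : EuclideanSpace ℝ (Fin (m + 1))}
    (hu : u ∈ (extChartAt (𝓡∂ (m + 1)) p).target) :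
    (extChartAt (𝓡∂ (m + 1)) p).symm u ∈ (𝓡∂ (m + 1)).interior M ↔ u ∈ chartInterior p := by
  rw [mem_interior_iff_chart ((extChartAt (𝓡∂ (m + 1)) p).map_target hu),
    (extChartAt (𝓡∂ (m + 1)) p).right_inv hu]

omit [IsManifold (𝓡∂ (m + 1)) ∞ M] in
-- The target is relatively open in the half space, so only the sign of the first coordinate
-- matters.
theorem mem_chartInterior_iff {p : M} {u : EuclideanSpace ℝ (Fin (m + 1))} :
    u ∈ chartInterior p ↔ u ∈ (extChartAt (𝓡∂ (m + 1)) p).target ∧ 0 < u 0 := by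
  have hr := interior_range_modelWithCornersEuclideanHalfSpace (m + 1)
  constructor
  · intro hu
    refine ⟨chartInterior_subset p hu, ?_⟩
    have : u ∈ interior (range (𝓡∂ (m + 1))) :=
      interior_mono (extChartAt_target_subset_range p) hu
    rw [hr] at this
    exact this
  · rintro ⟨hu, h0⟩
    have h1 := extChartAt_target_mem_nhdsWithin_of_mem hu
    have h2 : range (𝓡∂ (m + 1)) ∈ nhds u := by
      rw [← mem_interior_iff_mem_nhds, hr]; exact h0
    rw [nhdsWithin_eq_nhds.2 h2] at h1
    exact mem_interior_iff_mem_nhds.2 h1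

end Chart

/-! ### The Jacobi equation of the test functions, in a parametrization. -/

section LocalTestFunction

variable {n : ℕ} {X N : EuclideanSpace ℝ (Fin n) → EuclideanSpace ℝ (Fin (n + 1))}
  {U : Set (EuclideanSpace ℝ (Fin n))} {u : EuclideanSpace ℝ (Fin n)}

local notation "𝔼" => EuclideanSpace ℝ (Fin n)
local notation "𝔽" => EuclideanSpace ℝ (Fin (n + 1))

theorem gramTrace_inner_self {F : Type*} [NormedAddCommGroup F] [InnerProductSpace ℝ F]
    {L : 𝔼 →L[ℝ] F} (hL : Function.Injective L) :
    (gramTrace L fun v w => ⟪L v, L w⟫) = n := by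
  have h := gramMatrix_inv_mul hL
  have h2 : (gramTrace L fun v w => ⟪L v, L w⟫) = ((gramMatrix L)⁻¹ * gramMatrix L).trace := by
    rw [gramTrace_comm]
    simp only [gramTrace, Matrix.trace, Matrix.diag, Matrix.mul_apply]
    rfl
  rw [h2, h]
  simp

theorem vecLap_sum {Z ι : Type*} [NormedAddCommGroup Z] [NormedSpace ℝ Z] (hU : IsOpen U)
    (s : Finset ι) {f : ι → 𝔼 → Z} (hf : ∀ b, ContDiffOn ℝ ∞ (f b) U) (hu : u ∈ U) :
    vecLap X (fun u => ∑ b ∈ s, f b u) u = ∑ b ∈ s, vecLap X (f b) u := by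
  classical
  induction s using Finset.induction_on with
  | empty =>
    have : fderiv ℝ (fun _ : 𝔼 => (0 : Z)) = fun _ => 0 := by ext1 z; simp
    simp [vecLap, hessTrace, hess, this]
  | insert a s ha ih =>
    simp only [Finset.sum_insert ha]
    rw [vecLap_add hU (hf a) (ContDiffOn.sum fun b _ => hf b) hu, ih]

theorem vecLap_inner {k : ℕ} (hU : IsOpen U) {Y Z : 𝔼 → EuclideanSpace ℝ (Fin k)}
    (hY : ContDiffOn ℝ ∞ Y U) (hZ : ContDiffOn ℝ ∞ Z U) (hu : u ∈ U) :
    vecLap X (fun u => ⟪Y u, Z u⟫) u = ⟪Y u, vecLap X Z u⟫ + ⟪vecLap X Y u, Z u⟫ +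
      2 * gramTrace (fderiv ℝ X u) fun v w => ⟪fderiv ℝ Y u v, fderiv ℝ Z u w⟫ := by
  have hin : ∀ a b : EuclideanSpace ℝ (Fin k), ⟪a, b⟫ = ∑ i, a i * b i := fun a b => by
    simp [PiLp.inner_apply, mul_comm]
  have hc : ∀ {W : 𝔼 → EuclideanSpace ℝ (Fin k)}, ContDiffOn ℝ ∞ W U → ∀ i,
      ContDiffOn ℝ ∞ (fun u => W u i) U := fun hW i =>
    (EuclideanSpace.proj (𝕜 := ℝ) i).contDiff.comp_contDiffOn hW
  have hl : ∀ {W : 𝔼 → EuclideanSpace ℝ (Fin k)}, ContDiffOn ℝ ∞ W U → ∀ i,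
      vecLap X (fun u => W u i) u = vecLap X W u i := fun hW i =>
    vecLap_clm hU hW (EuclideanSpace.proj (𝕜 := ℝ) i) hu
  have hd : ∀ {W : 𝔼 → EuclideanSpace ℝ (Fin k)}, ContDiffOn ℝ ∞ W U → ∀ i v,
      fderiv ℝ (fun u => W u i) u v = fderiv ℝ W u v i := fun {W} hW i v => by
    have : HasFDerivAt (fun u => W u i) _ u := (EuclideanSpace.proj (𝕜 := ℝ) i).hasFDerivAt.comp u
      (differentiableAt_of_contDiffOn hU hW hu).hasFDerivAt
    rw [this.fderiv]; rfl
  simp_rw [hin]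
  rw [vecLap_sum hU _ (fun i => (hc hY i).mul (hc hZ i)) hu, gramTrace_sum, Finset.mul_sum,
    ← Finset.sum_add_distrib, ← Finset.sum_add_distrib]
  refine Finset.sum_congr rfl fun i _ => ?_
  rw [vecLap_mul hU (hc hY i) (hc hZ i) hu, hl hY, hl hZ]
  simp_rw [hd hY, hd hZ]
  ring

namespace IsLocalHypersurface

theorem vecLap_inner_self (h : IsLocalHypersurface X N U) {c : ℝ}
    (hc : ∀ u ∈ U, (gramTrace (fderiv ℝ X u) fun v w =>
      -⟪fderiv ℝ N u v, fderiv ℝ X u w⟫) = c) (hu : u ∈ U) :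
    vecLap X (fun u => ⟪X u, X u⟫) u = 2 * (n + c * ⟪X u, N u⟫) := by
  rw [vecLap_inner h.isOpen h.smooth h.smooth hu, h.vecLap_self hu, hc u hu,
    gramTrace_inner_self (h.immersion u hu), inner_smul_left, inner_smul_right,
    real_inner_comm (X u) (N u)]
  simp
  ring

theorem vecLap_support (h : IsLocalHypersurface X N U) {c : ℝ}
    (hc : ∀ u ∈ U, (gramTrace (fderiv ℝ X u) fun v w =>
      -⟪fderiv ℝ N u v, fderiv ℝ X u w⟫) = c) (hu : u ∈ U) :
    vecLap X (fun u => ⟪X u, N u⟫) u = -c - (gramTrace (fderiv ℝ X u) fun v w =>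
      ⟪fderiv ℝ N u v, fderiv ℝ N u w⟫) * ⟪X u, N u⟫ := by
  have h1 : (gramTrace (fderiv ℝ X u) fun v w => ⟪fderiv ℝ X u v, fderiv ℝ N u w⟫) = -c := by
    rw [← hc u hu, gramTrace_comm, ← gramTrace_neg]
    exact gramTrace_congr fun v w => by rw [real_inner_comm]; ring
  rw [vecLap_inner h.isOpen h.smooth h.normal_smooth hu, h.vecLap_self hu, hc u hu, h1,
    h.vecLap_normal hc hu, inner_smul_left, inner_smul_right, real_inner_self_eq_norm_sq,
    h.normal_norm u hu]
  simp
  ring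

/-- Only the tangential parts of `a` and `b` enter, and the trace is minus the second fundamental
form of these parts, which is symmetric. It makes the cross terms in the Laplacian of the test
function cancel. -/
theorem gramTrace_shape_symm (h : IsLocalHypersurface X N U) (hu : u ∈ U) (a b : 𝔽) :
    (gramTrace (fderiv ℝ X u) fun v w => ⟪fderiv ℝ X u v, a⟫ * ⟪fderiv ℝ N u w, b⟫) =
      gramTrace (fderiv ℝ X u) fun v w => ⟪fderiv ℝ X u v, b⟫ * ⟪fderiv ℝ N u w, a⟫ := by
  have key : ∀ a b : 𝔽, ∀ ca cb : 𝔼, a = ⟪N u, a⟫ • N u + fderiv ℝ X u ca →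
      b = ⟪N u, b⟫ • N u + fderiv ℝ X u cb →
      (gramTrace (fderiv ℝ X u) fun v w => ⟪fderiv ℝ X u v, a⟫ * ⟪fderiv ℝ N u w, b⟫) =
        ⟪fderiv ℝ N u ca, fderiv ℝ X u cb⟫ := by
    intro a b ca cb ha hb
    have h1 : ∀ v, ⟪fderiv ℝ X u v, a⟫ = ⟪fderiv ℝ X u v, fderiv ℝ X u ca⟫ := fun v => by
      rw [ha, inner_add_right, inner_smul_right, real_inner_comm (N u),
        h.normal_orthogonal u hu]; simp
    have h2 : ∀ v, ⟪fderiv ℝ N u v, b⟫ = ⟪fderiv ℝ X u cb, fderiv ℝ N u v⟫ := fun v => by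
      rw [hb, inner_add_right, inner_smul_right, h.inner_fderiv_normal hu, real_inner_comm]
      simp [real_inner_comm]
    have h3 := gramTrace_inner_mul (h.immersion u hu) ca
      ((innerₗ _ (fderiv ℝ X u cb)).comp (fderiv ℝ N u : 𝔼 →ₗ[ℝ] 𝔽))
    rw [gramTrace_congr (fun v w => by rw [h1, h2]), real_inner_comm]
    exact h3
  obtain ⟨ca, ha⟩ := exists_tangential (h.immersion u hu) (h.normal_norm u hu)
    (h.normal_orthogonal u hu) a
  obtain ⟨cb, hb⟩ := exists_tangential (h.immersion u hu) (h.normal_norm u hu)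
    (h.normal_orthogonal u hu) b
  rw [key a b ca cb ha hb, key b a cb ca hb ha, h.secondForm_symm hu]

/-- Product rule from the Laplacians of ⟨a, X⟩, ⟨X, N⟩, ⟨a, N⟩ and |X|². The cross terms ∇⟨a,
X⟩·∇⟨X, N⟩ and -½ ∇|X|²·∇⟨a, N⟩ cancel by `gramTrace_shape_symm`, and so do the terms c⟨X, N⟩⟨a, N⟩.
-/
theorem vecLap_testFunction (h : IsLocalHypersurface X N U) {c : ℝ}
    (hc : ∀ u ∈ U, (gramTrace (fderiv ℝ X u) fun v w =>
      -⟪fderiv ℝ N u v, fderiv ℝ X u w⟫) = c) (hu : u ∈ U) (a : 𝔽) :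
    vecLap X (fun u => ⟪a, X u⟫ * ⟪X u, N u⟫ +
        (-(1 / 2) * ⟪X u, X u⟫ + -(1 / 2)) * ⟪a, N u⟫) u =
      -(gramTrace (fderiv ℝ X u) fun v w => ⟪fderiv ℝ N u v, fderiv ℝ N u w⟫) *
        (⟪a, X u⟫ * ⟪X u, N u⟫ + (-(1 / 2) * ⟪X u, X u⟫ + -(1 / 2)) * ⟪a, N u⟫) -
        c * ⟪a, X u⟫ - n * ⟪a, N u⟫ := by
  have hU := h.isOpen
  have dX := (differentiableAt_of_contDiffOn hU h.smooth hu).hasFDerivAt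
  have dN := (differentiableAt_of_contDiffOn hU h.normal_smooth hu).hasFDerivAt
  have sXN : ContDiffOn ℝ ∞ (fun u => ⟪X u, N u⟫) U := h.smooth.inner ℝ h.normal_smooth
  have sXX : ContDiffOn ℝ ∞ (fun u => ⟪X u, X u⟫) U := h.smooth.inner ℝ h.smooth
  have sX : ContDiffOn ℝ ∞ (fun u => ⟪a, X u⟫) U := contDiffOn_const.inner ℝ h.smooth
  have sN : ContDiffOn ℝ ∞ (fun u => ⟪a, N u⟫) U := contDiffOn_const.inner ℝ h.normal_smooth
  have sρ : ContDiffOn ℝ ∞ (fun u => -(1 / 2) * ⟪X u, X u⟫ + -(1 / 2)) U :=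
    (contDiffOn_const.mul sXX).add contDiffOn_const
  have lconst : ∀ r : ℝ, vecLap X (fun _ : 𝔼 => r) u = 0 := by
    intro r
    have : fderiv ℝ (fun _ : 𝔼 => r) = fun _ => 0 := by ext1 z; simp
    simp [vecLap, hessTrace, hess, this]
  have lX : vecLap X (fun u => ⟪a, X u⟫) u = c * ⟪a, N u⟫ := by
    have := vecLap_clm (X := X) hU h.smooth (innerSL ℝ a) hu
    simp only [innerSL_apply_apply] at this
    rw [this, h.vecLap_self hu, hc u hu, inner_smul_right]
  have lN : vecLap X (fun u => ⟪a, N u⟫) u = -(gramTrace (fderiv ℝ X u) fun v w =>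
      ⟪fderiv ℝ N u v, fderiv ℝ N u w⟫) * ⟪a, N u⟫ := by
    have := vecLap_clm (X := X) hU h.normal_smooth (innerSL ℝ a) hu
    simp only [innerSL_apply_apply] at this
    rw [this, h.vecLap_normal hc hu, inner_smul_right]
  have lρ : vecLap X (fun u => -(1 / 2) * ⟪X u, X u⟫ + -(1 / 2)) u =
      -(n + c * ⟪X u, N u⟫) := by
    have := vecLap_clm (X := X) hU sXX ((-(1 / 2) : ℝ) • ContinuousLinearMap.id ℝ ℝ) hu
    simp only [smul_apply, ContinuousLinearMap.id_apply, smul_eq_mul] at this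
    rw [vecLap_add hU (contDiffOn_const.mul sXX) contDiffOn_const hu, this,
      h.vecLap_inner_self hc hu, lconst]
    ring
  have e1 : ∀ v, fderiv ℝ (fun u => ⟪a, X u⟫) u v = ⟪fderiv ℝ X u v, a⟫ := fun v => by
    rw [((hasFDerivAt_const a u).inner ℝ dX).fderiv]
    simp [real_inner_comm a]
  have e2 : ∀ v, fderiv ℝ (fun u => ⟪a, N u⟫) u v = ⟪fderiv ℝ N u v, a⟫ := fun v => by
    rw [((hasFDerivAt_const a u).inner ℝ dN).fderiv]
    simp [real_inner_comm a]
  have e3 : ∀ v, fderiv ℝ (fun u => ⟪X u, N u⟫) u v = ⟪fderiv ℝ N u v, X u⟫ := fun v => by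
    rw [(dX.inner ℝ dN).fderiv]
    simp only [ContinuousLinearMap.comp_apply, ContinuousLinearMap.prod_apply,
      fderivInnerCLM_apply]
    rw [real_inner_comm (N u), h.normal_orthogonal u hu, add_zero, real_inner_comm]
  have e4 : ∀ v, fderiv ℝ (fun u => -(1 / 2) * ⟪X u, X u⟫ + -(1 / 2)) u v =
      -⟪fderiv ℝ X u v, X u⟫ := fun v => by
    have := ((dX.inner ℝ dX).const_mul (-(1 / 2) : ℝ)).add_const (-(1 / 2) : ℝ)
    rw [this.fderiv]
    simp only [smul_apply, ContinuousLinearMap.comp_apply, ContinuousLinearMap.prod_apply,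
      fderivInnerCLM_apply, smul_eq_mul]
    rw [real_inner_comm (X u)]
    ring
  rw [vecLap_add hU (sX.mul sXN) (sρ.mul sN) hu, vecLap_mul hU sX sXN hu, vecLap_mul hU sρ sN hu,
    lX, lN, lρ, h.vecLap_support hc hu]
  simp_rw [e1, e2, e3, e4, neg_mul]
  rw [gramTrace_neg, h.gramTrace_shape_symm hu a (X u)]
  ring

end IsLocalHypersurface

end LocalTestFunction

/-! ### Laplacians at the interior points of the manifold. -/

section Interior

variable {m : ℕ} {M : Type*} [TopologicalSpace M] [ChartedSpace (EuclideanHalfSpace (m + 1)) M]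
  {x N : M → EuclideanSpace ℝ (Fin (m + 2))}

/-- The normal component of the conformal field `y ↦ ⟪a, y⟫ y - ((|y|² + 1) / 2) a` along `x`. -/
def testFunction (x N : M → EuclideanSpace ℝ (Fin (m + 2))) (a : EuclideanSpace ℝ (Fin (m + 2)))
    (p : M) : ℝ :=
  ⟪a, x p⟫ * ⟪x p, N p⟫ + (-(1 / 2) * ⟪x p, x p⟫ + -(1 / 2)) * ⟪a, N p⟫

/-- Half the squared distance to the origin, normalized to vanish on the unit sphere. -/
def sphereDefect (x : M → EuclideanSpace ℝ (Fin (m + 2))) (p : M) : ℝ :=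
  (1 / 2) * ⟪x p, x p⟫ + -(1 / 2)

theorem contMDiff_inner {n : WithTop ℕ∞} {k : ℕ} {V W : M → EuclideanSpace ℝ (Fin k)}
    (hV : ContMDiff (𝓡∂ (m + 1)) 𝓘(ℝ, EuclideanSpace ℝ (Fin k)) n V)
    (hW : ContMDiff (𝓡∂ (m + 1)) 𝓘(ℝ, EuclideanSpace ℝ (Fin k)) n W) :
    ContMDiff (𝓡∂ (m + 1)) 𝓘(ℝ, ℝ) n fun p => ⟪V p, W p⟫ := by
  have h : ContDiff ℝ n fun z : EuclideanSpace ℝ (Fin k) × EuclideanSpace ℝ (Fin k) =>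
      ⟪z.1, z.2⟫ := contDiff_fst.inner ℝ contDiff_snd
  exact h.contMDiff.comp (hV.prodMk_space hW)

theorem contMDiff_testFunction
    (hx : ContMDiff (𝓡∂ (m + 1)) 𝓘(ℝ, EuclideanSpace ℝ (Fin (m + 2))) ∞ x)
    (hN : ContMDiff (𝓡∂ (m + 1)) 𝓘(ℝ, EuclideanSpace ℝ (Fin (m + 2))) ∞ N)
    (a : EuclideanSpace ℝ (Fin (m + 2))) :
    ContMDiff (𝓡∂ (m + 1)) 𝓘(ℝ, ℝ) ∞ (testFunction x N a) := by
  have h : ContDiff ℝ ∞ fun z : EuclideanSpace ℝ (Fin (m + 2)) × EuclideanSpace ℝ (Fin (m + 2)) =>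
      ⟪a, z.1⟫ * ⟪z.1, z.2⟫ + (-(1 / 2) * ⟪z.1, z.1⟫ + -(1 / 2)) * ⟪a, z.2⟫ :=
    ((contDiff_const.inner ℝ contDiff_fst).mul (contDiff_fst.inner ℝ contDiff_snd)).add
      (((contDiff_const.mul (contDiff_fst.inner ℝ contDiff_fst)).add contDiff_const).mul
        (contDiff_const.inner ℝ contDiff_snd))
  exact h.contMDiff.comp (hx.prodMk_space hN)

theorem contMDiff_sphereDefect
    (hx : ContMDiff (𝓡∂ (m + 1)) 𝓘(ℝ, EuclideanSpace ℝ (Fin (m + 2))) ∞ x) :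
    ContMDiff (𝓡∂ (m + 1)) 𝓘(ℝ, ℝ) ∞ (sphereDefect x) := by
  have h : ContDiff ℝ ∞ fun z : EuclideanSpace ℝ (Fin (m + 2)) =>
      (1 / 2 : ℝ) * ⟪z, z⟫ + -(1 / 2) :=
    (contDiff_const.mul (contDiff_id.inner ℝ contDiff_id)).add contDiff_const
  exact h.contMDiff.comp hx

/-- The differential, in terms of the preferred chart. -/
theorem hasFDerivWithinAt_chartRep {Z : Type*} [NormedAddCommGroup Z] [NormedSpace ℝ Z]
    {f : M → Z} {p : M} (hf : MDifferentiableAt (𝓡∂ (m + 1)) 𝓘(ℝ, Z) f p) :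
    HasFDerivWithinAt (chartRep p f) (differential m f p) (range (𝓡∂ (m + 1)))
      (extChartAt (𝓡∂ (m + 1)) p p) :=
  hf.hasMFDerivAt.2

theorem differential_eq_of_hasFDerivWithinAt {Z : Type*} [NormedAddCommGroup Z] [NormedSpace ℝ Z]
    {f : M → Z} {p : M} (hc : ContinuousAt f p)
    {L : EuclideanSpace ℝ (Fin (m + 1)) →L[ℝ] Z}
    (h : HasFDerivWithinAt (chartRep p f) L (range (𝓡∂ (m + 1))) (extChartAt (𝓡∂ (m + 1)) p p)) :
    differential m f p = L :=
  (show HasMFDerivAt (𝓡∂ (m + 1)) 𝓘(ℝ, Z) f p L from ⟨hc, h⟩).mfderiv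

theorem differential_inner {k : ℕ} {V W : M → EuclideanSpace ℝ (Fin k)} {p : M}
    (hV : MDifferentiableAt (𝓡∂ (m + 1)) 𝓘(ℝ, EuclideanSpace ℝ (Fin k)) V p)
    (hW : MDifferentiableAt (𝓡∂ (m + 1)) 𝓘(ℝ, EuclideanSpace ℝ (Fin k)) W p)
    (v : EuclideanSpace ℝ (Fin (m + 1))) :
    differential m (fun p => ⟪V p, W p⟫) p v =
      ⟪differential m V p v, W p⟫ + ⟪V p, differential m W p v⟫ := by
  have h1 := (hasFDerivWithinAt_chartRep hV).inner ℝ (hasFDerivWithinAt_chartRep hW)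
  have h2 := differential_eq_of_hasFDerivWithinAt (f := fun p => ⟪V p, W p⟫)
    (hV.continuousAt.inner hW.continuousAt) h1
  rw [h2]
  simp only [ContinuousLinearMap.comp_apply, ContinuousLinearMap.prod_apply, fderivInnerCLM_apply,
    chartRep, Function.comp_apply, extChartAt_to_inv]
  exact add_comm _ _

variable [IsManifold (𝓡∂ (m + 1)) ∞ M]

namespace IsImmersedInBall

theorem isLocalHypersurface (h : IsImmersedInBall x N) (p : M) :
    IsLocalHypersurface (chartRep p x) (chartRep p N) (chartInterior p) where
  isOpen := isOpen_chartInterior p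
  smooth := contDiffOn_chartRep_interior h.smooth p
  normal_smooth := contDiffOn_chartRep_interior h.normal_smooth p
  immersion _ hu := injective_fderiv_chartRep h.smooth h.immersion hu
  normal_norm _ _ := h.normal_norm _
  normal_orthogonal u hu v := by
    rw [fderiv_chartRep hu (h.smooth.mdifferentiable (by simp) _)]
    exact h.normal_orthogonal _ _

omit [IsManifold (𝓡∂ (m + 1)) ∞ M] in
theorem inner_differential_normal (h : IsImmersedInBall x N) (p : M)
    (v : EuclideanSpace ℝ (Fin (m + 1))) : ⟪differential m N p v, N p⟫ = 0 := by
  have hN := h.normal_smooth.mdifferentiable (by simp) p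
  have h1 := differential_inner hN hN v
  have h2 : (fun p => ⟪N p, N p⟫) = fun _ => (1 : ℝ) := by
    ext q; rw [real_inner_self_eq_norm_sq, h.normal_norm]; norm_num
  have h3 : differential m (fun p => ⟪N p, N p⟫) p = 0 := by
    rw [h2]; exact mfderiv_const
  rw [h3, real_inner_comm (differential m N p v) (N p)] at h1
  have : (0 : ℝ) = ⟪differential m N p v, N p⟫ + ⟪differential m N p v, N p⟫ := h1
  linarith

omit [IsManifold (𝓡∂ (m + 1)) ∞ M] in
-- dN takes tangential values, so ⟨dN(v), dN(w)⟩ is itself the trace of σ(v, ·)σ(w, ·), by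
-- `gramTrace_inner_inner`.
theorem secondFormNormSq_eq (h : IsImmersedInBall x N) (p : M) :
    secondFormNormSq x N p = gramTrace (differential m x p) fun v w =>
      ⟪differential m N p v, differential m N p w⟫ := by
  have h1 : ∀ v w, ⟪differential m N p v, differential m N p w⟫ =
      gramTrace (differential m x p) fun a b =>
        ⟪differential m x p a, differential m N p v⟫ *
          ⟪differential m x p b, differential m N p w⟫ := by
    intro v w
    rw [gramTrace_inner_inner (h.immersion p) (h.normal_norm p) (h.normal_orthogonal p),
      real_inner_comm (differential m N p v) (N p), h.inner_differential_normal]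
    simp
  rw [gramTrace_congr h1, secondFormNormSq, Matrix.mul_assoc, Matrix.mul_assoc, gramTrace_comm]
  unfold gramTrace Matrix.trace
  refine Finset.sum_congr rfl fun i _ => ?_
  rw [Matrix.diag, Matrix.mul_apply]
  refine Finset.sum_congr rfl fun j _ => ?_
  refine congrArg₂ _ rfl ?_
  rw [Matrix.mul_apply]
  refine Finset.sum_congr rfl fun k _ => ?_
  rw [Matrix.mul_apply, Finset.mul_sum]
  refine Finset.sum_congr rfl fun l _ => ?_
  simp only [secondFormMatrix, secondForm, Matrix.of_apply, Matrix.transpose_apply]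
  rw [real_inner_comm (differential m x p (EuclideanSpace.single k 1)),
    real_inner_comm (differential m x p (EuclideanSpace.single l 1))]
  have : metricMatrix x p = gramMatrix (differential m x p) := rfl
  rw [this]
  ring

variable {H : ℝ}

theorem gramTrace_chart (h : IsImmersedInBall x N) (hH : ∀ p, meanCurvature x N p = H) (p : M) :
    ∀ u ∈ chartInterior (m := m) p, (gramTrace (fderiv ℝ (chartRep p x) u) fun v w =>
      -⟪fderiv ℝ (chartRep p N) u v, fderiv ℝ (chartRep p x) u w⟫) = ((m : ℝ) + 1) * H := by
  intro u hu
  have h1 := gramTrace_inner_eq_chart h.smooth hu (h.normal_smooth.mdifferentiable (by simp) _)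
    (h.smooth.mdifferentiable (by simp) _)
  rw [gramTrace_neg, ← h1, ← gramTrace_neg, ← hH ((extChartAt (𝓡∂ (m + 1)) p).symm u),
    meanCurvature_eq_gramTrace]

theorem extChartAt_mem_chartInterior {p : M} (hp : p ∈ (𝓡∂ (m + 1)).interior M) :
    extChartAt (𝓡∂ (m + 1)) p p ∈ chartInterior (m := m) p :=
  (mem_interior_iff_chart (mem_extChartAt_source p)).1 hp

theorem laplacian_eq_vecLap (h : IsImmersedInBall x N) {f : M → ℝ}
    (hf : ContMDiff (𝓡∂ (m + 1)) 𝓘(ℝ, ℝ) ∞ f) {p : M} (hp : p ∈ (𝓡∂ (m + 1)).interior M) :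
    laplacian x f p = vecLap (chartRep p x) (chartRep p f) (extChartAt (𝓡∂ (m + 1)) p p) := by
  have hu := extChartAt_mem_chartInterior hp
  have h1 := laplacian_eq_chart h.smooth h.immersion hf hu
  rw [extChartAt_to_inv] at h1
  rw [h1, locLap_eq_vecLap (isOpen_chartInterior p) (h.isLocalHypersurface p).smooth
    (h.isLocalHypersurface p).immersion (contDiffOn_chartRep_interior hf p) hu]

theorem laplacian_testFunction (h : IsImmersedInBall x N) (hH : ∀ p, meanCurvature x N p = H)
    (a : EuclideanSpace ℝ (Fin (m + 2))) {p : M} (hp : p ∈ (𝓡∂ (m + 1)).interior M) :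
    laplacian x (testFunction x N a) p + secondFormNormSq x N p * testFunction x N a p =
      -(((m : ℝ) + 1) * (H * ⟪a, x p⟫ + ⟪a, N p⟫)) := by
  have hu := extChartAt_mem_chartInterior hp
  have h1 := (h.isLocalHypersurface p).vecLap_testFunction (h.gramTrace_chart hH p) hu a
  have h2 := gramTrace_inner_eq_chart h.smooth hu (h.normal_smooth.mdifferentiable (by simp) _)
    (h.normal_smooth.mdifferentiable (by simp) _)
  rw [← h2, extChartAt_to_inv, ← h.secondFormNormSq_eq] at h1
  have h3 : ∀ {Z : Type} (f : M → Z), f ((extChartAt (𝓡∂ (m + 1)) p).symm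
      (extChartAt (𝓡∂ (m + 1)) p p)) = f p := fun f => by rw [extChartAt_to_inv]
  simp only [chartRep, Function.comp_apply, h3] at h1
  rw [h.laplacian_eq_vecLap (contMDiff_testFunction h.smooth h.normal_smooth a) hp]
  have h4 : chartRep p (testFunction x N a) = fun u =>
      ⟪a, x ((extChartAt (𝓡∂ (m + 1)) p).symm u)⟫ *
        ⟪x ((extChartAt (𝓡∂ (m + 1)) p).symm u), N ((extChartAt (𝓡∂ (m + 1)) p).symm u)⟫ +
      (-(1 / 2) * ⟪x ((extChartAt (𝓡∂ (m + 1)) p).symm u),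
        x ((extChartAt (𝓡∂ (m + 1)) p).symm u)⟫ + -(1 / 2)) *
        ⟪a, N ((extChartAt (𝓡∂ (m + 1)) p).symm u)⟫ := rfl
  rw [h4]
  unfold chartRep
  rw [h1, testFunction]
  push_cast
  ring

theorem laplacian_sphereDefect (h : IsImmersedInBall x N) (hH : ∀ p, meanCurvature x N p = H)
    {p : M} (hp : p ∈ (𝓡∂ (m + 1)).interior M) :
    laplacian x (sphereDefect x) p = ((m : ℝ) + 1) * (1 + H * ⟪x p, N p⟫) := by
  have hu := extChartAt_mem_chartInterior hp
  have hl := h.isLocalHypersurface p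
  have h1 := hl.vecLap_inner_self (h.gramTrace_chart hH p) hu
  have sXX : ContDiffOn ℝ ∞ (fun u => ⟪chartRep (m := m) p x u, chartRep (m := m) p x u⟫)
      (chartInterior (m := m) p) := hl.smooth.inner ℝ hl.smooth
  rw [h.laplacian_eq_vecLap (contMDiff_sphereDefect h.smooth) hp]
  have h4 : chartRep (m := m) p (sphereDefect x) = fun u =>
      (1 / 2) * ⟪chartRep (m := m) p x u, chartRep (m := m) p x u⟫ + -(1 / 2) := rfl
  have lconst : vecLap (chartRep p x) (fun _ : EuclideanSpace ℝ (Fin (m + 1)) => -(1 / 2 : ℝ))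
      (extChartAt (𝓡∂ (m + 1)) p p) = 0 := by
    simp [vecLap, hessTrace, hess]
  have := vecLap_clm (X := chartRep p x) hl.isOpen sXX
    ((1 / 2 : ℝ) • ContinuousLinearMap.id ℝ ℝ) hu
  simp only [smul_apply, ContinuousLinearMap.id_apply, smul_eq_mul] at this
  rw [h4, vecLap_add hl.isOpen (contDiffOn_const.mul sXX) contDiffOn_const hu, this, h1, lconst]
  simp only [chartRep, Function.comp_apply, extChartAt_to_inv]
  push_cast
  ring

end IsImmersedInBall

end Interior

/-! ### Geometry along the boundary and the linearized contact angle condition. -/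

section Boundary

variable {m : ℕ} {M : Type*} [TopologicalSpace M] [ChartedSpace (EuclideanHalfSpace (m + 1)) M]
  {x N : M → EuclideanSpace ℝ (Fin (m + 2))} {p : M} {θ : ℝ}

theorem extChartAt_boundary_zero (hp : p ∈ (𝓡∂ (m + 1)).boundary M) :
    extChartAt (𝓡∂ (m + 1)) p p 0 = 0 := by
  have h : extChartAt (𝓡∂ (m + 1)) p p ∈ frontier (range (𝓡∂ (m + 1))) := hp
  rw [frontier_range_modelWithCornersEuclideanHalfSpace] at h
  exact h.symm

theorem mem_range_halfSpace {u : EuclideanSpace ℝ (Fin (m + 1))} :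
    u ∈ range (𝓡∂ (m + 1)) ↔ 0 ≤ u 0 := by
  rw [range_modelWithCornersEuclideanHalfSpace]; rfl

theorem tendsto_line_chart {s : Set ℝ} {v : EuclideanSpace ℝ (Fin (m + 1))}
    (hs : ∀ t ∈ s, extChartAt (𝓡∂ (m + 1)) p p + t • v ∈ range (𝓡∂ (m + 1))) :
    Filter.Tendsto (fun t : ℝ => extChartAt (𝓡∂ (m + 1)) p p + t • v) (nhdsWithin 0 s)
      (nhdsWithin (extChartAt (𝓡∂ (m + 1)) p p) (range (𝓡∂ (m + 1)))) := by
  refine tendsto_nhdsWithin_iff.2 ⟨?_, eventually_nhdsWithin_of_forall hs⟩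
  have : Continuous fun t : ℝ => extChartAt (𝓡∂ (m + 1)) p p + t • v := by fun_prop
  simpa using (this.tendsto 0).mono_left nhdsWithin_le_nhds

theorem hasDerivWithinAt_line_chart {f : M → ℝ} (hf : MDifferentiableAt (𝓡∂ (m + 1)) 𝓘(ℝ, ℝ) f p)
    {s : Set ℝ} {v : EuclideanSpace ℝ (Fin (m + 1))}
    (hs : ∀ t ∈ s, extChartAt (𝓡∂ (m + 1)) p p + t • v ∈ range (𝓡∂ (m + 1))) :
    HasDerivWithinAt (fun t : ℝ => chartRep p f (extChartAt (𝓡∂ (m + 1)) p p + t • v))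
      (differential m f p v) s 0 := by
  have hline : HasDerivWithinAt (fun t : ℝ => extChartAt (𝓡∂ (m + 1)) p p + t • v) v s 0 := by
    simpa using (((hasDerivAt_id (0 : ℝ)).smul_const v).const_add
      (extChartAt (𝓡∂ (m + 1)) p p)).hasDerivWithinAt
  exact (hasFDerivWithinAt_chartRep hf).comp_hasDerivWithinAt_of_eq 0 hline hs (by simp)

/-- The derivative at a boundary maximum in the directions that point into `M`. -/
theorem differential_nonpos_of_le {f : M → ℝ} (hf : MDifferentiableAt (𝓡∂ (m + 1)) 𝓘(ℝ, ℝ) f p)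
    (hmax : ∀ q, f q ≤ f p) {v : EuclideanSpace ℝ (Fin (m + 1))} (hv : 0 ≤ v 0) :
    differential m f p v ≤ 0 := by
  have hp : 0 ≤ extChartAt (𝓡∂ (m + 1)) p p 0 :=
    mem_range_halfSpace.1 (extChartAt_target_subset_range p (mem_extChartAt_target p))
  have h := hasDerivWithinAt_line_chart hf (s := Ici 0) (v := v) fun t (ht : 0 ≤ t) =>
    mem_range_halfSpace.2 (by simp; positivity)
  have h2 := hasDerivWithinAt_iff_tendsto_slope.1 h
  have : (nhdsWithin (0 : ℝ) (Ici 0 \ {0})).NeBot := by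
    rw [Ici_sdiff_left]; infer_instance
  refine le_of_tendsto h2 ?_
  filter_upwards [self_mem_nhdsWithin] with t ht
  have ht' : 0 < t := lt_of_le_of_ne ht.1 (Ne.symm ht.2)
  rw [slope_def_field]
  refine div_nonpos_of_nonpos_of_nonneg ?_ (by linarith)
  have e : chartRep p f (extChartAt (𝓡∂ (m + 1)) p p + (0 : ℝ) • v) = f p := by
    simp only [chartRep, Function.comp_apply, zero_smul, add_zero, extChartAt_to_inv]
  rw [e, sub_nonpos]
  exact hmax _

variable [IsManifold (𝓡∂ (m + 1)) ∞ M]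

/-- A function that is constant on the boundary has vanishing derivatives along the boundary. -/
theorem differential_eq_zero_of_boundary {f : M → ℝ} {c : ℝ}
    (hf : MDifferentiableAt (𝓡∂ (m + 1)) 𝓘(ℝ, ℝ) f p)
    (hc : ∀ q ∈ (𝓡∂ (m + 1)).boundary M, f q = c) (hp : p ∈ (𝓡∂ (m + 1)).boundary M)
    {v : EuclideanSpace ℝ (Fin (m + 1))} (hv : v 0 = 0) : differential m f p v = 0 := by
  have h0 := extChartAt_boundary_zero hp
  have hl : ∀ t : ℝ, (extChartAt (𝓡∂ (m + 1)) p p + t • v) 0 = 0 := fun t => by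
    rw [PiLp.add_apply, PiLp.smul_apply, h0, hv]; simp
  have hs : ∀ t ∈ (univ : Set ℝ), extChartAt (𝓡∂ (m + 1)) p p + t • v ∈ range (𝓡∂ (m + 1)) :=
    fun t _ => mem_range_halfSpace.2 (hl t).ge
  have h := hasDerivWithinAt_line_chart hf hs
  have ht := (tendsto_line_chart hs).eventually
    (extChartAt_target_mem_nhdsWithin_of_mem (mem_extChartAt_target (I := 𝓡∂ (m + 1)) p))
  rw [nhdsWithin_univ] at ht
  rw [hasDerivWithinAt_univ] at h
  have he : (fun t : ℝ => chartRep p f (extChartAt (𝓡∂ (m + 1)) p p + t • v)) =ᶠ[nhds 0]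
      fun _ => c := by
    filter_upwards [ht] with t ht
    refine hc _ ?_
    rw [← (𝓡∂ (m + 1)).compl_interior, mem_compl_iff, symm_mem_interior_iff ht,
      mem_chartInterior_iff, hl]
    simp
  exact h.unique ((hasDerivAt_const (0 : ℝ) c).congr_of_eventuallyEq he)

namespace IsImmersedInBall

/-- The second fundamental form is symmetric, up to the boundary. -/
theorem secondForm_symm (h : IsImmersedInBall x N) (p : M)
    (v w : EuclideanSpace ℝ (Fin (m + 1))) :
    ⟪differential m N p v, differential m x p w⟫ =
      ⟪differential m N p w, differential m x p v⟫ := by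
  set T := (extChartAt (𝓡∂ (m + 1)) p).target
  set u₀ := extChartAt (𝓡∂ (m + 1)) p p
  have hu₀ : u₀ ∈ T := mem_extChartAt_target p
  have hUD : UniqueDiffOn ℝ T := uniqueDiffOn_extChartAt_target p
  have hd : ∀ {V : M → EuclideanSpace ℝ (Fin (m + 2))},
      ContMDiff (𝓡∂ (m + 1)) 𝓘(ℝ, EuclideanSpace ℝ (Fin (m + 2))) ∞ V →
      fderivWithin ℝ (chartRep p V) T u₀ = differential m V p := fun hV =>
    ((hasFDerivWithinAt_chartRep (hV.mdifferentiable (by simp) p)).mono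
      (extChartAt_target_subset_range p)).fderivWithin (hUD u₀ hu₀)
  have hcont : ∀ {V : M → EuclideanSpace ℝ (Fin (m + 2))},
      ContMDiff (𝓡∂ (m + 1)) 𝓘(ℝ, EuclideanSpace ℝ (Fin (m + 2))) ∞ V → ∀ v,
      ContinuousWithinAt (fun u => fderivWithin ℝ (chartRep p V) T u v) T u₀ := fun hV v =>
    (((contDiffOn_chartRep hV p).continuousOn_fderivWithin hUD (by simp)) u₀ hu₀).clm_apply
      continuousWithinAt_const
  have h1 : ∀ v w, ContinuousWithinAt (fun u => ⟪fderivWithin ℝ (chartRep p N) T u v,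
      fderivWithin ℝ (chartRep p x) T u w⟫) T u₀ := fun v w =>
    (hcont h.normal_smooth v).inner (hcont h.smooth w)
  -- The symmetry is known at interior points of the chart. Both sides are continuous up to the
  -- boundary, and `u₀` is a limit of such points.
  have hcl : u₀ ∈ closure (chartInterior p) := extChartAt_target_subset_closure_interior hu₀
  have hne : (nhdsWithin u₀ (chartInterior p)).NeBot := mem_closure_iff_nhdsWithin_neBot.1 hcl
  have h2 := (h1 v w).mono_left (nhdsWithin_mono u₀ (chartInterior_subset p))
  have h3 := (h1 w v).mono_left (nhdsWithin_mono u₀ (chartInterior_subset p))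
  have h4 := tendsto_nhds_unique_of_eventuallyEq h2 h3 (by
    filter_upwards [self_mem_nhdsWithin] with u hu
    have e : ∀ V : M → EuclideanSpace ℝ (Fin (m + 2)),
        fderivWithin ℝ (chartRep p V) T u = fderiv ℝ (chartRep p V) u := fun V =>
      fderivWithin_of_mem_nhds (mem_interior_iff_mem_nhds.1 hu)
    rw [e, e]
    exact (h.isLocalHypersurface p).secondForm_symm hu v w)
  simpa only [hd h.smooth, hd h.normal_smooth] using h4

omit [IsManifold (𝓡∂ (m + 1)) ∞ M] in
theorem inv_metric_pos (h : IsImmersedInBall x N) (p : M) : 0 < (metricMatrix x p)⁻¹ 0 0 :=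
  (gramMatrix_posDef (h.immersion p)).inv.diag_pos

omit [IsManifold (𝓡∂ (m + 1)) ∞ M] in
-- `conormalTangent` is the metric dual of the form du₀, up to the factor -1/√g⁰⁰, so pairing with
-- the conormal reads off the first coordinate. Unit length and orthogonality to ∂M follow from
-- this.
theorem inner_conormal (h : IsImmersedInBall x N) (p : M)
    (v : EuclideanSpace ℝ (Fin (m + 1))) :
    ⟪conormal x p, differential m x p v⟫ = -(v 0) / Real.sqrt ((metricMatrix x p)⁻¹ 0 0) := by
  have h1 := gramTrace_inner_mul (h.immersion p) v (EuclideanSpace.proj (𝕜 := ℝ) (0 : Fin (m + 1)) :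
    EuclideanSpace ℝ (Fin (m + 1)) →ₗ[ℝ] ℝ)
  have h2 : (EuclideanSpace.proj (𝕜 := ℝ) (0 : Fin (m + 1)) : EuclideanSpace ℝ (Fin (m + 1)) →ₗ[ℝ] ℝ) v = v 0 :=
    rfl
  rw [h2] at h1
  have h3 := map_eq_sum_smul_single (differential m x p : EuclideanSpace ℝ (Fin (m + 1)) →ₗ[ℝ]
    EuclideanSpace ℝ (Fin (m + 2))) (conormalTangent x p)
  simp only [ContinuousLinearMap.coe_coe] at h3
  rw [conormal, h3, sum_inner, ← h1, gramTrace, ← Finset.sum_neg_distrib, Finset.sum_div]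
  refine Finset.sum_congr rfl fun i _ => ?_
  rw [Finset.sum_eq_single 0]
  · simp only [inner_smul_left, conormalTangent, conj_trivial]
    have e : (EuclideanSpace.proj (𝕜 := ℝ) (0 : Fin (m + 1)) : EuclideanSpace ℝ (Fin (m + 1)) →ₗ[ℝ] ℝ)
        (EuclideanSpace.single 0 1) = 1 := by
      change (EuclideanSpace.single (0 : Fin (m + 1)) (1 : ℝ)) 0 = 1
      simp
    rw [e]
    have : metricMatrix x p = gramMatrix (differential m x p) := rfl
    rw [this]
    ring
  · intro j _ hj
    have e : (EuclideanSpace.proj (𝕜 := ℝ) (0 : Fin (m + 1)) : EuclideanSpace ℝ (Fin (m + 1)) →ₗ[ℝ] ℝ)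
        (EuclideanSpace.single j 1) = 0 := by
      change (EuclideanSpace.single j (1 : ℝ)) 0 = 0
      simp [hj.symm]
    rw [e]; ring
  · simp

omit [IsManifold (𝓡∂ (m + 1)) ∞ M] in
theorem conormalTangent_zero (h : IsImmersedInBall x N) (p : M) :
    conormalTangent x p 0 = -Real.sqrt ((metricMatrix x p)⁻¹ 0 0) := by
  have h1 := h.inv_metric_pos p
  have h2 : Real.sqrt ((metricMatrix x p)⁻¹ 0 0) ≠ 0 := (Real.sqrt_pos.2 h1).ne'
  simp only [conormalTangent]
  rw [div_eq_iff h2, neg_mul, Real.mul_self_sqrt h1.le]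

omit [IsManifold (𝓡∂ (m + 1)) ∞ M] in
theorem inner_conormal_self (h : IsImmersedInBall x N) (p : M) :
    ⟪conormal x p, conormal x p⟫ = 1 := by
  have h1 := h.inner_conormal p (conormalTangent x p)
  have h2 : Real.sqrt ((metricMatrix x p)⁻¹ 0 0) ≠ 0 := (Real.sqrt_pos.2 (h.inv_metric_pos p)).ne'
  rw [h.conormalTangent_zero, neg_neg, div_self h2] at h1
  exact h1

omit [IsManifold (𝓡∂ (m + 1)) ∞ M] in
theorem exists_conormal_decomposition (h : IsImmersedInBall x N) (p : M)
    (v : EuclideanSpace ℝ (Fin (m + 1))) :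
    ∃ (r : ℝ) (w : EuclideanSpace ℝ (Fin (m + 1))), w 0 = 0 ∧ v = r • conormalTangent x p + w := by
  have h2 : conormalTangent x p 0 ≠ 0 := by
    rw [h.conormalTangent_zero]; exact neg_ne_zero.2 (Real.sqrt_pos.2 (h.inv_metric_pos p)).ne'
  refine ⟨v 0 / conormalTangent x p 0, v - (v 0 / conormalTangent x p 0) • conormalTangent x p,
    ?_, by abel⟩
  simp [h2]

omit [IsManifold (𝓡∂ (m + 1)) ∞ M] in
theorem inner_self_le_one (h : IsImmersedInBall x N) (q : M) : ⟪x q, x q⟫ ≤ 1 := by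
  rw [real_inner_self_eq_norm_sq]
  rcases (𝓡∂ (m + 1)).isInteriorPoint_or_isBoundaryPoint q with hq | hq
  · have := h.interior_mem q hq
    rw [mem_ball_zero_iff] at this
    nlinarith [norm_nonneg (x q)]
  · have := h.boundary_mem q hq
    rw [mem_sphere_zero_iff_norm] at this
    rw [this]; norm_num

omit [IsManifold (𝓡∂ (m + 1)) ∞ M] in
theorem inner_self_boundary (h : IsImmersedInBall x N) (hp : p ∈ (𝓡∂ (m + 1)).boundary M) :
    ⟪x p, x p⟫ = 1 := by
  have := h.boundary_mem p hp
  rw [mem_sphere_zero_iff_norm] at this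
  rw [real_inner_self_eq_norm_sq, this]; norm_num

theorem inner_differential_boundary (h : IsImmersedInBall x N)
    (hp : p ∈ (𝓡∂ (m + 1)).boundary M) {v : EuclideanSpace ℝ (Fin (m + 1))} (hv : v 0 = 0) :
    ⟪x p, differential m x p v⟫ = 0 := by
  have hx := h.smooth.mdifferentiable (by simp) p
  have h1 := differential_inner hx hx v
  rw [differential_eq_zero_of_boundary ((contMDiff_inner h.smooth h.smooth).mdifferentiable
    (by simp) p) (fun q hq => h.inner_self_boundary hq) hp hv, real_inner_comm (x p)] at h1
  linarith

omit [IsManifold (𝓡∂ (m + 1)) ∞ M] in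
-- |x|² attains its maximum at boundary points, so it cannot increase in the inward direction
-- `-conormalTangent x p`.
theorem inner_conormal_nonneg (h : IsImmersedInBall x N) (hp : p ∈ (𝓡∂ (m + 1)).boundary M) :
    0 ≤ ⟪x p, conormal x p⟫ := by
  have hx := h.smooth.mdifferentiable (by simp) p
  have h1 := differential_inner hx hx (-conormalTangent x p)
  have h2 := differential_nonpos_of_le (f := fun p => ⟪x p, x p⟫)
    ((contMDiff_inner h.smooth h.smooth).mdifferentiable (by simp) p)
    (fun q => by rw [h.inner_self_boundary hp]; exact h.inner_self_le_one q)
    (v := -conormalTangent x p) (by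
      rw [PiLp.neg_apply, h.conormalTangent_zero, neg_neg]; positivity)
  rw [h1, real_inner_comm (x p), map_neg, inner_neg_right] at h2
  unfold conormal
  linarith

/-- At the boundary, the position vector is normal to `∂M`. -/
theorem position_boundary (h : IsImmersedInBall x N) (hp : p ∈ (𝓡∂ (m + 1)).boundary M) :
    x p = ⟪x p, N p⟫ • N p + ⟪x p, conormal x p⟫ • conormal x p := by
  have hNν : ⟪conormal x p, N p⟫ = 0 := by
    rw [real_inner_comm]; exact h.normal_orthogonal p _
  refine eq_of_inner_normal_tangent (h.immersion p) (h.normal_norm p) (h.normal_orthogonal p) ?_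
    fun v => ?_
  · rw [inner_add_left, inner_smul_left, inner_smul_left, hNν, real_inner_self_eq_norm_sq,
      h.normal_norm]
    simp
  · obtain ⟨r, w, hw, rfl⟩ := h.exists_conormal_decomposition p v
    have e1 := h.inner_differential_boundary hp hw
    have e2 := h.inner_conormal p w
    rw [hw, neg_zero, zero_div] at e2
    have e3 : differential m x p (conormalTangent x p) = conormal x p := rfl
    rw [map_add, map_smul, e3]
    simp only [inner_add_left, inner_add_right, inner_smul_left, inner_smul_right, e1, e2,
      h.normal_orthogonal, h.inner_conormal_self, real_inner_comm (conormal x p) (N p), hNν]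
    simp

end IsImmersedInBall

namespace IsCapillary

/-- Since x = ⟨x, N⟩N + ⟨x, ν⟩ν is a unit vector, so is ν̄, and ⟨ν, ν̄⟩ = ⟨x, N⟩. This product is
cos θ, whence ⟨x, ν⟩² = sin² θ; the sign comes from `inner_conormal_nonneg`. -/
theorem contact (h : IsCapillary x N θ) (hp : p ∈ (𝓡∂ (m + 1)).boundary M) :
    ⟪x p, N p⟫ = Real.cos θ ∧ ⟪x p, conormal x p⟫ = Real.sin θ := by
  have hi := h.toIsImmersedInBall
  set ν := conormal x p with hν
  have hNν : ⟪ν, N p⟫ = 0 := by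
    rw [real_inner_comm]; exact hi.normal_orthogonal p _
  have hνν : ⟪ν, ν⟫ = 1 := hi.inner_conormal_self p
  have hNN : ⟪N p, N p⟫ = 1 := by rw [real_inner_self_eq_norm_sq, hi.normal_norm]; norm_num
  have hs : ⟪x p, N p⟫ ^ 2 + ⟪x p, ν⟫ ^ 2 = 1 := by
    have e := hi.inner_self_boundary hp
    nth_rewrite 1 [hi.position_boundary hp] at e
    rw [inner_add_left, inner_smul_left, inner_smul_left, real_inner_comm (x p) (N p),
      real_inner_comm (x p) (conormal x p)] at e
    simp only [conj_trivial] at e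
    rw [← e]; ring
  have hw : ‖wettedConormal x N p‖ = 1 := by
    have : ‖wettedConormal x N p‖ ^ 2 = 1 := by
      rw [← real_inner_self_eq_norm_sq, wettedConormal, ← hν]
      simp only [inner_sub_left, inner_sub_right, inner_smul_left, inner_smul_right, hνν, hNN, hNν,
        real_inner_comm ν (N p), conj_trivial]
      linear_combination hs
    nlinarith [norm_nonneg (wettedConormal x N p)]
  have hn : ‖ν‖ = 1 := by
    have : ‖ν‖ ^ 2 = 1 := by rw [← real_inner_self_eq_norm_sq, hνν]
    nlinarith [norm_nonneg ν]
  have h1 : ⟪x p, N p⟫ = Real.cos θ := by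
    rw [← h.contact_angle p hp, InnerProductGeometry.cos_angle, ← hν, hn, hw, wettedConormal, ← hν]
    rw [inner_sub_right, inner_smul_right, inner_smul_right, hνν, hNν]
    simp
  refine ⟨h1, ?_⟩
  have h2 := hi.inner_conormal_nonneg hp
  rw [← hν] at h2
  have h3 : 0 < Real.sin θ := Real.sin_pos_of_mem_Ioo h.angle_mem
  have h4 := Real.sin_sq_add_cos_sq θ
  rw [h1] at hs
  have h5 : ⟪x p, ν⟫ ^ 2 = Real.sin θ ^ 2 := by linarith
  exact (sq_eq_sq₀ h2 h3.le).1 h5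

/-- The conormal is a principal direction. -/
theorem differential_normal_conormal (h : IsCapillary x N θ)
    (hp : p ∈ (𝓡∂ (m + 1)).boundary M) :
    differential m N p (conormalTangent x p) =
      -secondForm x N p (conormalTangent x p) (conormalTangent x p) • conormal x p := by
  have hi := h.toIsImmersedInBall
  have hsin : 0 < Real.sin θ := Real.sin_pos_of_mem_Ioo h.angle_mem
  have hx := hi.smooth.mdifferentiable (by simp) p
  have hN := hi.normal_smooth.mdifferentiable (by simp) p
  have hNν : ⟪conormal x p, N p⟫ = 0 := by
    rw [real_inner_comm]; exact hi.normal_orthogonal p _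
  -- Differentiate ⟨x, N⟩ = cos θ along ∂M: 0 = ⟨x, dN(w)⟩ = sin θ ⟨ν, dN(w)⟩, and sin θ ≠ 0.
  have key : ∀ w : EuclideanSpace ℝ (Fin (m + 1)), w 0 = 0 →
      ⟪differential m N p w, conormal x p⟫ = 0 := by
    intro w hw
    have h1 := differential_inner hx hN w
    rw [differential_eq_zero_of_boundary ((contMDiff_inner hi.smooth
      hi.normal_smooth).mdifferentiable (by simp) p) (fun q hq => (h.contact hq).1) hp hw,
      real_inner_comm (N p), hi.normal_orthogonal, hi.position_boundary hp, inner_add_left,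
      inner_smul_left, inner_smul_left, real_inner_comm (differential m N p w) (N p),
      hi.inner_differential_normal, (h.contact hp).2,
      real_inner_comm (differential m N p w) (conormal x p)] at h1
    simp only [conj_trivial, mul_zero, zero_add] at h1
    exact (mul_eq_zero.1 h1.symm).resolve_left hsin.ne'
  refine eq_of_inner_normal_tangent (hi.immersion p) (hi.normal_norm p) (hi.normal_orthogonal p) ?_
    fun v => ?_
  · rw [hi.inner_differential_normal, inner_smul_left, hNν, mul_zero]
  · obtain ⟨r, w, hw, rfl⟩ := hi.exists_conormal_decomposition p v
    have e2 := hi.inner_conormal p w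
    rw [hw, neg_zero, zero_div] at e2
    have e3 : differential m x p (conormalTangent x p) = conormal x p := rfl
    have e4 : ⟪differential m N p (conormalTangent x p), differential m x p w⟫ = 0 := by
      rw [hi.secondForm_symm, e3, key w hw]
    rw [map_add, map_smul, inner_add_right, inner_add_right, e4, inner_smul_right,
      inner_smul_right, e3, inner_smul_left, inner_smul_left, e2, hi.inner_conormal_self,
      secondForm, e3]
    simp

omit [IsManifold (𝓡∂ (m + 1)) ∞ M] in
theorem differential_testFunction (h : IsImmersedInBall x N) (p : M)
    (a : EuclideanSpace ℝ (Fin (m + 2))) (v : EuclideanSpace ℝ (Fin (m + 1))) :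
    differential m (testFunction x N a) p v =
      ⟪a, differential m x p v⟫ * ⟪x p, N p⟫ + ⟪a, x p⟫ * ⟪x p, differential m N p v⟫ -
      ⟪x p, differential m x p v⟫ * ⟪a, N p⟫ -
      (1 / 2) * (⟪x p, x p⟫ + 1) * ⟪a, differential m N p v⟫ := by
  have dX := hasFDerivWithinAt_chartRep (h.smooth.mdifferentiable (by simp) p)
  have dN := hasFDerivWithinAt_chartRep (h.normal_smooth.mdifferentiable (by simp) p)
  have da := hasFDerivWithinAt_const (𝕜 := ℝ) a (extChartAt (𝓡∂ (m + 1)) p p) (range (𝓡∂ (m + 1)))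
  have hd := ((da.inner ℝ dX).fun_mul (dX.inner ℝ dN)).fun_add
    ((((dX.inner ℝ dX).const_mul (-(1 / 2) : ℝ)).add_const (-(1 / 2) : ℝ)).fun_mul (da.inner ℝ dN))
  have h1 := differential_eq_of_hasFDerivWithinAt (f := testFunction x N a)
    (contMDiff_testFunction h.smooth h.normal_smooth a).continuous.continuousAt hd
  rw [h1]
  simp only [ContinuousLinearMap.comp_apply, ContinuousLinearMap.prod_apply, fderivInnerCLM_apply,
    chartRep, Function.comp_apply, extChartAt_to_inv, add_apply, smul_apply, smul_eq_mul,
    zero_apply, inner_zero_left, add_zero]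
  rw [real_inner_comm (N p) (differential m x p v), h.normal_orthogonal,
    real_inner_comm (x p) (differential m x p v)]
  ring

/-- The test functions satisfy the linearized contact angle condition. -/
theorem testFunction_boundary (h : IsCapillary x N θ) (hp : p ∈ (𝓡∂ (m + 1)).boundary M)
    (a : EuclideanSpace ℝ (Fin (m + 2))) :
    differential m (testFunction x N a) p (conormalTangent x p) -
      (1 / Real.sin θ + Real.cot θ *
        secondForm x N p (conormalTangent x p) (conormalTangent x p)) *
          testFunction x N a p = 0 := by
  have hi := h.toIsImmersedInBall
  have hsin : Real.sin θ ≠ 0 := (Real.sin_pos_of_mem_Ioo h.angle_mem).ne'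
  obtain ⟨h1, h2⟩ := h.contact hp
  have e3 : differential m x p (conormalTangent x p) = conormal x p := rfl
  have hax : ⟪a, x p⟫ = Real.cos θ * ⟪a, N p⟫ + Real.sin θ * ⟪a, conormal x p⟫ := by
    rw [← h1, ← h2, ← inner_smul_right, ← inner_smul_right, ← inner_add_right,
      ← hi.position_boundary hp]
  -- With A = ⟨a, N⟩ and B = ⟨a, ν⟩, the test function equals sin θ (cos θ B - sin θ A), and its
  -- conormal derivative is (1 + cos θ σ(ν, ν))(cos θ B - sin θ A). Their ratio is q; to avoid
  -- dividing by the value of the function, the difference is expanded.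
  rw [differential_testFunction hi, h.differential_normal_conormal hp, e3, testFunction, h1,
    inner_smul_right, inner_smul_right, h2, hi.inner_self_boundary hp, hax,
    Real.cot_eq_cos_div_sin]
  have h4 := Real.sin_sq_add_cos_sq θ
  have h5 : Real.cos θ ^ 2 = 1 - Real.sin θ ^ 2 := by linarith
  field_simp
  ring_nf
  have h6 : Real.cos θ ^ 3 = Real.cos θ * (1 - Real.sin θ ^ 2) := by rw [← h5]; ring
  rw [h6, h5]
  ring

end IsCapillary

end Boundary

/-! ### The area measures: gluing of charts, finiteness, null sets. -/

section Area

variable {m : ℕ} {M : Type*} [TopologicalSpace M] [ChartedSpace (EuclideanHalfSpace (m + 1)) M]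
  {x : M → EuclideanSpace ℝ (Fin (m + 2))}

/-- The density of the area in the chart at `p`. -/
def chartDensity (x : M → EuclideanSpace ℝ (Fin (m + 2))) (p : M)
    (u : EuclideanSpace ℝ (Fin (m + 1))) : ℝ :=
  Real.sqrt (gramMatrix (fderivWithin ℝ (chartRep p x) (range (𝓡∂ (m + 1))) u)).det

theorem measurableSet_extChartAt_target (p : M) :
    MeasurableSet (extChartAt (𝓡∂ (m + 1)) p).target := by
  rw [extChartAt_target]
  exact ((chartAt (EuclideanHalfSpace (m + 1)) p).open_target.preimage
    (𝓡∂ (m + 1)).continuous_symm).measurableSet.inter (𝓡∂ (m + 1)).isClosed_range.measurableSet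

variable [MeasurableSpace M] [BorelSpace M]

theorem measurableSet_symm_preimage (p : M) {A : Set M} (hA : MeasurableSet A) :
    MeasurableSet ((extChartAt (𝓡∂ (m + 1)) p).symm ⁻¹' A ∩ (extChartAt (𝓡∂ (m + 1)) p).target) := by
  have h1 : Measurable ((extChartAt (𝓡∂ (m + 1)) p).target.domRestrict
      (extChartAt (𝓡∂ (m + 1)) p).symm) :=
    (continuousOn_iff_continuous_domRestrict.1 (continuousOn_extChartAt_symm p)).measurable
  have h2 := (measurableSet_extChartAt_target p).subtype_image (h1 hA)
  convert h2 using 1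
  ext u
  simp only [mem_inter_iff, mem_preimage, mem_image, Subtype.exists]
  constructor
  · rintro ⟨h, h'⟩; exact ⟨u, h', h, rfl⟩
  · rintro ⟨u, h', h, rfl⟩; exact ⟨h, h'⟩

theorem aemeasurable_symm (p : M) : AEMeasurable (extChartAt (𝓡∂ (m + 1)) p).symm
    (volume.restrict (extChartAt (𝓡∂ (m + 1)) p).target) :=
  (continuousOn_extChartAt_symm p).aemeasurable (measurableSet_extChartAt_target p)

theorem chartArea_apply (x : M → EuclideanSpace ℝ (Fin (m + 2))) (p : M) {A : Set M}
    (hA : MeasurableSet A) : chartArea x p A =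
      ∫⁻ u in (extChartAt (𝓡∂ (m + 1)) p).symm ⁻¹' A ∩ (extChartAt (𝓡∂ (m + 1)) p).target,
        ENNReal.ofReal (chartDensity x p u) := by
  rw [chartArea, Measure.map_apply_of_aemeasurable
    ((aemeasurable_symm p).mono_ac (withDensity_absolutelyContinuous _ _)) hA,
    withDensity_apply', Measure.restrict_restrict' (measurableSet_extChartAt_target p)]
  rfl

theorem measurableSet_source (p : M) : MeasurableSet (extChartAt (𝓡∂ (m + 1)) p).source :=
  (isOpen_extChartAt_source p).measurableSet

theorem chartArea_inter_source (x : M → EuclideanSpace ℝ (Fin (m + 2))) (p : M) {A : Set M}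
    (hA : MeasurableSet A) :
    chartArea x p (A ∩ (extChartAt (𝓡∂ (m + 1)) p).source) = chartArea x p A := by
  rw [chartArea_apply x p hA, chartArea_apply x p (hA.inter (measurableSet_source p))]
  congr 2
  ext u
  simp only [mem_inter_iff, mem_preimage]
  constructor
  · rintro ⟨⟨h1, _⟩, h2⟩; exact ⟨h1, h2⟩
  · rintro ⟨h1, h2⟩; exact ⟨⟨h1, (extChartAt (𝓡∂ (m + 1)) p).map_target h2⟩, h2⟩

variable [IsManifold (𝓡∂ (m + 1)) ∞ M]

omit [MeasurableSpace M] [BorelSpace M] in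
/-- The change of variables between two charts. -/
theorem chartDensity_eq (hx : ContMDiff (𝓡∂ (m + 1)) 𝓘(ℝ, EuclideanSpace ℝ (Fin (m + 2))) ∞ x)
    {p q : M} {u : EuclideanSpace ℝ (Fin (m + 1))} (hu : u ∈ (extChartAt (𝓡∂ (m + 1)) p).target)
    (hq : (extChartAt (𝓡∂ (m + 1)) p).symm u ∈ (extChartAt (𝓡∂ (m + 1)) q).source) :
    chartDensity x p u =
      |(fderivWithin ℝ (chartRep p (extChartAt (𝓡∂ (m + 1)) q)) (range (𝓡∂ (m + 1))) u).det| *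
        chartDensity x q (extChartAt (𝓡∂ (m + 1)) q ((extChartAt (𝓡∂ (m + 1)) p).symm u)) := by
  set z := (extChartAt (𝓡∂ (m + 1)) p).symm u with hz
  have hzt : extChartAt (𝓡∂ (m + 1)) q z ∈ (extChartAt (𝓡∂ (m + 1)) q).target :=
    (extChartAt (𝓡∂ (m + 1)) q).map_source hq
  have hzz : (extChartAt (𝓡∂ (m + 1)) q).symm (extChartAt (𝓡∂ (m + 1)) q z) = z :=
    (extChartAt (𝓡∂ (m + 1)) q).left_inv hq
  have hφ : MDifferentiableAt (𝓡∂ (m + 1)) 𝓘(ℝ, EuclideanSpace ℝ (Fin (m + 1)))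
      (extChartAt (𝓡∂ (m + 1)) q) z :=
    mdifferentiableAt_extChartAt (by rwa [extChartAt_source] at hq)
  have h1 := fderivWithin_chartRep hu (f := extChartAt (𝓡∂ (m + 1)) q) hφ
  have h2 := fderivWithin_chartRep hu (hx.mdifferentiable (by simp) z)
  have h3 := fderivWithin_chartRep hzt (f := x) (hx.mdifferentiable (by simp) _)
  rw [hzz] at h3
  have h4 : chartFrame q (extChartAt (𝓡∂ (m + 1)) q z) ∘L
      differential m (extChartAt (𝓡∂ (m + 1)) q) z = ContinuousLinearMap.id ℝ _ :=
    mfderivWithin_extChartAt_symm_comp_mfderiv_extChartAt' hq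
  have h5 : fderivWithin ℝ (chartRep p x) (range (𝓡∂ (m + 1))) u =
      fderivWithin ℝ (chartRep q x) (range (𝓡∂ (m + 1))) (extChartAt (𝓡∂ (m + 1)) q z) ∘L
        fderivWithin ℝ (chartRep p (extChartAt (𝓡∂ (m + 1)) q)) (range (𝓡∂ (m + 1))) u := by
    rw [h1, h2, h3, ContinuousLinearMap.comp_assoc, ← hz,
      ← ContinuousLinearMap.comp_assoc (chartFrame q _), h4, ContinuousLinearMap.id_comp]
  rw [chartDensity, h5, gramMatrix_comp_det, Real.sqrt_mul (sq_nonneg _), Real.sqrt_sq_eq_abs]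
  rfl

/-- The change of variables formula for the transition map `τ`, whose Jacobian is the quotient of
the densities by `chartDensity_eq`. -/
theorem chartArea_eq_of_subset
    (hx : ContMDiff (𝓡∂ (m + 1)) 𝓘(ℝ, EuclideanSpace ℝ (Fin (m + 2))) ∞ x) (p q : M) {A : Set M}
    (hA : MeasurableSet A) (hp : A ⊆ (extChartAt (𝓡∂ (m + 1)) p).source)
    (hq : A ⊆ (extChartAt (𝓡∂ (m + 1)) q).source) : chartArea x p A = chartArea x q A := by
  rw [chartArea_apply x p hA, chartArea_apply x q hA]
  set S := (extChartAt (𝓡∂ (m + 1)) p).symm ⁻¹' A ∩ (extChartAt (𝓡∂ (m + 1)) p).target with hS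
  set τ := chartRep (m := m) p (extChartAt (𝓡∂ (m + 1)) q) with hτ
  have himg : (extChartAt (𝓡∂ (m + 1)) q).symm ⁻¹' A ∩ (extChartAt (𝓡∂ (m + 1)) q).target =
      τ '' S := by
    ext w
    constructor
    · rintro ⟨h1, h2⟩
      refine ⟨extChartAt (𝓡∂ (m + 1)) p ((extChartAt (𝓡∂ (m + 1)) q).symm w), ⟨?_, ?_⟩, ?_⟩
      · rw [mem_preimage, (extChartAt (𝓡∂ (m + 1)) p).left_inv (hp h1)]; exact h1
      · exact (extChartAt (𝓡∂ (m + 1)) p).map_source (hp h1)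
      · simp only [hτ, chartRep, Function.comp_apply]
        rw [(extChartAt (𝓡∂ (m + 1)) p).left_inv (hp h1),
          (extChartAt (𝓡∂ (m + 1)) q).right_inv h2]
    · rintro ⟨u, ⟨h1, h2⟩, rfl⟩
      refine ⟨?_, (extChartAt (𝓡∂ (m + 1)) q).map_source (hq h1)⟩
      simp only [hτ, chartRep, Function.comp_apply, mem_preimage]
      rw [(extChartAt (𝓡∂ (m + 1)) q).left_inv (hq h1)]
      exact h1
  have hinj : InjOn τ S := by
    rintro u ⟨h1, h2⟩ v ⟨h3, h4⟩ huv
    exact (extChartAt (𝓡∂ (m + 1)) p).symm.injOn h2 h4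
      ((extChartAt (𝓡∂ (m + 1)) q).injOn (hq h1) (hq h3) huv)
  have hder : ∀ u ∈ S, HasFDerivWithinAt τ (fderivWithin ℝ τ (range (𝓡∂ (m + 1))) u) S u := by
    rintro u ⟨h1, h2⟩
    have h3 := contDiffWithinAt_ext_coord_change (I := 𝓡∂ (m + 1)) (n := ∞) q p (y := u) (by
      rw [PartialEquiv.trans_source]
      exact ⟨h2, hq h1⟩)
    exact (h3.differentiableWithinAt (by simp)).hasFDerivWithinAt.mono
      (inter_subset_right.trans (extChartAt_target_subset_range p))
  rw [himg, lintegral_image_eq_lintegral_abs_det_fderiv_mul volume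
    (measurableSet_symm_preimage p hA) hder hinj]
  refine setLIntegral_congr_fun (measurableSet_symm_preimage p hA) fun u hu => ?_
  rw [chartDensity_eq hx hu.2 (hq hu.1), ENNReal.ofReal_mul (abs_nonneg _)]
  rfl

variable [CompactSpace M] [Nonempty M]

/-- On the domain of a chart, the area is the area of that chart. -/
theorem area_eq_chartArea
    (hx : ContMDiff (𝓡∂ (m + 1)) 𝓘(ℝ, EuclideanSpace ℝ (Fin (m + 2))) ∞ x) (q : M) {A : Set M}
    (hA : MeasurableSet A) (hq : A ⊆ (extChartAt (𝓡∂ (m + 1)) q).source) :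
    area x A = chartArea x q A := by
  obtain ⟨t, ht⟩ := isCompact_univ.elim_finite_subcover
    (fun p : M => (extChartAt (𝓡∂ (m + 1)) p).source) (fun p => isOpen_extChartAt_source p)
    (fun p _ => mem_iUnion.2 ⟨p, mem_extChartAt_source p⟩)
  have htn : (t : Set M).Nonempty := by
    obtain ⟨p⟩ := ‹Nonempty M›
    obtain ⟨r, hr, -⟩ := mem_iUnion₂.1 (ht (mem_univ p))
    exact ⟨r, hr⟩
  obtain ⟨f, hf⟩ := t.countable_toSet.exists_eq_range htn
  set D : ℕ → Set M := disjointed fun k => (extChartAt (𝓡∂ (m + 1)) (f k)).source with hD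
  have hDm : ∀ k, MeasurableSet (D k) := fun k =>
    MeasurableSet.disjointed (fun k => measurableSet_source (f k)) k
  have hDs : ∀ k, D k ⊆ (extChartAt (𝓡∂ (m + 1)) (f k)).source := fun k => disjointed_subset _ k
  have hDd : Pairwise (Function.onFun Disjoint D) := disjoint_disjointed _
  have hDu : ⋃ k, D k = univ := by
    rw [hD, iUnion_disjointed, eq_univ_iff_forall]
    intro p
    obtain ⟨r, hr, hpr⟩ := mem_iUnion₂.1 (ht (mem_univ p))
    have : r ∈ range f := hf ▸ hr
    obtain ⟨k, rfl⟩ := this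
    exact mem_iUnion.2 ⟨k, hpr⟩
  have hsum : ∀ (μ : Measure M) {B : Set M}, MeasurableSet B → μ B = ∑' k, μ (B ∩ D k) := by
    intro μ B hB
    rw [← measure_iUnion (fun i j hij => ((hDd hij).mono inter_subset_right inter_subset_right))
      (fun k => hB.inter (hDm k)), ← inter_iUnion, hDu, inter_univ]
  -- The value of a supremum of measures on a set is not directly accessible. The measure `μ`, glued
  -- from finitely many charts along disjoint pieces `D k`, bounds every chart measure because these
  -- agree on overlaps; hence it bounds `area x`. On subsets of one chart domain, `μ` is the measure
  -- of that chart.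
  set μ : Measure M := Measure.sum fun k => (chartArea x (f k)).restrict (D k) with hμ
  have hμa : ∀ {B : Set M}, MeasurableSet B → μ B = ∑' k, chartArea x (f k) (B ∩ D k) := by
    intro B hB
    rw [hμ, Measure.sum_apply _ hB]
    simp_rw [Measure.restrict_apply hB]
  have hle : area x ≤ μ := by
    refine iSup_le fun q => Measure.le_iff.2 fun B hB => ?_
    rw [hsum _ hB, hμa hB]
    refine ENNReal.tsum_le_tsum fun k => ?_
    rw [← chartArea_inter_source x q (hB.inter (hDm k)),
      chartArea_eq_of_subset hx q (f k) ((hB.inter (hDm k)).inter (measurableSet_source q))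
        inter_subset_right (inter_subset_left.trans (inter_subset_right.trans (hDs k)))]
    exact measure_mono inter_subset_left
  refine le_antisymm ?_ (le_iSup (fun p => chartArea x p) q A)
  refine (hle A).trans ?_
  rw [hμa hA, hsum (chartArea x q) hA]
  refine ENNReal.tsum_le_tsum fun k => le_of_eq ?_
  exact chartArea_eq_of_subset hx (f k) q (hA.inter (hDm k)) (inter_subset_right.trans (hDs k))
    (inter_subset_left.trans hq)

theorem area_restrict_source
    (hx : ContMDiff (𝓡∂ (m + 1)) 𝓘(ℝ, EuclideanSpace ℝ (Fin (m + 2))) ∞ x) (p : M) :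
    (area x).restrict (extChartAt (𝓡∂ (m + 1)) p).source = chartArea x p := by
  ext A hA
  rw [Measure.restrict_apply hA, area_eq_chartArea hx p (hA.inter (measurableSet_source p))
    inter_subset_right, chartArea_inter_source x p hA]

omit [MeasurableSpace M] [BorelSpace M] [CompactSpace M] [Nonempty M] in
theorem continuousOn_chartDensity
    (hx : ContMDiff (𝓡∂ (m + 1)) 𝓘(ℝ, EuclideanSpace ℝ (Fin (m + 2))) ∞ x) (p : M) :
    ContinuousOn (chartDensity x p) (extChartAt (𝓡∂ (m + 1)) p).target := by
  set T := (extChartAt (𝓡∂ (m + 1)) p).target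
  have h1 : ContinuousOn (fderivWithin ℝ (chartRep p x) T) T :=
    (contDiffOn_chartRep hx p).continuousOn_fderivWithin (uniqueDiffOn_extChartAt_target p)
      (by simp)
  have h2 : ContinuousOn (fderivWithin ℝ (chartRep p x) (range (𝓡∂ (m + 1)))) T :=
    h1.congr fun u hu => (fderivWithin_congr_set (extChartAt_target_eventuallyEq_of_mem hu)).symm
  have h3 : Continuous fun L : EuclideanSpace ℝ (Fin (m + 1)) →L[ℝ]
      EuclideanSpace ℝ (Fin (m + 2)) => Real.sqrt (gramMatrix L).det := by
    refine Real.continuous_sqrt.comp (Continuous.matrix_det ?_)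
    refine continuous_matrix fun i j => ?_
    simp only [gramMatrix, Matrix.of_apply]
    exact Continuous.inner (by fun_prop) (by fun_prop)
  exact h3.comp_continuousOn h2

theorem isFiniteMeasure_area
    (hx : ContMDiff (𝓡∂ (m + 1)) 𝓘(ℝ, EuclideanSpace ℝ (Fin (m + 2))) ∞ x) :
    IsFiniteMeasure (area x) := by
  have hloc : IsLocallyFiniteMeasure (area x) := by
    refine ⟨fun p => ?_⟩
    set T := (extChartAt (𝓡∂ (m + 1)) p).target with hT
    set u₀ := extChartAt (𝓡∂ (m + 1)) p p with hu₀
    have hc : ContinuousWithinAt (chartDensity x p) T u₀ :=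
      continuousOn_chartDensity hx p u₀ (mem_extChartAt_target p)
    have h1 : ∀ᶠ u in nhdsWithin u₀ T, chartDensity x p u < chartDensity x p u₀ + 1 :=
      hc.eventually (gt_mem_nhds (by linarith))
    obtain ⟨r, hr, hball⟩ := Metric.mem_nhdsWithin_iff.1 h1
    set V := (extChartAt (𝓡∂ (m + 1)) p).source ∩
      extChartAt (𝓡∂ (m + 1)) p ⁻¹' Metric.ball u₀ r with hV
    have hVo : IsOpen V := isOpen_extChartAt_preimage' p Metric.isOpen_ball
    refine ⟨V, hVo.mem_nhds ⟨mem_extChartAt_source p, Metric.mem_ball_self hr⟩, ?_⟩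
    rw [area_eq_chartArea hx p hVo.measurableSet inter_subset_left,
      chartArea_apply x p hVo.measurableSet]
    have hsub : ∀ u ∈ (extChartAt (𝓡∂ (m + 1)) p).symm ⁻¹' V ∩ T, u ∈ Metric.ball u₀ r ∩ T := by
      rintro u ⟨h2, h3⟩
      have := h2.2
      rw [mem_preimage, (extChartAt (𝓡∂ (m + 1)) p).right_inv h3] at this
      exact ⟨this, h3⟩
    refine lt_of_le_of_lt (setLIntegral_mono measurable_const fun u hu =>
      ENNReal.ofReal_le_ofReal (hball (hsub u hu)).le) ?_
    rw [setLIntegral_const]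
    refine ENNReal.mul_lt_top ENNReal.ofReal_lt_top ?_
    exact lt_of_le_of_lt (measure_mono fun u hu => (hsub u hu).1) measure_ball_lt_top
  infer_instance

/-- In each chart the boundary lies in the Lebesgue null hyperplane u₀ = 0. `M` is second countable,
being compact, so a locally null set is null. -/
theorem area_boundary [T2Space M]
    (hx : ContMDiff (𝓡∂ (m + 1)) 𝓘(ℝ, EuclideanSpace ℝ (Fin (m + 2))) ∞ x) :
    area x ((𝓡∂ (m + 1)).boundary M) = 0 := by
  have : SecondCountableTopology (EuclideanHalfSpace (m + 1)) :=
    (𝓡∂ (m + 1)).secondCountableTopology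
  have : SecondCountableTopology M :=
    ChartedSpace.secondCountable_of_sigmaCompact (EuclideanHalfSpace (m + 1)) M
  have hbm : MeasurableSet ((𝓡∂ (m + 1)).boundary M) :=
    ((𝓡∂ (m + 1)).isClosed_boundary (n := ∞) (by simp)).measurableSet
  refine measure_null_of_locally_null _ fun p hp =>
    ⟨(𝓡∂ (m + 1)).boundary M ∩ (extChartAt (𝓡∂ (m + 1)) p).source,
      inter_mem_nhdsWithin _ (extChartAt_source_mem_nhds p), ?_⟩
  rw [area_eq_chartArea hx p (hbm.inter (measurableSet_source p)) inter_subset_right,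
    chartArea_apply x p (hbm.inter (measurableSet_source p))]
  refine setLIntegral_measure_zero _ _ ?_
  refine measure_mono_null (t := (LinearMap.ker (EuclideanSpace.proj (𝕜 := ℝ) (0 : Fin (m + 1)) :
    EuclideanSpace ℝ (Fin (m + 1)) →ₗ[ℝ] ℝ) : Set (EuclideanSpace ℝ (Fin (m + 1))))) ?_ ?_
  · rintro u ⟨h1, h2⟩
    have h3 : ¬ 0 < u 0 := fun h => by
      have h4 := (symm_mem_interior_iff h2).2 (mem_chartInterior_iff.2 ⟨h2, h⟩)
      rw [← (𝓡∂ (m + 1)).compl_boundary] at h4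
      exact h4 h1.1
    have h4 : 0 ≤ u 0 := mem_range_halfSpace.1 (extChartAt_target_subset_range p h2)
    exact le_antisymm (not_lt.1 h3) h4
  · refine Measure.addHaar_submodule _ _ fun h => ?_
    have h1 : EuclideanSpace.single (0 : Fin (m + 1)) (1 : ℝ) ∈ LinearMap.ker
      (EuclideanSpace.proj (𝕜 := ℝ) (0 : Fin (m + 1)) :
        EuclideanSpace ℝ (Fin (m + 1)) →ₗ[ℝ] ℝ) := by rw [h]; trivial
    have h2 : (EuclideanSpace.single (0 : Fin (m + 1)) (1 : ℝ)) 0 = 0 := h1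
    simp at h2

omit [MeasurableSpace M] [BorelSpace M] [IsManifold (𝓡∂ (m + 1)) ∞ M] [CompactSpace M]
  [Nonempty M] in
theorem chartDensity_eq_areaDensity {p : M} {u : EuclideanSpace ℝ (Fin (m + 1))}
    (hu : u ∈ chartInterior p) : chartDensity x p u = areaDensity (chartRep p x) u := by
  rw [chartDensity, fderivWithin_range_eq hu]; rfl

omit [CompactSpace M] [Nonempty M] in
-- The density is positive on the interior of each chart target, and every nonempty open set of `M`
-- meets the image of such an interior.
theorem isOpenPosMeasure_area
    (hx : ContMDiff (𝓡∂ (m + 1)) 𝓘(ℝ, EuclideanSpace ℝ (Fin (m + 2))) ∞ x)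
    (hi : ∀ p, Function.Injective (differential m x p)) :
    (area x).IsOpenPosMeasure := by
  refine ⟨fun V hV ⟨q, hq⟩ h0 => ?_⟩
  set T := (extChartAt (𝓡∂ (m + 1)) q).target
  have h1 : chartArea x q V = 0 :=
    le_antisymm ((le_iSup (fun p => chartArea x p) q V).trans h0.le) zero_le
  rw [chartArea_apply x q hV.measurableSet] at h1
  set O := chartInterior q ∩ (extChartAt (𝓡∂ (m + 1)) q).symm ⁻¹' V with hO
  have hOo : IsOpen O := ((continuousOn_extChartAt_symm q).mono
    (chartInterior_subset q)).isOpen_inter_preimage (isOpen_chartInterior q) hV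
  have hOn : O.Nonempty := by
    have hcl : extChartAt (𝓡∂ (m + 1)) q q ∈ closure (chartInterior q) :=
      extChartAt_target_subset_closure_interior (mem_extChartAt_target q)
    have hne := mem_closure_iff_nhdsWithin_neBot.1 hcl
    have hc : ContinuousWithinAt (extChartAt (𝓡∂ (m + 1)) q).symm (chartInterior q)
        (extChartAt (𝓡∂ (m + 1)) q q) :=
      (continuousOn_extChartAt_symm q _ (mem_extChartAt_target q)).mono (chartInterior_subset q)
    have hm := hc.preimage_mem_nhdsWithin (t := V)
      (hV.mem_nhds (by rw [extChartAt_to_inv]; exact hq))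
    obtain ⟨u, h⟩ := hne.nonempty_of_mem (Filter.inter_mem self_mem_nhdsWithin hm)
    exact ⟨u, h⟩
  have h2 : ∫⁻ u in O, ENNReal.ofReal (chartDensity x q u) = 0 :=
    le_antisymm ((lintegral_mono_set (fun u (hu : u ∈ O) =>
      (⟨hu.2, chartInterior_subset q hu.1⟩ :
        u ∈ (extChartAt (𝓡∂ (m + 1)) q).symm ⁻¹' V ∩ T))).trans h1.le) zero_le
  have hae : AEMeasurable (fun u => ENNReal.ofReal (chartDensity x q u)) (volume.restrict O) :=
    (((continuousOn_chartDensity hx q).mono (inter_subset_left.trans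
      (chartInterior_subset q))).aemeasurable hOo.measurableSet).ennreal_ofReal
  rw [lintegral_eq_zero_iff' hae] at h2
  have h3 : ∀ᵐ u ∂(volume.restrict O), False := by
    filter_upwards [h2, ae_restrict_mem hOo.measurableSet] with u hu1 hu2
    have hpos := areaDensity_pos (injective_fderiv_chartRep hx hi hu2.1)
    rw [← chartDensity_eq_areaDensity hu2.1] at hpos
    simp only [Pi.zero_apply, ENNReal.ofReal_eq_zero] at hu1
    linarith
  rw [Filter.eventually_false_iff_eq_bot, ae_eq_bot, Measure.restrict_eq_zero] at h3
  exact (hOo.measure_pos volume hOn).ne' h3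

/-- Integration in a chart. -/
theorem integral_area_eq_chart
    (hx : ContMDiff (𝓡∂ (m + 1)) 𝓘(ℝ, EuclideanSpace ℝ (Fin (m + 2))) ∞ x) (p : M) {f : M → ℝ}
    (hf : Continuous f) (hsupp : ∀ q ∉ (extChartAt (𝓡∂ (m + 1)) p).source, f q = 0) :
    ∫ q, f q ∂(area x) = ∫ u in (extChartAt (𝓡∂ (m + 1)) p).target,
      chartDensity x p u * f ((extChartAt (𝓡∂ (m + 1)) p).symm u) := by
  have hae : AEMeasurable (fun u => ENNReal.ofReal (chartDensity x p u))
      (volume.restrict (extChartAt (𝓡∂ (m + 1)) p).target) :=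
    ((continuousOn_chartDensity hx p).aemeasurable
      (measurableSet_extChartAt_target p)).ennreal_ofReal
  rw [← setIntegral_eq_integral_of_forall_compl_eq_zero (fun q hq => hsupp q hq),
    area_restrict_source hx]
  have hmap : chartArea x p = Measure.map (extChartAt (𝓡∂ (m + 1)) p).symm
      ((volume.restrict (extChartAt (𝓡∂ (m + 1)) p).target).withDensity fun u =>
        ENNReal.ofReal (chartDensity x p u)) := rfl
  rw [hmap, integral_map ((aemeasurable_symm p).mono_ac (withDensity_absolutelyContinuous _ _))
    hf.aestronglyMeasurable, integral_withDensity_eq_integral_toReal_smul₀ hae (by simp)]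
  refine integral_congr_ae (Filter.Eventually.of_forall fun u => ?_)
  simp only [smul_eq_mul]
  rw [ENNReal.toReal_ofReal (show 0 ≤ chartDensity x p u from Real.sqrt_nonneg _)]

omit [CompactSpace M] [Nonempty M] in
-- The boundary integrand of the second variation vanishes on ∂M for the test functions, so it
-- suffices to know where the boundary measure is carried.
theorem ae_boundaryArea_mem_boundary (x : M → EuclideanSpace ℝ (Fin (m + 2))) :
    ∀ᵐ p ∂(boundaryArea x), p ∈ (𝓡∂ (m + 1)).boundary M := by
  have hbm : MeasurableSet ((𝓡∂ (m + 1)).boundary M) :=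
    ((𝓡∂ (m + 1)).isClosed_boundary (n := ∞) (by simp)).measurableSet
  have hp : ∀ p, chartBoundaryArea x p ((𝓡∂ (m + 1)).boundary M)ᶜ = 0 := by
    intro p
    set T := (extChartAt (𝓡∂ (m + 1)) p).target with hT
    have hTm : MeasurableSet (boundaryInclusion (m := m) ⁻¹' T) := by
      have : Continuous (boundaryInclusion (m := m)) := by
        refine (PiLp.continuous_toLp 2 _).comp (continuous_pi fun i => ?_)
        refine Fin.cases ?_ (fun i => ?_) i
        · simpa using continuous_const
        · simp only [Fin.cons_succ]; fun_prop
      exact this.measurable (measurableSet_extChartAt_target p)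
    -- If the parametrization were not almost everywhere measurable, its push-forward would be the
    -- zero measure by convention.
    by_cases ha : AEMeasurable (fun u => (extChartAt (𝓡∂ (m + 1)) p).symm (boundaryInclusion u))
      ((volume.restrict (boundaryInclusion ⁻¹' T)).withDensity
        fun u => ENNReal.ofReal (Real.sqrt (Matrix.of fun i j : Fin m =>
          ⟪chartPartial x p (boundaryInclusion u) i.succ,
            chartPartial x p (boundaryInclusion u) j.succ⟫).det))
    · rw [chartBoundaryArea, Measure.map_apply_of_aemeasurable ha hbm.compl]
      refine withDensity_absolutelyContinuous _ _ ?_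
      rw [Measure.restrict_apply' hTm]
      convert measure_empty (μ := (volume : Measure (EuclideanSpace ℝ (Fin m))))
      rw [eq_empty_iff_forall_notMem]
      rintro u ⟨h1, h2⟩
      rw [mem_preimage, (𝓡∂ (m + 1)).compl_boundary, symm_mem_interior_iff h2,
        mem_chartInterior_iff] at h1
      exact absurd h1.2 (by simp [boundaryInclusion])
    · rw [chartBoundaryArea, Measure.map_of_not_aemeasurable ha]
      simp
  -- Every chart measure equals its own restriction to the boundary, hence lies below the restricted
  -- supremum; so does the supremum.
  have hle : boundaryArea x ≤ (boundaryArea x).restrict ((𝓡∂ (m + 1)).boundary M) := by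
    refine iSup_le fun p => ?_
    have h1 : (chartBoundaryArea x p).restrict ((𝓡∂ (m + 1)).boundary M) = chartBoundaryArea x p :=
      Measure.restrict_eq_self_of_ae_mem (by rw [ae_iff]; exact hp p)
    rw [← h1]
    exact Measure.restrict_mono le_rfl (le_iSup (fun p => chartBoundaryArea x p) p)
  have h2 := hle ((𝓡∂ (m + 1)).boundary M)ᶜ
  rw [Measure.restrict_apply hbm.compl, compl_inter_self, measure_empty] at h2
  rw [ae_iff]
  exact le_antisymm h2 zero_le

end Area

/-! ### Green's formula for functions supported away from the boundary. -/

section Green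

/-- The integral of a partial derivative of a function with compact support vanishes. -/
theorem integral_fderiv_eq_zero {E : Type*} [NormedAddCommGroup E] [InnerProductSpace ℝ E]
    [FiniteDimensional ℝ E] [MeasurableSpace E] [BorelSpace E] {f : E → ℝ}
    (hf : ContDiff ℝ 1 f) (hc : HasCompactSupport f) (v : E) : ∫ u, fderiv ℝ f u v = 0 := by
  have h1 : Continuous fun u => fderiv ℝ f u v := (hf.continuous_fderiv (by simp)).clm_apply
    continuous_const
  have h2 : HasCompactSupport fun u => fderiv ℝ f u v := hc.fderiv_apply ℝ v
  have h := integral_mul_fderiv_eq_neg_fderiv_mul_of_integrable (μ := (volume : Measure E))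
    (f := fun _ : E => (1 : ℝ)) (g := f) (v := v) (by simp)
    (by simpa using h1.integrable_of_hasCompactSupport h2)
    (by simpa using hf.continuous.integrable_of_hasCompactSupport hc)
    (fun _ _ => differentiableAt_const _) (fun u _ => hf.differentiable (by simp) u)
  simpa using h

variable {m : ℕ} {M : Type*} [TopologicalSpace M] [ChartedSpace (EuclideanHalfSpace (m + 1)) M]
  [IsManifold (𝓡∂ (m + 1)) ∞ M]
  {x : M → EuclideanSpace ℝ (Fin (m + 2))} {ψ h : M → ℝ}

/-- The divergence of `ψ ∇h`. -/
def divMulGradient (x : M → EuclideanSpace ℝ (Fin (m + 2))) (ψ h : M → ℝ) (q : M) : ℝ :=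
  ψ q * laplacian x h q + gradInner x ψ h q

omit [IsManifold (𝓡∂ (m + 1)) ∞ M] in
theorem divMulGradient_eq_zero {q : M} (hq : q ∉ tsupport ψ) : divMulGradient x ψ h q = 0 := by
  have h1 : ψ =ᶠ[nhds q] fun _ => 0 := notMem_tsupport_iff_eventuallyEq.1 hq
  have h2 : differential m ψ q = 0 := by
    have := h1.mfderiv_eq (I := 𝓡∂ (m + 1)) (I' := 𝓘(ℝ, ℝ))
    rw [differential, this]
    exact mfderiv_const
  rw [divMulGradient, gradInner, h2, h1.self_of_nhds]
  simp [gramTrace]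

theorem sum_fderiv_flux_chart
    (hx : ContMDiff (𝓡∂ (m + 1)) 𝓘(ℝ, EuclideanSpace ℝ (Fin (m + 2))) ∞ x)
    (hi : ∀ p, Function.Injective (differential m x p))
    (hψ : ContMDiff (𝓡∂ (m + 1)) 𝓘(ℝ, ℝ) ∞ ψ) (hh : ContMDiff (𝓡∂ (m + 1)) 𝓘(ℝ, ℝ) ∞ h)
    {p : M} {u : EuclideanSpace ℝ (Fin (m + 1))} (hu : u ∈ chartInterior p) :
    ∑ i, fderiv ℝ (fluxComponent (chartRep p x) (chartRep p ψ) (chartRep p h) i) u (coordVec i) =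
      areaDensity (chartRep p x) u *
        divMulGradient x ψ h ((extChartAt (𝓡∂ (m + 1)) p).symm u) := by
  rw [sum_fderiv_fluxComponent (isOpen_chartInterior p) (contDiffOn_chartRep_interior hx p)
    (fun u hu => injective_fderiv_chartRep hx hi hu) (contDiffOn_chartRep_interior hψ p)
    (contDiffOn_chartRep_interior hh p) hu, divMulGradient, laplacian_eq_chart hx hi hh hu,
    gradInner_eq_chart hx hψ hh hu]
  rfl

/-- Continuity is not visible from the definition, which uses a different chart at each point. Near
the support of `ψ`, which consists of interior points, the function is a quotient of continuous
expressions in one fixed chart; elsewhere it is zero. -/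
theorem continuous_divMulGradient
    (hx : ContMDiff (𝓡∂ (m + 1)) 𝓘(ℝ, EuclideanSpace ℝ (Fin (m + 2))) ∞ x)
    (hi : ∀ p, Function.Injective (differential m x p))
    (hψ : ContMDiff (𝓡∂ (m + 1)) 𝓘(ℝ, ℝ) ∞ ψ) (hh : ContMDiff (𝓡∂ (m + 1)) 𝓘(ℝ, ℝ) ∞ h)
    (hint : tsupport ψ ⊆ (𝓡∂ (m + 1)).interior M) : Continuous (divMulGradient x ψ h) := by
  refine continuous_of_tsupport fun q hq => ?_
  have hq1 : q ∈ tsupport ψ := by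
    refine closure_minimal ?_ (isClosed_tsupport ψ) hq
    intro z hz
    by_contra hz'
    exact hz (divMulGradient_eq_zero hz')
  have hu : extChartAt (𝓡∂ (m + 1)) q q ∈ chartInterior (m := m) q :=
    (mem_interior_iff_chart (mem_extChartAt_source q)).1 (hint hq1)
  set G : EuclideanSpace ℝ (Fin (m + 1)) → ℝ := fun u =>
    (∑ i, fderiv ℝ (fluxComponent (chartRep q x) (chartRep q ψ) (chartRep q h) i) u (coordVec i)) /
      areaDensity (chartRep q x) u with hG
  have hGc : ContinuousOn G (chartInterior (m := m) q) := by
    have hsm := contDiffOn_chartRep_interior hx q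
    have him : ∀ u ∈ chartInterior (m := m) q, Function.Injective (fderiv ℝ (chartRep q x) u) :=
      fun u hu => injective_fderiv_chartRep hx hi hu
    refine ContinuousOn.div (continuousOn_finsetSum _ fun i _ => ?_)
      (contDiffOn_areaDensity (isOpen_chartInterior q) hsm him).continuousOn
      fun u hu => (areaDensity_pos (him u hu)).ne'
    exact (contDiffOn_fderiv_apply (isOpen_chartInterior q)
      (contDiffOn_fluxComponent (isOpen_chartInterior q) hsm him
        (contDiffOn_chartRep_interior hψ q) (contDiffOn_chartRep_interior hh q) i) _).continuousOn
  have hGa : ContinuousAt (fun z => G (extChartAt (𝓡∂ (m + 1)) q z)) q :=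
    ContinuousAt.comp (f := extChartAt (𝓡∂ (m + 1)) q)
      (hGc.continuousAt ((isOpen_chartInterior q).mem_nhds hu)) (continuousAt_extChartAt q)
  refine hGa.congr ?_
  filter_upwards [(continuousAt_extChartAt q).preimage_mem_nhds
    ((isOpen_chartInterior q).mem_nhds hu), extChartAt_source_mem_nhds (I := 𝓡∂ (m + 1)) q] with z hz1 hz2
  have hz1' : extChartAt (𝓡∂ (m + 1)) q z ∈ chartInterior (m := m) q := hz1
  have him := injective_fderiv_chartRep hx hi hz1'
  rw [hG]
  simp only
  rw [sum_fderiv_flux_chart hx hi hψ hh hz1', (extChartAt (𝓡∂ (m + 1)) q).left_inv hz2,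
    mul_div_cancel_left₀ _ (areaDensity_pos him).ne']

variable [MeasurableSpace M] [BorelSpace M] [CompactSpace M] [Nonempty M]

theorem integral_divMulGradient_of_subset_source
    (hx : ContMDiff (𝓡∂ (m + 1)) 𝓘(ℝ, EuclideanSpace ℝ (Fin (m + 2))) ∞ x)
    (hi : ∀ p, Function.Injective (differential m x p))
    (hψ : ContMDiff (𝓡∂ (m + 1)) 𝓘(ℝ, ℝ) ∞ ψ) (hh : ContMDiff (𝓡∂ (m + 1)) 𝓘(ℝ, ℝ) ∞ h)
    (hint : tsupport ψ ⊆ (𝓡∂ (m + 1)).interior M) {p : M}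
    (hp : tsupport ψ ⊆ (extChartAt (𝓡∂ (m + 1)) p).source) :
    ∫ q, divMulGradient x ψ h q ∂(area x) = 0 := by
  set Φ := extChartAt (𝓡∂ (m + 1)) p with hΦ
  rw [integral_area_eq_chart hx p (continuous_divMulGradient hx hi hψ hh hint)
    fun q hq => divMulGradient_eq_zero fun hq' => hq (hp hq')]
  set K := Φ '' tsupport ψ with hK
  have hKc : IsCompact K :=
    (isClosed_tsupport ψ).isCompact.image_of_continuousOn ((continuousOn_extChartAt p).mono hp)
  have hKU : K ⊆ chartInterior (m := m) p := by
    rintro _ ⟨q, hq, rfl⟩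
    exact (mem_interior_iff_chart (hp hq)).1 (hint hq)
  have hKs : ∀ u ∈ Φ.target, u ∉ K → Φ.symm u ∉ tsupport ψ := fun u hu huK h' =>
    huK ⟨_, h', Φ.right_inv hu⟩
  have hsm := contDiffOn_chartRep_interior hx p
  have him : ∀ u ∈ chartInterior (m := m) p, Function.Injective (fderiv ℝ (chartRep p x) u) :=
    fun u hu => injective_fderiv_chartRep hx hi hu
  -- The flux components, extended by zero. They are supported in the compact set `K` inside the
  -- open chart interior, so the extension is continuously differentiable on the whole space and its
  -- partial derivatives have integral zero.
  set J : Fin (m + 1) → EuclideanSpace ℝ (Fin (m + 1)) → ℝ := fun i =>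
    (chartInterior (m := m) p).indicator
      (fluxComponent (chartRep p x) (chartRep p ψ) (chartRep p h) i) with hJ
  have hJ0 : ∀ i, ∀ u ∉ K, J i u = 0 := by
    intro i u huK
    by_cases hu : u ∈ chartInterior (m := m) p
    · have h0 : chartRep p ψ u = 0 :=
        image_eq_zero_of_notMem_tsupport (f := ψ)
          (hKs u (chartInterior_subset p hu) huK)
      simp [hJ, hu, fluxComponent, h0]
    · simp [hJ, hu]
  have hJU : ∀ i, ∀ u ∈ chartInterior (m := m) p, J i =ᶠ[nhds u]
      fluxComponent (chartRep p x) (chartRep p ψ) (chartRep p h) i := fun i u hu => by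
    filter_upwards [(isOpen_chartInterior p).mem_nhds hu] with z hz
    simp [hJ, hz]
  have hJz : ∀ i, ∀ u ∉ K, J i =ᶠ[nhds u] fun _ => 0 := fun i u hu => by
    filter_upwards [hKc.isClosed.isOpen_compl.mem_nhds hu] with z hz
    exact hJ0 i z hz
  have hJs : ∀ i, ContDiff ℝ 1 (J i) := fun i => contDiff_iff_contDiffAt.2 fun u => by
    by_cases hu : u ∈ K
    · refine ContDiffAt.congr_of_eventuallyEq ?_ (hJU i u (hKU hu))
      exact ((contDiffOn_fluxComponent (isOpen_chartInterior p) hsm him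
        (contDiffOn_chartRep_interior hψ p) (contDiffOn_chartRep_interior hh p) i).contDiffAt
          ((isOpen_chartInterior p).mem_nhds (hKU hu))).of_le (by simp)
    · exact contDiffAt_const.congr_of_eventuallyEq (hJz i u hu)
  have hJc : ∀ i, HasCompactSupport (J i) := fun i => HasCompactSupport.intro hKc (hJ0 i)
  have hint1 : ∀ i, Integrable fun u => fderiv ℝ (J i) u (coordVec i) := fun i =>
    (((hJs i).continuous_fderiv (by simp)).clm_apply
      continuous_const).integrable_of_hasCompactSupport ((hJc i).fderiv_apply ℝ _)
  have hsum : ∫ u, ∑ i, fderiv ℝ (J i) u (coordVec i) = 0 := by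
    rw [integral_finsetSum _ fun i _ => hint1 i]
    exact Finset.sum_eq_zero fun i _ => integral_fderiv_eq_zero (hJs i) (hJc i) _
  rw [← hsum, ← integral_indicator (measurableSet_extChartAt_target p)]
  refine integral_congr_ae (Filter.Eventually.of_forall fun u => ?_)
  by_cases huK : u ∈ K
  · have hu := hKU huK
    rw [indicator_of_mem (chartInterior_subset p hu), chartDensity_eq_areaDensity hu,
      ← sum_fderiv_flux_chart hx hi hψ hh hu]
    exact Finset.sum_congr rfl fun i _ => by rw [(hJU i u hu).fderiv_eq]
  · have h2 : ∑ i, fderiv ℝ (J i) u (coordVec i) = 0 :=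
      Finset.sum_eq_zero fun i _ => by rw [(hJz i u huK).fderiv_eq]; simp
    simp only [h2]
    by_cases hu : u ∈ Φ.target
    · rw [indicator_of_mem hu, divMulGradient_eq_zero (hKs u hu huK), mul_zero]
    · rw [indicator_of_notMem hu]

omit [IsManifold (𝓡∂ (m + 1)) ∞ M] [MeasurableSpace M] [BorelSpace M] [CompactSpace M]
  [Nonempty M] in
theorem divMulGradient_sum {ι : Type*} (s : Finset ι) {φ : ι → M → ℝ}
    (hφ : ∀ i, ContMDiff (𝓡∂ (m + 1)) 𝓘(ℝ, ℝ) ∞ (φ i)) (q : M) :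
    divMulGradient x (fun q => ∑ i ∈ s, φ i q) h q = ∑ i ∈ s, divMulGradient x (φ i) h q := by
  have hd : differential m (fun q => ∑ i ∈ s, φ i q) q = ∑ i ∈ s, differential m (φ i) q :=
    differential_eq_of_hasFDerivWithinAt
      (continuous_finsetSum _ fun i _ => (hφ i).continuous).continuousAt
      (HasFDerivWithinAt.fun_sum fun i _ =>
        hasFDerivWithinAt_chartRep ((hφ i).mdifferentiable (by simp) q))
  simp only [divMulGradient, gradInner, Finset.sum_add_distrib, hd, ← gramTrace_sum,
    Finset.sum_mul, _root_.sum_apply]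

/-- Green's formula for a test function supported in the interior. -/
theorem integral_divMulGradient [T2Space M]
    (hx : ContMDiff (𝓡∂ (m + 1)) 𝓘(ℝ, EuclideanSpace ℝ (Fin (m + 2))) ∞ x)
    (hi : ∀ p, Function.Injective (differential m x p))
    (hψ : ContMDiff (𝓡∂ (m + 1)) 𝓘(ℝ, ℝ) ∞ ψ) (hh : ContMDiff (𝓡∂ (m + 1)) 𝓘(ℝ, ℝ) ∞ h)
    (hint : tsupport ψ ⊆ (𝓡∂ (m + 1)).interior M) :
    ∫ q, divMulGradient x ψ h q ∂(area x) = 0 := by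
  obtain ⟨t, ht⟩ := isCompact_univ.elim_finite_subcover
    (fun p : M => (extChartAt (𝓡∂ (m + 1)) p).source) (fun p => isOpen_extChartAt_source p)
    (fun p _ => mem_iUnion.2 ⟨p, mem_extChartAt_source p⟩)
  obtain ⟨ρ, hρ⟩ := SmoothPartitionOfUnity.exists_isSubordinate (𝓡∂ (m + 1)) isClosed_univ
    (fun p : t => (extChartAt (𝓡∂ (m + 1)) (p : M)).source) (fun p => isOpen_extChartAt_source _)
    (fun q hq => by
      obtain ⟨r, hr, h'⟩ := mem_iUnion₂.1 (ht hq)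
      exact mem_iUnion.2 ⟨⟨r, hr⟩, h'⟩)
  have hs : ∀ i, ContMDiff (𝓡∂ (m + 1)) 𝓘(ℝ, ℝ) ∞ fun q => ρ i q * ψ q := fun i =>
    (ρ i).contMDiff.mul hψ
  have hsum : ψ = fun q => ∑ i, ρ i q * ψ q := by
    ext q
    have h1 := ρ.sum_eq_one (mem_univ q)
    rw [finsum_eq_sum_of_fintype] at h1
    rw [← Finset.sum_mul, h1, one_mul]
  have hsi : ∀ i, tsupport (fun q => ρ i q * ψ q) ⊆ (𝓡∂ (m + 1)).interior M := fun i =>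
    (tsupport_mul_subset_right (f := ρ i) (g := ψ)).trans hint
  have := isFiniteMeasure_area hx
  rw [hsum]
  simp_rw [divMulGradient_sum Finset.univ hs]
  rw [integral_finsetSum _ fun i _ => (continuous_divMulGradient hx hi (hs i) hh
    (hsi i)).integrable_of_hasCompactSupport (HasCompactSupport.of_compactSpace _)]
  exact Finset.sum_eq_zero fun i _ => integral_divMulGradient_of_subset_source hx hi (hs i) hh
    (hsi i) (p := i) ((tsupport_mul_subset_left (f := ρ i) (g := ψ)).trans (hρ i))

end Green

/-! ### Cutoff functions near the sphere, with limits under the integral. -/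

section Cutoff

open Filter Topology

/-- A smooth cutoff function, which vanishes for `k (1 - t) ≤ 1`. -/
def cutoff (k : ℕ) (t : ℝ) : ℝ := Real.smoothTransition (k * (1 - t) - 1)

theorem contDiff_cutoff (k : ℕ) : ContDiff ℝ ∞ (cutoff k) :=
  Real.smoothTransition.contDiff.comp (by fun_prop)

theorem cutoff_eq_zero {k : ℕ} {t : ℝ} (h : k * (1 - t) ≤ 1) : cutoff k t = 0 :=
  Real.smoothTransition.zero_of_nonpos (by linarith)

theorem abs_cutoff_le_one (k : ℕ) (t : ℝ) : |cutoff k t| ≤ 1 := by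
  rw [cutoff, abs_of_nonneg (Real.smoothTransition.nonneg _)]
  exact Real.smoothTransition.le_one _

theorem eventually_lt_cutoff {t : ℝ} (ht : t < 1) : ∀ᶠ k : ℕ in atTop, 1 < k * (1 - t) - 1 := by
  have h : Tendsto (fun k : ℕ => (k : ℝ) * (1 - t)) atTop atTop :=
    tendsto_natCast_atTop_atTop.atTop_mul_const (by linarith)
  filter_upwards [h.eventually_gt_atTop 2] with k hk
  linarith

theorem tendsto_cutoff {t : ℝ} (ht : t < 1) : Tendsto (fun k => cutoff k t) atTop (𝓝 1) := by
  refine tendsto_const_nhds.congr' ?_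
  filter_upwards [eventually_lt_cutoff ht] with k hk
  exact (Real.smoothTransition.one_of_one_le hk.le).symm

theorem deriv_smoothTransition_of_lt {s : ℝ} (hs : s < 0) : deriv Real.smoothTransition s = 0 := by
  have : Real.smoothTransition =ᶠ[𝓝 s] fun _ => 0 := by
    filter_upwards [gt_mem_nhds hs] with r hr
    exact Real.smoothTransition.zero_of_nonpos hr.le
  rw [this.deriv_eq]; simp

theorem deriv_smoothTransition_of_gt {s : ℝ} (hs : 1 < s) : deriv Real.smoothTransition s = 0 := by
  have : Real.smoothTransition =ᶠ[𝓝 s] fun _ => 1 := by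
    filter_upwards [lt_mem_nhds hs] with r hr
    exact Real.smoothTransition.one_of_one_le hr.le
  rw [this.deriv_eq]; simp

theorem deriv_cutoff (k : ℕ) (t : ℝ) :
    deriv (cutoff k) t = deriv Real.smoothTransition (k * (1 - t) - 1) * -k := by
  have h1 : HasDerivAt (fun t : ℝ => (k : ℝ) * (1 - t) - 1) (-k) t := by
    simpa using (((hasDerivAt_id t).const_sub 1).const_mul (k : ℝ)).sub_const 1
  have h2 : HasDerivAt Real.smoothTransition _ (k * (1 - t) - 1) :=
    ((Real.smoothTransition.contDiff (n := 1)).differentiable (by simp) _).hasDerivAt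
  exact (h2.comp t h1).deriv

/-- The coefficient `η - η' (1 - t)` of the leading term in the divergence of a cut off field. -/
def cutoffSlope (k : ℕ) (t : ℝ) : ℝ := cutoff k t - deriv (cutoff k) t * (1 - t)

theorem continuous_deriv_cutoff (k : ℕ) : Continuous (deriv (cutoff k)) :=
  (contDiff_cutoff k).continuous_deriv (by simp)

theorem tendsto_deriv_cutoff {t : ℝ} (ht : t < 1) :
    Tendsto (fun k => deriv (cutoff k) t * (1 - t)) atTop (𝓝 0) := by
  refine tendsto_const_nhds.congr' ?_
  filter_upwards [eventually_lt_cutoff ht] with k hk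
  rw [deriv_cutoff, deriv_smoothTransition_of_gt hk]; ring

/-- The derivative grows like k, but it vanishes unless 1 ≤ k(1 - t) ≤ 2, so the factor 1 - t
compensates. The constant is twice the supremum of the derivative of the transition function. -/
theorem exists_abs_deriv_cutoff_le :
    ∃ C : ℝ, ∀ k t, t < 1 → |deriv (cutoff k) t * (1 - t)| ≤ C := by
  have hc : Continuous (deriv Real.smoothTransition) :=
    (Real.smoothTransition.contDiff (n := 1)).continuous_deriv (by simp)
  obtain ⟨C, hC⟩ := (isCompact_Icc (a := (0 : ℝ)) (b := 1)).exists_bound_of_continuousOn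
    hc.continuousOn
  have hC0 : 0 ≤ C := (norm_nonneg _).trans (hC 0 (by simp))
  refine ⟨C * 2, fun k t ht => ?_⟩
  rw [deriv_cutoff]
  have hk : 0 ≤ (k : ℝ) * (1 - t) := mul_nonneg (Nat.cast_nonneg k) (by linarith)
  rcases lt_or_ge ((k : ℝ) * (1 - t) - 1) 0 with h | h
  · rw [deriv_smoothTransition_of_lt h]; simpa using hC0
  rcases lt_or_ge 1 ((k : ℝ) * (1 - t) - 1) with h' | h'
  · rw [deriv_smoothTransition_of_gt h']; simpa using hC0
  rw [mul_assoc, abs_mul, show -(k : ℝ) * (1 - t) = -((k : ℝ) * (1 - t)) by ring, abs_neg,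
    abs_of_nonneg hk]
  exact mul_le_mul (hC _ ⟨h, h'⟩) (by linarith) hk hC0

/-- Dominated convergence. It is applied to `cutoff` and `cutoffSlope`, with limit 1, and to t ↦
`deriv (cutoff k) t * (1 - t)`, with limit 0. -/
theorem tendsto_integral_cutoff {Ω : Type*} [MeasurableSpace Ω] {μ : Measure Ω}
    {c : ℕ → ℝ → ℝ} {C l : ℝ} (hc : ∀ k, Continuous (c k)) (hb : ∀ k t, t < 1 → |c k t| ≤ C)
    (hl : ∀ t < 1, Tendsto (fun k => c k t) atTop (𝓝 l)) {ρ : Ω → ℝ}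
    (hρ : AEStronglyMeasurable ρ μ) (hρ1 : ∀ᵐ z ∂μ, ρ z < 1) {F : Ω → ℝ} (hF : Integrable F μ) :
    Tendsto (fun k => ∫ z, c k (ρ z) * F z ∂μ) atTop (𝓝 (l * ∫ z, F z ∂μ)) := by
  rw [← integral_const_mul]
  refine tendsto_integral_of_dominated_convergence (fun z => C * |F z|)
    (fun k => ((hc k).comp_aestronglyMeasurable hρ).mul hF.1) (hF.abs.const_mul C) ?_ ?_
  · intro k
    filter_upwards [hρ1] with z hz
    rw [Real.norm_eq_abs, abs_mul]
    exact mul_le_mul_of_nonneg_right (hb k _ hz) (abs_nonneg _)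
  · filter_upwards [hρ1] with z hz
    exact (hl _ hz).mul_const _

theorem exists_abs_cutoffSlope_le : ∃ C : ℝ, ∀ k t, t < 1 → |cutoffSlope k t| ≤ C := by
  obtain ⟨C, hC⟩ := exists_abs_deriv_cutoff_le
  exact ⟨1 + C, fun k t ht => (abs_sub _ _).trans (add_le_add (abs_cutoff_le_one k t) (hC k t ht))⟩

theorem tendsto_cutoffSlope {t : ℝ} (ht : t < 1) :
    Tendsto (fun k => cutoffSlope k t) atTop (𝓝 1) := by
  simpa [cutoffSlope] using (tendsto_cutoff ht).sub (tendsto_deriv_cutoff ht)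

theorem continuous_cutoffSlope (k : ℕ) : Continuous (cutoffSlope k) :=
  (contDiff_cutoff k).continuous.sub
    ((continuous_deriv_cutoff k).mul (continuous_const.sub continuous_id))

end Cutoff

/-! ### The Dirichlet energy of w = (|x|² - 1)/2. -/

section Dirichlet

open Filter Topology

variable {m : ℕ} {M : Type*} [TopologicalSpace M] [ChartedSpace (EuclideanHalfSpace (m + 1)) M]
  [IsManifold (𝓡∂ (m + 1)) ∞ M] {x N : M → EuclideanSpace ℝ (Fin (m + 2))} {H : ℝ}

omit [IsManifold (𝓡∂ (m + 1)) ∞ M] in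
theorem differential_comp {f : M → ℝ} {p : M} (hf : MDifferentiableAt (𝓡∂ (m + 1)) 𝓘(ℝ, ℝ) f p)
    {φ : ℝ → ℝ} {φ' : ℝ} (hφ : HasDerivAt φ φ' (f p)) :
    differential m (fun q => φ (f q)) p = φ' • differential m f p := by
  refine differential_eq_of_hasFDerivWithinAt
    (ContinuousAt.comp (f := f) hφ.continuousAt hf.continuousAt) ?_
  have h1 : HasDerivAt φ φ' (chartRep p f (extChartAt (𝓡∂ (m + 1)) p p)) := by
    rwa [chartRep, Function.comp_apply, extChartAt_to_inv]
  exact h1.comp_hasFDerivWithinAt _ (hasFDerivWithinAt_chartRep hf)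

omit [IsManifold (𝓡∂ (m + 1)) ∞ M] in
theorem differential_sphereDefect
    {p : M} (hx : MDifferentiableAt (𝓡∂ (m + 1)) 𝓘(ℝ, EuclideanSpace ℝ (Fin (m + 2))) x p)
    (v : EuclideanSpace ℝ (Fin (m + 1))) :
    differential m (sphereDefect x) p v = ⟪differential m x p v, x p⟫ := by
  have h1 := (hasFDerivWithinAt_chartRep hx).inner ℝ (hasFDerivWithinAt_chartRep hx)
  have hd : MDifferentiableAt (𝓡∂ (m + 1)) 𝓘(ℝ, ℝ) (fun q => ⟪x q, x q⟫) p :=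
    (show HasMFDerivAt (𝓡∂ (m + 1)) 𝓘(ℝ, ℝ) (fun q => ⟪x q, x q⟫) p _ from
      ⟨hx.continuousAt.inner hx.continuousAt, h1⟩).mdifferentiableAt
  have h2 : HasDerivAt (fun t : ℝ => (1 / 2) * t + -(1 / 2)) (1 / 2) ⟪x p, x p⟫ := by
    simpa using ((hasDerivAt_id ⟪x p, x p⟫).const_mul (1 / 2 : ℝ)).add_const (-(1 / 2))
  have h3 : differential m (sphereDefect x) p = _ := differential_comp hd h2
  rw [h3, _root_.smul_apply, differential_inner hx hx, smul_eq_mul,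
    real_inner_comm (differential m x p v)]
  ring

namespace IsImmersedInBall

omit [IsManifold (𝓡∂ (m + 1)) ∞ M] in
-- The gradient of w is the tangential part of x.
theorem gradInner_sphereDefect (h : IsImmersedInBall x N) (p : M) :
    gradInner x (sphereDefect x) (sphereDefect x) p = ⟪x p, x p⟫ - ⟪x p, N p⟫ ^ 2 := by
  have hx := h.smooth.mdifferentiable (by simp) p
  rw [gradInner]
  simp_rw [differential_sphereDefect hx]
  rw [gramTrace_inner_inner (h.immersion p) (h.normal_norm p) (h.normal_orthogonal p),
    real_inner_comm (x p) (N p)]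
  ring

omit [IsManifold (𝓡∂ (m + 1)) ∞ M] in
theorem inner_self_lt_one (h : IsImmersedInBall x N) {p : M} (hp : p ∈ (𝓡∂ (m + 1)).interior M) :
    ⟪x p, x p⟫ < 1 := by
  have := h.interior_mem p hp
  rw [mem_ball_zero_iff] at this
  rw [real_inner_self_eq_norm_sq]
  nlinarith [norm_nonneg (x p)]

omit [IsManifold (𝓡∂ (m + 1)) ∞ M] in
theorem tsupport_cutoff_subset (h : IsImmersedInBall x N) (k : ℕ) (f : M → ℝ) :
    tsupport (fun q => cutoff k ⟪x q, x q⟫ * f q) ⊆ (𝓡∂ (m + 1)).interior M := by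
  have hcont := h.smooth.continuous
  have hcl : IsClosed {q : M | 1 ≤ (k : ℝ) * (1 - ⟪x q, x q⟫)} :=
    isClosed_le continuous_const (continuous_const.mul (continuous_const.sub (hcont.inner hcont)))
  refine (closure_minimal (t := {q : M | 1 ≤ (k : ℝ) * (1 - ⟪x q, x q⟫)}) ?_ hcl).trans ?_
  · intro q hq
    by_contra h'
    rw [mem_ofPred_eq, not_le] at h'
    exact hq (by simp only [cutoff_eq_zero h'.le, zero_mul])
  · intro q hq
    rw [← (𝓡∂ (m + 1)).compl_boundary]
    intro hb
    rw [mem_ofPred_eq, h.inner_self_boundary hb] at hq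
    norm_num at hq

variable [MeasurableSpace M] [BorelSpace M] [CompactSpace M] [Nonempty M] [T2Space M]

theorem ae_interior (h : IsImmersedInBall x N) :
    ∀ᵐ p ∂(area x), p ∈ (𝓡∂ (m + 1)).interior M := by
  rw [ae_iff]
  refine measure_mono_null ?_ (area_boundary h.smooth)
  intro p hp
  rw [← (𝓡∂ (m + 1)).compl_interior]
  exact hp

omit [T2Space M] in
theorem integrable_of_continuous (h : IsImmersedInBall x N) {f : M → ℝ} (hf : Continuous f) :
    Integrable f (area x) := by
  have := isFiniteMeasure_area h.smooth
  exact hf.integrable_of_hasCompactSupport (HasCompactSupport.of_compactSpace _)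

/-- The energy of the function `(|x|² - 1) / 2`, which vanishes on the boundary. -/
theorem integral_sphereDefect_mul (h : IsImmersedInBall x N)
    (hH : ∀ p, meanCurvature x N p = H) :
    ∫ p, sphereDefect x p * (((m : ℝ) + 1) * (1 + H * ⟪x p, N p⟫)) ∂(area x) =
      -∫ p, (⟪x p, x p⟫ - ⟪x p, N p⟫ ^ 2) ∂(area x) := by
  have hcx := h.smooth.continuous
  have hcN := h.normal_smooth.continuous
  have hcxx : Continuous fun p => ⟪x p, x p⟫ := hcx.inner hcx
  have hcxN : Continuous fun p => ⟪x p, N p⟫ := hcx.inner hcN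
  have hw := contMDiff_sphereDefect h.smooth
  set A : M → ℝ := fun p => sphereDefect x p * (((m : ℝ) + 1) * (1 + H * ⟪x p, N p⟫)) with hA
  set B : M → ℝ := fun p => ⟪x p, x p⟫ - ⟪x p, N p⟫ ^ 2 with hB
  have hAc : Continuous A := hw.continuous.mul
    (continuous_const.mul (continuous_const.add (continuous_const.mul hcxN)))
  have hBc : Continuous B := hcxx.sub (hcxN.pow 2)
  have hAi := h.integrable_of_continuous hAc
  have hBi := h.integrable_of_continuous hBc
  have hlt : ∀ᵐ p ∂(area x), ⟪x p, x p⟫ < 1 := by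
    filter_upwards [h.ae_interior] with p hp using h.inner_self_lt_one hp
  obtain ⟨C, hC⟩ := exists_abs_cutoffSlope_le
  have l1 := tendsto_integral_cutoff (fun k => (contDiff_cutoff k).continuous)
    (fun k t _ => abs_cutoff_le_one k t) (fun t ht => tendsto_cutoff ht)
    hcxx.aestronglyMeasurable hlt hAi
  have l2 := tendsto_integral_cutoff continuous_cutoffSlope hC
    (fun t ht => tendsto_cutoffSlope ht) hcxx.aestronglyMeasurable hlt hBi
  -- Green's formula with ψ = η(|x|²) w and h = w, where η is the cutoff; ψ is supported in the
  -- interior.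
  have key : ∀ k, (∫ p, cutoff k ⟪x p, x p⟫ * A p ∂(area x)) +
      ∫ p, cutoffSlope k ⟪x p, x p⟫ * B p ∂(area x) = 0 := by
    intro k
    have hθ : ContMDiff (𝓡∂ (m + 1)) 𝓘(ℝ, ℝ) ∞ fun q =>
        cutoff k ⟪x q, x q⟫ * sphereDefect x q :=
      ((contDiff_cutoff k).contMDiff.comp (contMDiff_inner h.smooth h.smooth)).mul hw
    have i1 : Integrable (fun p => cutoff k ⟪x p, x p⟫ * A p) (area x) :=
      h.integrable_of_continuous (((contDiff_cutoff k).continuous.comp hcxx).mul hAc)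
    have i2 : Integrable (fun p => cutoffSlope k ⟪x p, x p⟫ * B p) (area x) :=
      h.integrable_of_continuous (((continuous_cutoffSlope k).comp hcxx).mul hBc)
    rw [← integral_add i1 i2, ← integral_divMulGradient h.smooth h.immersion hθ hw
        (h.tsupport_cutoff_subset k (sphereDefect x))]
    refine integral_congr_ae ?_
    filter_upwards [h.ae_interior] with p hp
    have hxx : ∀ q, ⟪x q, x q⟫ = 2 * sphereDefect x q + 1 := fun q => by
      rw [sphereDefect]; ring
    -- As |x|² = 2w + 1, ψ is a function of w, with derivative η + 2wη' = η - η'(1 - |x|²), the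
    -- cutoff slope. It stays bounded because w vanishes on the sphere.
    have hφ : HasDerivAt (fun s : ℝ => cutoff k (2 * s + 1) * s)
        (cutoffSlope k ⟪x p, x p⟫) (sphereDefect x p) := by
      have e1 : HasDerivAt (fun s : ℝ => 2 * s + 1) 2 (sphereDefect x p) := by
        simpa using ((hasDerivAt_id (sphereDefect x p)).const_mul (2 : ℝ)).add_const 1
      have e2 : HasDerivAt (cutoff k) _ (2 * sphereDefect x p + 1) :=
        ((contDiff_cutoff k).differentiable (by simp) _).hasDerivAt
      have e3 := (HasDerivAt.comp (h := fun s : ℝ => 2 * s + 1) (sphereDefect x p) e2 e1).mul (hasDerivAt_id (sphereDefect x p))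
      refine e3.congr_deriv ?_
      rw [cutoffSlope, hxx p]
      simp
      ring
    have hd := differential_comp (hw.mdifferentiable (by simp) p) hφ
    have hfun : (fun q => cutoff k ⟪x q, x q⟫ * sphereDefect x q) = fun q =>
        cutoff k (2 * sphereDefect x q + 1) * sphereDefect x q := by
      ext q; rw [hxx q]
    have hg : gradInner x (fun q => cutoff k ⟪x q, x q⟫ * sphereDefect x q) (sphereDefect x) p =
        cutoffSlope k ⟪x p, x p⟫ * B p := by
      rw [show B p = _ from (h.gradInner_sphereDefect p).symm, gradInner, gradInner, hfun, hd, ← gramTrace_const_mul]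
      exact gramTrace_congr fun v w => by
        rw [_root_.smul_apply, smul_eq_mul, mul_assoc]
    rw [divMulGradient, hg, h.laplacian_sphereDefect hH hp, hA]
    ring
  have l3 := tendsto_nhds_unique (l1.add l2) (by simp_rw [key]; exact tendsto_const_nhds)
  linarith

end IsImmersedInBall

end Dirichlet

/-! ### The conformal field and the divergence of its cutoffs. -/

section ConformalField

variable {d : ℕ}

/-- A conformal field of the unit ball, which is tangent to the unit sphere. -/
def conformalField (a y : EuclideanSpace ℝ (Fin d)) : EuclideanSpace ℝ (Fin d) :=
  ⟪a, y⟫ • y + (-(1 / 2) * ⟪y, y⟫ + -(1 / 2)) • a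

theorem contDiff_conformalField (a : EuclideanSpace ℝ (Fin d)) :
    ContDiff ℝ ∞ (conformalField a) :=
  ((contDiff_const.inner ℝ contDiff_id).smul contDiff_id).add
    (((contDiff_const.mul (contDiff_id.inner ℝ contDiff_id)).add contDiff_const).smul
      contDiff_const)

theorem hasFDerivAt_inner_self (y : EuclideanSpace ℝ (Fin d)) :
    HasFDerivAt (fun z : EuclideanSpace ℝ (Fin d) => ⟪z, z⟫) ((2 : ℝ) • innerSL ℝ y) y := by
  refine ((hasFDerivAt_id y).inner ℝ (hasFDerivAt_id y)).congr_fderiv ?_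
  ext v
  simp [real_inner_comm, two_mul]

/-- The derivative is ⟨a, y⟩ times the identity plus the skew map v ↦ ⟨a, v⟩y - ⟨y, v⟩a. So the
field is conformal, with divergence d⟨a, y⟩. -/
theorem fderiv_conformalField (a y v : EuclideanSpace ℝ (Fin d)) :
    fderiv ℝ (conformalField a) y v = ⟪a, v⟫ • y + ⟪a, y⟫ • v - ⟪y, v⟫ • a := by
  have h1 : HasFDerivAt (fun z : EuclideanSpace ℝ (Fin d) => ⟪a, z⟫) (innerSL ℝ a) y :=
    (innerSL ℝ a).hasFDerivAt
  have h2 : HasFDerivAt (conformalField a) _ y := (h1.fun_smul (hasFDerivAt_id y)).fun_add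
    ((((hasFDerivAt_inner_self y).const_mul (-(1 / 2))).add_const (-(1 / 2))).smul_const a)
  rw [h2.fderiv]
  simp
  module

/-- The factor 1 - |y|² expresses tangency to the sphere. It multiplies the derivative of the cutoff
in the divergence and keeps that term bounded. -/
theorem inner_conformalField (a y : EuclideanSpace ℝ (Fin d)) :
    ⟪y, conformalField a y⟫ = -(1 / 2) * (1 - ⟪y, y⟫) * ⟪a, y⟫ := by
  rw [conformalField, inner_add_right, inner_smul_right, inner_smul_right, real_inner_comm a y]
  ring

theorem euclideanDiv_cutoff_conformalField (k : ℕ) (a y : EuclideanSpace ℝ (Fin d)) :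
    euclideanDiv (fun y => cutoff k ⟪y, y⟫ • conformalField a y) y =
      d * (cutoff k ⟪y, y⟫ * ⟪a, y⟫) - deriv (cutoff k) ⟪y, y⟫ * (1 - ⟪y, y⟫) * ⟪a, y⟫ := by
  have hη : HasFDerivAt (fun z : EuclideanSpace ℝ (Fin d) => cutoff k ⟪z, z⟫) _ y :=
    ((contDiff_cutoff k).differentiable (by simp) _).hasDerivAt.comp_hasFDerivAt y
      (hasFDerivAt_inner_self y)
  have h2 : HasFDerivAt (fun y => cutoff k ⟪y, y⟫ • conformalField a y) _ y :=
    hη.fun_smul ((contDiff_conformalField a).differentiable (by simp) y).hasFDerivAt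
  have hin : ∀ b z : EuclideanSpace ℝ (Fin d), ⟪b, z⟫ = ∑ i, b i * z i := fun b z => by
    simp [PiLp.inner_apply, mul_comm]
  have h3 : ∀ i, fderiv ℝ (fun y => cutoff k ⟪y, y⟫ • conformalField a y) y
      (EuclideanSpace.single i 1) i = cutoff k ⟪y, y⟫ * ⟪a, y⟫ +
        2 * deriv (cutoff k) ⟪y, y⟫ * (y i * conformalField a y i) := by
    intro i
    rw [h2.fderiv]
    simp [fderiv_conformalField, EuclideanSpace.inner_single_right]
    ring
  rw [euclideanDiv, Finset.sum_congr rfl fun i _ => h3 i, Finset.sum_add_distrib,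
    ← Finset.mul_sum Finset.univ (fun i => y i * conformalField a y i), ← hin,
    inner_conformalField, Finset.sum_const, Finset.card_univ, Fintype.card_fin, nsmul_eq_mul]
  ring

theorem norm_lt_one_of_cutoff {k : ℕ} {y : EuclideanSpace ℝ (Fin d)}
    (hy : 1 ≤ (k : ℝ) * (1 - ⟪y, y⟫)) : ‖y‖ < 1 := by
  by_contra! h
  rw [real_inner_self_eq_norm_sq] at hy
  nlinarith [mul_nonneg (Nat.cast_nonneg (α := ℝ) k) (by nlinarith : 0 ≤ ‖y‖ ^ 2 - 1)]

theorem tsupport_cutoff_smul_subset (k : ℕ)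
    (X : EuclideanSpace ℝ (Fin d) → EuclideanSpace ℝ (Fin d)) :
    tsupport (fun y => cutoff k ⟪y, y⟫ • X y) ⊆ Metric.ball 0 1 := by
  have hcl : IsClosed {y : EuclideanSpace ℝ (Fin d) | 1 ≤ (k : ℝ) * (1 - ⟪y, y⟫)} :=
    isClosed_le continuous_const
      (continuous_const.mul (continuous_const.sub (continuous_id.inner continuous_id)))
  refine (closure_minimal
    (t := {y : EuclideanSpace ℝ (Fin d) | 1 ≤ (k : ℝ) * (1 - ⟪y, y⟫)}) ?_ hcl).trans ?_
  · intro y hy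
    by_contra h'
    rw [mem_ofPred_eq, not_le] at h'
    exact hy (by simp only [cutoff_eq_zero h'.le, zero_smul])
  · intro y hy
    rw [mem_ball_zero_iff]
    exact norm_lt_one_of_cutoff hy

end ConformalField

/-! ### The generalized body, and the mean value of the test functions. -/

section Body

open Filter Topology

variable {m : ℕ} {M : Type*} [TopologicalSpace M] [ChartedSpace (EuclideanHalfSpace (m + 1)) M]
  [MeasurableSpace M] {x N : M → EuclideanSpace ℝ (Fin (m + 2))}
  {k : ℕ} {T : Fin k → Set (EuclideanSpace ℝ (Fin (m + 2)))}

theorem IsGeneralizedBody.volume_lt_top (hT : IsGeneralizedBody x N T) (i : Fin k) :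
    volume (T i) < ⊤ :=
  (measure_mono (hT.subset_ball i)).trans_lt measure_ball_lt_top

theorem IsGeneralizedBody.integrableOn_of_continuous (hT : IsGeneralizedBody x N T) (i : Fin k)
    {Z : Type*} [NormedAddCommGroup Z] {f : EuclideanSpace ℝ (Fin (m + 2)) → Z}
    (hf : Continuous f) : IntegrableOn f (T i) :=
  (hf.continuousOn.integrableOn_compact (isCompact_closedBall (0 : EuclideanSpace ℝ _) 1)).mono_set
    ((hT.subset_ball i).trans Metric.ball_subset_closedBall)

theorem IsGeneralizedBody.sum_integral_eq_zero (hT : IsGeneralizedBody x N T)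
    (hc : massCenter T = 0) : ∑ i, ∫ y in T i, y = 0 := by
  rw [massCenter, smul_eq_zero] at hc
  refine hc.resolve_left (inv_ne_zero (ne_of_gt ?_))
  refine Finset.sum_pos (fun i _ => ?_) ⟨⟨0, hT.pos⟩, Finset.mem_univ _⟩
  exact ENNReal.toReal_pos ((hT.isOpen i).measure_pos volume (hT.nonempty i)).ne'
    (hT.volume_lt_top i).ne

variable [IsManifold (𝓡∂ (m + 1)) ∞ M] [BorelSpace M] [CompactSpace M] [Nonempty M] [T2Space M]

/-- The test functions have mean zero if the mass center of the body is the origin. -/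
theorem IsGeneralizedBody.integral_testFunction (hT : IsGeneralizedBody x N T)
    (hc : massCenter T = 0) (h : IsImmersedInBall x N) (a : EuclideanSpace ℝ (Fin (m + 2))) :
    ∫ p, testFunction x N a p ∂(area x) = 0 := by
  have hcx := h.smooth.continuous
  have hcxx : Continuous fun p => ⟪x p, x p⟫ := hcx.inner hcx
  have hlt : ∀ᵐ p ∂(area x), ⟪x p, x p⟫ < 1 := by
    filter_upwards [h.ae_interior] with p hp using h.inner_self_lt_one hp
  have hay : Continuous fun y : EuclideanSpace ℝ (Fin (m + 2)) => ⟪a, y⟫ :=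
    continuous_const.inner continuous_id
  have hyy : Continuous fun y : EuclideanSpace ℝ (Fin (m + 2)) => ⟪y, y⟫ :=
    continuous_id.inner continuous_id
  obtain ⟨C, hC⟩ := exists_abs_deriv_cutoff_le
  have hTlt : ∀ i, ∀ᵐ y ∂(volume.restrict (T i)), ⟪y, y⟫ < 1 := fun i => by
    filter_upwards [ae_restrict_mem (hT.isOpen i).measurableSet] with y hy
    have := mem_ball_zero_iff.1 (hT.subset_ball i hy)
    rw [real_inner_self_eq_norm_sq]
    nlinarith [norm_nonneg y]
  have l1 := tendsto_integral_cutoff (fun k => (contDiff_cutoff k).continuous)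
    (fun k t _ => abs_cutoff_le_one k t) (fun t ht => tendsto_cutoff ht)
    hcxx.aestronglyMeasurable hlt
    (h.integrable_of_continuous (contMDiff_testFunction h.smooth h.normal_smooth a).continuous)
  have l2 := fun i => tendsto_integral_cutoff (fun k => (contDiff_cutoff k).continuous)
    (fun k t _ => abs_cutoff_le_one k t) (fun t ht => tendsto_cutoff ht)
    hyy.aestronglyMeasurable (hTlt i) (hT.integrableOn_of_continuous i hay)
  have l3 := fun i => tendsto_integral_cutoff
    (c := fun k t => deriv (cutoff k) t * (1 - t))
    (fun k => (continuous_deriv_cutoff k).mul (continuous_const.sub continuous_id))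
    hC (fun t ht => tendsto_deriv_cutoff ht)
    hyy.aestronglyMeasurable (hTlt i) (hT.integrableOn_of_continuous i hay)
  -- The boundary identity of the body, for the cut off conformal field. In the limit the cutoff
  -- derivative disappears, which leaves (m + 2) ∑ᵢ ∫_{Tᵢ} ⟨a, y⟩ = -∫ f_a.
  have key : ∀ k, ∑ i, (((m + 2 : ℕ) : ℝ) * (∫ y in T i, cutoff k ⟪y, y⟫ * ⟪a, y⟫) -
      ∫ y in T i, deriv (cutoff k) ⟪y, y⟫ * (1 - ⟪y, y⟫) * ⟪a, y⟫) =
        -∫ p, cutoff k ⟪x p, x p⟫ * testFunction x N a p ∂(area x) := by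
    intro k
    have hY : ContDiff ℝ ∞ fun y => cutoff k ⟪y, y⟫ • conformalField a y :=
      ((contDiff_cutoff k).comp (contDiff_id.inner ℝ contDiff_id)).smul (contDiff_conformalField a)
    have hsub := tsupport_cutoff_smul_subset k (conformalField a)
    have hcs : HasCompactSupport fun y => cutoff k ⟪y, y⟫ • conformalField a y :=
      (isCompact_closedBall (0 : EuclideanSpace ℝ (Fin (m + 2))) 1).of_isClosed_subset
        (isClosed_tsupport _) (hsub.trans Metric.ball_subset_closedBall)
    have hb := hT.boundary_eq _ hY hcs hsub
    simp_rw [euclideanDiv_cutoff_conformalField] at hb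
    convert hb using 1
    · refine Finset.sum_congr rfl fun i _ => ?_
      have i1 : IntegrableOn (fun y => cutoff k ⟪y, y⟫ * ⟪a, y⟫) (T i) :=
        hT.integrableOn_of_continuous i (((contDiff_cutoff k).continuous.comp hyy).mul hay)
      have i2 : IntegrableOn (fun y => deriv (cutoff k) ⟪y, y⟫ * (1 - ⟪y, y⟫) * ⟪a, y⟫) (T i) :=
        hT.integrableOn_of_continuous i ((((continuous_deriv_cutoff k).comp hyy).mul
          (continuous_const.sub hyy)).mul hay)
      rw [integral_sub (i1.const_mul _) i2, integral_const_mul]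
    · congr 1
      refine integral_congr_ae (Eventually.of_forall fun p => ?_)
      simp only [inner_smul_left, conformalField, inner_add_left, testFunction, conj_trivial]
  have l4 := tendsto_finsetSum Finset.univ fun i _ =>
    ((l2 i).const_mul (((m + 2 : ℕ) : ℝ))).sub (l3 i)
  have l5 := tendsto_nhds_unique (l4.congr key) l1.neg
  have h0 : ∑ i, ∫ y in T i, ⟪a, y⟫ = 0 := by
    have h1 : ∀ i, ∫ y in T i, ⟪a, y⟫ = ⟪a, ∫ y in T i, y⟫ := fun i =>
      integral_inner (hT.integrableOn_of_continuous i continuous_id) a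
    rw [Finset.sum_congr rfl fun i _ => h1 i, ← inner_sum, hT.sum_integral_eq_zero hc,
      inner_zero_right]
  simp only [one_mul, zero_mul, sub_zero, ← Finset.mul_sum, h0, mul_zero] at l5
  linarith

end Body

/-! ### The trace of the second variation over the test functions is negative. -/

section Instability

variable {m : ℕ} {M : Type*} [TopologicalSpace M] [ChartedSpace (EuclideanHalfSpace (m + 1)) M]
  [IsManifold (𝓡∂ (m + 1)) ∞ M] {x N : M → EuclideanSpace ℝ (Fin (m + 2))} {H θ : ℝ}

/-- A function with vanishing differential is constant near each point, in the chart. -/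
theorem exists_ball_chartRep_eq {f : M → ℝ} (hf : ContMDiff (𝓡∂ (m + 1)) 𝓘(ℝ, ℝ) ∞ f)
    (hd : ∀ q, differential m f q = 0) (p : M) :
    ∃ r > 0, ∀ u ∈ Metric.ball (extChartAt (𝓡∂ (m + 1)) p p) r ∩ range (𝓡∂ (m + 1)),
      u ∈ (extChartAt (𝓡∂ (m + 1)) p).target ∧ chartRep p f u = f p := by
  obtain ⟨r, hr, hball⟩ := Metric.mem_nhdsWithin_iff.1
    (extChartAt_target_mem_nhdsWithin (I := 𝓡∂ (m + 1)) p)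
  refine ⟨r, hr, fun u hu => ⟨hball hu, ?_⟩⟩
  -- A ball intersected with the half space is convex, so the mean value inequality with constant 0
  -- applies up to the boundary.
  have hconv : Convex ℝ (Metric.ball (extChartAt (𝓡∂ (m + 1)) p p) r ∩ range (𝓡∂ (m + 1))) :=
    (convex_ball _ _).inter (𝓡∂ (m + 1)).convex_range
  have hder : ∀ z ∈ Metric.ball (extChartAt (𝓡∂ (m + 1)) p p) r ∩ range (𝓡∂ (m + 1)),
      HasFDerivWithinAt (chartRep p f) (0 : EuclideanSpace ℝ (Fin (m + 1)) →L[ℝ] ℝ)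
        (Metric.ball (extChartAt (𝓡∂ (m + 1)) p p) r ∩ range (𝓡∂ (m + 1))) z := by
    intro z hz
    have hzt := hball hz
    have h1 := fderivWithin_chartRep hzt (hf.mdifferentiable (by simp) _)
    rw [hd, ContinuousLinearMap.zero_comp] at h1
    have h2 : DifferentiableWithinAt ℝ (chartRep p f) (range (𝓡∂ (m + 1))) z :=
      (differentiableWithinAt_congr_set (extChartAt_target_eventuallyEq_of_mem hzt)).1
        ((contDiffOn_chartRep hf p).differentiableOn (by simp) z hzt)
    rw [← h1]
    exact h2.hasFDerivWithinAt.mono inter_subset_right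
  have h0 : extChartAt (𝓡∂ (m + 1)) p p ∈
      Metric.ball (extChartAt (𝓡∂ (m + 1)) p p) r ∩ range (𝓡∂ (m + 1)) :=
    ⟨Metric.mem_ball_self hr, extChartAt_target_subset_range p (mem_extChartAt_target p)⟩
  have h3 := hconv.norm_image_sub_le_of_norm_hasFDerivWithin_le hder (C := 0) (by simp) h0 hu
  rw [zero_mul, norm_le_zero_iff, sub_eq_zero] at h3
  rw [h3, chartRep, Function.comp_apply, extChartAt_to_inv]

/-- The position vector is not everywhere normal. -/
theorem IsImmersedInBall.exists_inner_sq_ne (h : IsImmersedInBall x N) :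
    ∃ p, ⟪x p, x p⟫ - ⟪x p, N p⟫ ^ 2 ≠ 0 := by
  by_contra! h0
  -- Equality in the Cauchy–Schwarz inequality makes x a multiple of N, and then dw = ⟨dx, x⟩ = 0.
  have hd : ∀ q, differential m (sphereDefect x) q = 0 := by
    intro q
    have hxN : x q = ⟪x q, N q⟫ • N q := by
      rw [← sub_eq_zero, ← norm_eq_zero, ← sq_eq_zero_iff, ← real_inner_self_eq_norm_sq,
        inner_sub_left, inner_sub_right, inner_sub_right, inner_smul_left, inner_smul_left,
        inner_smul_right, inner_smul_right, real_inner_self_eq_norm_sq (N q), h.normal_norm,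
        real_inner_comm (x q) (N q)]
      have := h0 q
      simp only [conj_trivial]
      linarith
    ext v
    rw [differential_sphereDefect (h.smooth.mdifferentiable (by simp) q), hxN, inner_smul_right,
      real_inner_comm (N q) (differential m x q v), h.normal_orthogonal, mul_zero]
    rfl
  obtain ⟨p, hp⟩ := h.boundary_nonempty
  obtain ⟨r, hr, hball⟩ := exists_ball_chartRep_eq (contMDiff_sphereDefect h.smooth) hd p
  -- A point pushed from the boundary into the interior by half the radius. There |x| < 1, although
  -- w has the same value as at `p`, where |x| = 1.
  set u := extChartAt (𝓡∂ (m + 1)) p p + EuclideanSpace.single 0 (r / 2) with hu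
  have hu0 : u 0 = r / 2 := by
    rw [hu, PiLp.add_apply, extChartAt_boundary_zero hp]; simp
  obtain ⟨hut, huf⟩ := hball u ⟨by
    rw [Metric.mem_ball, dist_eq_norm, hu, add_sub_cancel_left, PiLp.norm_single,
      Real.norm_of_nonneg (by positivity)]
    linarith, mem_range_halfSpace.2 (by rw [hu0]; positivity)⟩
  have hint := (symm_mem_interior_iff hut).2 (mem_chartInterior_iff.2 ⟨hut, by rw [hu0]; positivity⟩)
  have h1 := h.inner_self_lt_one hint
  have h2 := h.inner_self_boundary hp
  have h3 : (1 / 2) * ⟪x ((extChartAt (𝓡∂ (m + 1)) p).symm u),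
    x ((extChartAt (𝓡∂ (m + 1)) p).symm u)⟫ + -(1 / 2) = (1 / 2) * ⟪x p, x p⟫ + -(1 / 2) := huf
  linarith

variable [MeasurableSpace M] [BorelSpace M] [CompactSpace M] [Nonempty M] [T2Space M]

omit [T2Space M] in
-- The integrand is the squared length of the tangential part of x: continuous, nonnegative, and
-- nonzero somewhere. The area charges nonempty open sets.
theorem IsImmersedInBall.integral_inner_sq_pos (h : IsImmersedInBall x N) :
    0 < ∫ p, (⟪x p, x p⟫ - ⟪x p, N p⟫ ^ 2) ∂(area x) := by
  have := isFiniteMeasure_area h.smooth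
  have := isOpenPosMeasure_area h.smooth h.immersion
  have hcx := h.smooth.continuous
  have hcN := h.normal_smooth.continuous
  obtain ⟨p, hp⟩ := h.exists_inner_sq_ne
  refine Continuous.integral_pos_of_hasCompactSupport_nonneg_nonzero (x := p)
    ((hcx.inner hcx).sub ((hcx.inner hcN).pow 2)) (HasCompactSupport.of_compactSpace _)
    (fun q => ?_) hp
  have h1 := abs_real_inner_le_norm (x q) (N q)
  rw [h.normal_norm, mul_one] at h1
  have h2 := sq_le_sq' (by linarith [neg_abs_le ⟪x q, N q⟫, abs_le.1 h1 |>.1]) (abs_le.1 h1).2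
  rw [Pi.zero_apply, real_inner_self_eq_norm_sq]
  linarith

theorem IsCapillary.secondVariation_testFunction (h : IsCapillary x N θ)
    (hH : ∀ p, meanCurvature x N p = H) (a : EuclideanSpace ℝ (Fin (m + 2))) :
    secondVariation x N θ (testFunction x N a) = ∫ p, ((m : ℝ) + 1) *
      (H * ⟪a, x p⟫ + ⟪a, N p⟫) * testFunction x N a p ∂(area x) := by
  have h1 : ∫ p, (differential m (testFunction x N a) p (conormalTangent x p) -
      (1 / Real.sin θ + Real.cot θ * secondForm x N p (conormalTangent x p)
        (conormalTangent x p)) * testFunction x N a p) * testFunction x N a p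
          ∂(boundaryArea x) = 0 := by
    refine integral_eq_zero_of_ae ?_
    filter_upwards [ae_boundaryArea_mem_boundary x] with p hp
    rw [h.testFunction_boundary hp, zero_mul]
    rfl
  rw [secondVariation, h1, add_zero, ← integral_neg]
  refine integral_congr_ae ?_
  filter_upwards [h.toIsImmersedInBall.ae_interior] with p hp
  rw [h.toIsImmersedInBall.laplacian_testFunction hH a hp]
  ring

/-- The trace of the second variation on the space of test functions. -/
theorem IsCapillary.sum_secondVariation (h : IsCapillary x N θ) :
    ∑ b, secondVariation x N θ (testFunction x N (EuclideanSpace.single b 1)) =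
      -(((m : ℝ) + 2) * ∫ p, (⟪x p, x p⟫ - ⟪x p, N p⟫ ^ 2) ∂(area x)) := by
  obtain ⟨H, hH⟩ := h.constant_meanCurvature
  have h' := h.toIsImmersedInBall
  have hcx := h'.smooth.continuous
  have hcN := h'.normal_smooth.continuous
  have hcxx : Continuous fun p => ⟪x p, x p⟫ := hcx.inner hcx
  have hcxN : Continuous fun p => ⟪x p, N p⟫ := hcx.inner hcN
  have hcw := (contMDiff_sphereDefect h'.smooth).continuous
  have hin : ∀ b z : EuclideanSpace ℝ (Fin (m + 2)), ⟪b, z⟫ = ∑ i, b i * z i := fun b z => by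
    simp [PiLp.inner_apply, mul_comm]
  have hD := h'.integral_sphereDefect_mul hH
  simp_rw [h.secondVariation_testFunction hH]
  have hint : ∀ b : Fin (m + 2), Integrable (fun p => ((m : ℝ) + 1) *
      (H * ⟪EuclideanSpace.single b (1 : ℝ), x p⟫ + ⟪EuclideanSpace.single b (1 : ℝ), N p⟫) *
        testFunction x N (EuclideanSpace.single b 1) p) (area x) := fun b =>
    h'.integrable_of_continuous
      ((continuous_const.mul ((continuous_const.mul (continuous_const.inner hcx)).add
        (continuous_const.inner hcN))).mul
          (contMDiff_testFunction h'.smooth h'.normal_smooth _).continuous)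
  rw [← integral_finsetSum _ fun b _ => hint b]
  -- Parseval's identity replaces sums of products of coordinates by |x|², ⟨x, N⟩ and |N|² = 1.
  -- Splitting -(|x|² + 1)/2 as w - |x|² isolates w Δw, whose integral is known.
  have hpt : ∀ p, ∑ b, ((m : ℝ) + 1) * (H * ⟪EuclideanSpace.single b (1 : ℝ), x p⟫ +
      ⟪EuclideanSpace.single b (1 : ℝ), N p⟫) * testFunction x N (EuclideanSpace.single b 1) p =
        sphereDefect x p * (((m : ℝ) + 1) * (1 + H * ⟪x p, N p⟫)) -
          ((m : ℝ) + 1) * (⟪x p, x p⟫ - ⟪x p, N p⟫ ^ 2) := by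
    intro p
    have hNN : ⟪N p, N p⟫ = 1 := by
      rw [real_inner_self_eq_norm_sq, h'.normal_norm]; norm_num
    have e : ∀ b, ((m : ℝ) + 1) * (H * ⟪EuclideanSpace.single b (1 : ℝ), x p⟫ +
      ⟪EuclideanSpace.single b (1 : ℝ), N p⟫) * testFunction x N (EuclideanSpace.single b 1) p =
        ((m : ℝ) + 1) * (H * ⟪x p, N p⟫ * (x p b * x p b) +
          (⟪x p, N p⟫ + H * (-(1 / 2) * ⟪x p, x p⟫ + -(1 / 2))) * (x p b * N p b) +
          (-(1 / 2) * ⟪x p, x p⟫ + -(1 / 2)) * (N p b * N p b)) := by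
      intro b
      simp only [testFunction, EuclideanSpace.inner_single_left, map_one, one_mul]
      ring
    rw [Finset.sum_congr rfl fun b _ => e b, ← Finset.mul_sum, Finset.sum_add_distrib,
      Finset.sum_add_distrib, ← Finset.mul_sum, ← Finset.mul_sum, ← Finset.mul_sum, ← hin, ← hin,
      ← hin, hNN, sphereDefect]
    ring
  simp_rw [hpt]
  have i1 : Integrable (fun p => sphereDefect x p * (((m : ℝ) + 1) * (1 + H * ⟪x p, N p⟫)))
      (area x) := h'.integrable_of_continuous (hcw.mul
        (continuous_const.mul (continuous_const.add (continuous_const.mul hcxN))))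
  have i2 : Integrable (fun p => ((m : ℝ) + 1) * (⟪x p, x p⟫ - ⟪x p, N p⟫ ^ 2)) (area x) :=
    h'.integrable_of_continuous (continuous_const.mul (hcxx.sub (hcxN.pow 2)))
  rw [integral_sub i1 i2, hD, integral_const_mul]
  ring

end Instability

end Capillary

end

theorem theorem1 {m : ℕ} {M : Type*} [TopologicalSpace M] [T2Space M] [CompactSpace M]
    [ChartedSpace (EuclideanHalfSpace (m + 1)) M] [IsManifold (𝓡∂ (m + 1)) ∞ M]
    [MeasurableSpace M] [BorelSpace M]
    (x N : M → EuclideanSpace ℝ (Fin (m + 2))) (θ : ℝ)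
    (hx : Capillary.IsCapillary x N θ)
    {k : ℕ} (T : Fin k → Set (EuclideanSpace ℝ (Fin (m + 2))))
    (hT : Capillary.IsGeneralizedBody x N T)
    (hcenter : Capillary.massCenter T = 0) :
    ¬ Capillary.IsWeaklyStable x N θ := by
  intro hs
  have : Nonempty M := ⟨hx.boundary_nonempty.some⟩
  have hi := hx.toIsImmersedInBall
  -- Stability would make every term of the trace nonnegative, while the trace is -(m + 2) times a
  -- positive integral.
  have h1 : 0 ≤ ∑ b, Capillary.secondVariation x N θ
      (Capillary.testFunction x N (EuclideanSpace.single b 1)) :=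
    Finset.sum_nonneg fun b _ => hs _
      (Capillary.contMDiff_testFunction hi.smooth hi.normal_smooth _)
      (hT.integral_testFunction hcenter hi _)
  rw [hx.sum_secondVariation] at h1
  have h2 := mul_pos (by positivity : (0 : ℝ) < (m : ℝ) + 2) hi.integral_inner_sq_pos
  linarith
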